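/- All homeomorphisms act on the right, so that $gh$ means "first $g$, then $h$", and $\mathrm{Supp}(f)=\{x : x\cdot f\neq x\}$. **Thompson's group.** Let $F$ be the group of orientation preserving piecewise linear homeomorphisms of $[0,1]$ with finitely many breakpoints, all lying in $\mathbf Z[\frac12]$, and whose derivatives, wherever they exist, are integer powers of $2$. Let $F'$ be its derived subgroup, and for $r<s$ let $F_{[r,s]}$ be the subgroup of the elements of $F$ whose support lies in $[r,s]$. Let $\iota(t)=1-t$ on $[0,1]$. Fix $c_0\in F$ with $\mathrm{Supp}(c_0)=(0,\frac14)$, with $t\cdot c_0>t$ for $t\in(0,\frac14)$ and $t\cdot c_0=2t$ for $t\in(0,\frac1{16})$. Put $c_1=\iota\circ c_0\circ\iota$ and $\nu_1=c_0c_1$. Fix homeomorphisms $\nu_2,\nu_3$ of $[0,1]$ with supports contained in $(\frac1{16},\frac{15}{16})$ that generate $F_{[\frac1{16},\frac{15}{16}]}$. **Labellings.** A labelling is a map $\rho:\frac12\mathbf Z\to\{a,b,a^{-1},b^{-1}\}$ with $\rho(k)\in\{a,a^{-1}\}$ for $k\in\mathbf Z$ and $\rho(k)\in\{b,b^{-1}\}$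 for $k\in\frac12\mathbf Z\setminus\mathbf Z$. A block is a set $X=\{k,k+\frac12,\dots,k+\frac n2\}$ with $k\in\frac12\mathbf Z$ and an integer $n\ge 0$; its size is $n+1$ and its word is $W_\rho(X)=\rho(k)\rho(k+\frac12)\cdots\rho(k+\frac n2)$. The formal inverse of a word $w_1\cdots w_m$ is $w_m^{-1}\cdots w_1^{-1}$. The labelling $\rho$ is quasi-periodic if (1) for each block $X$ there is an $N$ such that $W_\rho(X)$ is a string of consecutive letters of $W_\rho(Y)$ for every block $Y$ of size at least $N$, and (2) for each block $X$ there is a block $Y$ such that $W_\rho(Y)$ is the formal inverse of $W_\rho(X)$. **The group $G_\rho$.** For $i\in\{1,2,3\}$ let $\zeta_i$ and $\chi_i$ be the homeomorphisms of $\mathbf R$ such that, for every $n\in\mathbf Z$, the restriction of $\zeta_i$ to $[n,n+1]$ is the conjugate, by the translation $[0,1]\to[n,n+1]$, of $\nu_i$ if $\rho(n+\frac12)=b$ and of $\iota\circ\nu_i\circ\iota$ if $\rho(n+\frac12)=b^{-1}$, and the restriction of $\chi_i$ to $[n-\frac12,n+\frac12]$ is the conjugate, by the translation $[0,1]\to[n-\frac12,n+\frac12]$,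 of $\nu_i$ if $\rho(n)=a$ and of $\iota\circ\nu_i\circ\iota$ if $\rho(n)=a^{-1}$. Let $G_\rho=\langle\zeta_1,\zeta_2,\zeta_3,\chi_1,\chi_2,\chi_3\rangle<\mathrm{Homeo}^+(\mathbf R)$. **Proposition.** Let $\rho$ be a quasi-periodic labelling. For every $f\in G_\rho$ there are $g_1,g_2\in G_\rho$ such that: 1. $f=g_1g_2$; 2. $g_2$ is a commutator of two elements of $G_\rho$; 3. there are a subgroup $K$ of $G_\rho$ with $g_1\in K$ and an integer $n\geq 1$ such that $K$ is isomorphic to the direct sum $F'\oplus\cdots\oplus F'$ of $n$ copies of $F'$. -/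

import Mathlib

/-! ### Homeomorphisms of `[0,1]` and of the line

The orientation preserving homeomorphisms of `[0,1]` and of `ℝ` are exactly the order automorphisms,
so they are modelled by `unitInterval ≃o unitInterval` and `ℝ ≃o ℝ`. The product `g * f` of Mathlib's
group structure is the composite "first `f`, then `g`". -/

namespace SimpleLeftOrderable

/-- The support `{x | x · f ≠ x}`. -/
def supp {X : Type*} [LE X] (f : X ≃o X) : Set X := {x | f x ≠ x}

/-- The dyadic rationals `ℤ[1/2]`, as a set of real numbers. -/
def dyadic : Set ℝ := {x | ∃ (m : ℤ) (n : ℕ), x = (m : ℝ) / 2 ^ n}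

theorem dyadic_zero : (0 : ℝ) ∈ dyadic := ⟨0, 0, by simp⟩

theorem dyadic_add {x y : ℝ} (hx : x ∈ dyadic) (hy : y ∈ dyadic) : x + y ∈ dyadic := by
  obtain ⟨m, n, rfl⟩ := hx
  obtain ⟨m', n', rfl⟩ := hy
  refine ⟨m * 2 ^ n' + m' * 2 ^ n, n + n', ?_⟩
  push_cast
  rw [pow_add]
  field_simp

theorem dyadic_neg {x : ℝ} (hx : x ∈ dyadic) : -x ∈ dyadic := by
  obtain ⟨m, n, rfl⟩ := hx
  exact ⟨-m, n, by push_cast; ring⟩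

theorem dyadic_sub {x y : ℝ} (hx : x ∈ dyadic) (hy : y ∈ dyadic) : x - y ∈ dyadic := by
  rw [sub_eq_add_neg]; exact dyadic_add hx (dyadic_neg hy)

theorem dyadic_zpow_mul {x : ℝ} (k : ℤ) (hx : x ∈ dyadic) : (2 : ℝ) ^ k * x ∈ dyadic := by
  obtain ⟨m, n, rfl⟩ := hx
  obtain ⟨j, rfl | rfl⟩ := k.eq_nat_or_neg
  · refine ⟨m * 2 ^ j, n, ?_⟩
    push_cast
    rw [zpow_natCast]
    ring
  · refine ⟨m, n + j, ?_⟩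
    rw [zpow_neg, zpow_natCast, pow_add]
    field_simp

/-! ### Thompson's group `F` -/

/-- `f` is piecewise linear with respect to the finite set `S`: on every interval `[x, y]` without a
point of `S` in its interior, `f` is affine and its slope is an integer power of `2`. -/
def IsDyadicPL (S : Finset unitInterval) (f : unitInterval ≃o unitInterval) : Prop :=
  (∀ s ∈ S, (s : ℝ) ∈ dyadic) ∧
  ∀ x y : unitInterval, x < y → (∀ s ∈ S, ¬ (x < s ∧ s < y)) →
    ∃ k : ℤ, ∀ z : unitInterval, x ≤ z → z ≤ y →
      (f z : ℝ) = f x + (2 : ℝ) ^ k * ((z : ℝ) - x)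

theorem IsDyadicPL.exists_base {S : Finset unitInterval} {f : unitInterval ≃o unitInterval}
    (h : IsDyadicPL S f) (x : unitInterval) (hx : 0 < x) :
    ∃ s : unitInterval, s < x ∧ (s : ℝ) ∈ dyadic ∧ (S.filter (· < s)).card ≤ (S.filter (· < x)).card ∧
      (s = 0 ∨ (S.filter (· < s)).card < (S.filter (· < x)).card) ∧
      ∃ k : ℤ, (f x : ℝ) = f s + (2 : ℝ) ^ k * ((x : ℝ) - s) := by
  have key : ∀ s : unitInterval, s < x → (∀ t ∈ S, ¬ (s < t ∧ t < x)) →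
      ∃ k : ℤ, (f x : ℝ) = f s + (2 : ℝ) ^ k * ((x : ℝ) - s) := by
    intro s hs ht
    obtain ⟨k, hk⟩ := h.2 s x hs ht
    exact ⟨k, hk x hs.le le_rfl⟩
  by_cases hne : (S.filter (· < x)).Nonempty
  · set s := (S.filter (· < x)).max' hne with hsdef
    have hs := Finset.mem_filter.1 (Finset.max'_mem _ hne)
    have hlt : (S.filter (· < s)).card < (S.filter (· < x)).card := by
      apply Finset.card_lt_card
      refine ⟨fun t ht => ?_, fun hsub => ?_⟩
      · have := Finset.mem_filter.1 ht
        exact Finset.mem_filter.2 ⟨this.1, this.2.trans hs.2⟩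
      · have := Finset.mem_filter.1 (hsub (Finset.max'_mem _ hne))
        exact absurd this.2 (lt_irrefl _)
    refine ⟨s, hs.2, h.1 s hs.1, hlt.le, Or.inr hlt, key s hs.2 fun t ht hh => ?_⟩
    exact absurd (Finset.le_max' _ t (Finset.mem_filter.2 ⟨ht, hh.2⟩)) (not_le.2 hh.1)
  · refine ⟨0, hx, by simpa using dyadic_zero, ?_, Or.inl rfl, key 0 hx fun t ht hh => ?_⟩
    · apply Finset.card_le_card
      intro t ht
      have := Finset.mem_filter.1 ht
      exact Finset.mem_filter.2 ⟨this.1, this.2.trans hx⟩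
    · exact hne ⟨t, Finset.mem_filter.2 ⟨ht, hh.2⟩⟩

theorem map_zero' (f : unitInterval ≃o unitInterval) : f 0 = 0 := f.map_bot

theorem IsDyadicPL.map_dyadic {S : Finset unitInterval} {f : unitInterval ≃o unitInterval}
    (h : IsDyadicPL S f) : ∀ x : unitInterval, (x : ℝ) ∈ dyadic → (f x : ℝ) ∈ dyadic := by
  have aux : ∀ n : ℕ, ∀ x : unitInterval, (S.filter (· < x)).card = n →
      (x : ℝ) ∈ dyadic → (f x : ℝ) ∈ dyadic := by
    intro n
    induction n using Nat.strong_induction_on with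
    | _ n ih =>
      intro x hn hx
      rcases (show (0 : unitInterval) ≤ x from bot_le).eq_or_lt with h0 | h0
      · rw [← h0, map_zero']; simpa using dyadic_zero
      obtain ⟨s, -, hsd, -, hs, k, hk⟩ := h.exists_base x h0
      have hfs : (f s : ℝ) ∈ dyadic := by
        rcases hs with rfl | hs
        · rw [map_zero']; simpa using dyadic_zero
        · exact ih _ (hn ▸ hs) s rfl hsd
      rw [hk]
      exact dyadic_add hfs (dyadic_zpow_mul k (dyadic_sub hx hsd))
  exact fun x => aux _ x rfl

theorem IsDyadicPL.dyadic_of_map {S : Finset unitInterval} {f : unitInterval ≃o unitInterval}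
    (h : IsDyadicPL S f) (x : unitInterval) (hx : (f x : ℝ) ∈ dyadic) : (x : ℝ) ∈ dyadic := by
  rcases (show (0 : unitInterval) ≤ x from bot_le).eq_or_lt with h0 | h0
  · rw [← h0]; simpa using dyadic_zero
  obtain ⟨s, -, hsd, -, -, k, hk⟩ := h.exists_base x h0
  have h2 : (2 : ℝ) ^ k ≠ 0 := zpow_ne_zero _ two_ne_zero
  have : (x : ℝ) = s + (2 : ℝ) ^ (-k) * ((f x : ℝ) - f s) := by
    rw [hk, zpow_neg]; field_simp; ring
  rw [this]
  exact dyadic_add hsd (dyadic_zpow_mul _ (dyadic_sub hx (h.map_dyadic s hsd)))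

/-- Thompson's group `F`: the piecewise linear orientation preserving homeomorphisms of `[0,1]` with
finitely many breakpoints, all of them dyadic rationals, and with all slopes powers of `2`. -/
def thompsonF : Subgroup (unitInterval ≃o unitInterval) where
  carrier := {f | ∃ S : Finset unitInterval, IsDyadicPL S f}
  one_mem' := ⟨∅, by simp, fun x y _ _ => ⟨0, fun z _ _ => by simp⟩⟩
  mul_mem' := by
    classical
    rintro f g ⟨S, hS⟩ ⟨T, hT⟩
    refine ⟨T ∪ S.image g.symm, ?_, ?_⟩
    · intro s hs
      rcases Finset.mem_union.1 hs with hs | hs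
      · exact hT.1 s hs
      · obtain ⟨t, ht, rfl⟩ := Finset.mem_image.1 hs
        exact hT.dyadic_of_map _ (by simpa using hS.1 t ht)
    · intro x y hxy hno
      obtain ⟨k, hk⟩ := hT.2 x y hxy fun s hs => hno s (Finset.mem_union_left _ hs)
      obtain ⟨l, hl⟩ := hS.2 (g x) (g y) (g.lt_iff_lt.2 hxy) fun s hs hh =>
        hno (g.symm s) (Finset.mem_union_right _ (Finset.mem_image_of_mem _ hs))
          ⟨by rw [← g.lt_iff_lt]; simpa using hh.1, by rw [← g.lt_iff_lt]; simpa using hh.2⟩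
      refine ⟨l + k, fun z hxz hzy => ?_⟩
      have h1 := hl (g z) (g.monotone hxz) (g.monotone hzy)
      have h2 := hk z hxz hzy
      change (f (g z) : ℝ) = f (g x) + _
      rw [h1, h2, zpow_add₀ two_ne_zero]
      ring
  inv_mem' := by
    classical
    rintro f ⟨S, hS⟩
    refine ⟨S.image f, ?_, ?_⟩
    · intro s hs
      obtain ⟨t, ht, rfl⟩ := Finset.mem_image.1 hs
      exact hS.map_dyadic t (hS.1 t ht)
    · intro x y hxy hno
      obtain ⟨k, hk⟩ := hS.2 (f.symm x) (f.symm y) (f.symm.lt_iff_lt.2 hxy) fun s hs hh =>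
        hno (f s) (Finset.mem_image_of_mem _ hs)
          ⟨by rw [← f.symm.lt_iff_lt]; simpa using hh.1, by rw [← f.symm.lt_iff_lt]; simpa using hh.2⟩
      refine ⟨-k, fun z hxz hzy => ?_⟩
      have h1 := hk (f.symm z) (f.symm.monotone hxz) (f.symm.monotone hzy)
      simp only [OrderIso.apply_symm_apply] at h1
      change (f.symm z : ℝ) = f.symm x + _
      have h2 : (2 : ℝ) ^ k ≠ 0 := zpow_ne_zero _ two_ne_zero
      rw [h1, zpow_neg]
      field_simp
      ring

/-- `F_{[r,s]}`: the elements of `F` with support in `[r,s]`. -/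
def thompsonFOn (r s : ℝ) : Subgroup (unitInterval ≃o unitInterval) where
  carrier := {f | f ∈ thompsonF ∧ ∀ x ∈ supp f, (x : ℝ) ∈ Set.Icc r s}
  one_mem' := ⟨thompsonF.one_mem, fun _ hx => absurd rfl hx⟩
  mul_mem' := by
    rintro f g ⟨hf, hf'⟩ ⟨hg, hg'⟩
    refine ⟨thompsonF.mul_mem hf hg, fun x hx => ?_⟩
    by_cases h : g x = x
    · exact hf' x fun h' => hx (by change f (g x) = x; rw [h, h'])
    · exact hg' x h
  inv_mem' := by
    rintro f ⟨hf, hf'⟩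
    refine ⟨thompsonF.inv_mem hf, fun x hx => hf' x fun h => hx ?_⟩
    change f.symm x = x
    rw [OrderIso.symm_apply_eq, h]

/-- The conjugate `ι ∘ f ∘ ι` of `f` by the orientation reversing isometry `ι t = 1 - t`. -/
def flipConj (f : unitInterval ≃o unitInterval) : unitInterval ≃o unitInterval where
  toFun t := unitInterval.symm (f (unitInterval.symm t))
  invFun t := unitInterval.symm (f.symm (unitInterval.symm t))
  left_inv t := by simp
  right_inv t := by simp
  map_rel_iff' := by
    intro s t
    change unitInterval.symm _ ≤ unitInterval.symm _ ↔ _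
    rw [unitInterval.symm_le_symm, f.le_iff_le, unitInterval.symm_le_symm]

/-- The conditions on the element `c₀` of `F`. -/
structure IsBaseElement (c₀ : unitInterval ≃o unitInterval) : Prop where
  mem : c₀ ∈ thompsonF
  supp_eq : supp c₀ = {t | (0 : ℝ) < t ∧ (t : ℝ) < 1 / 4}
  lt_apply : ∀ t : unitInterval, (0 : ℝ) < t → (t : ℝ) < 1 / 4 → t < c₀ t
  apply_eq : ∀ t : unitInterval, (0 : ℝ) < t → (t : ℝ) < 1 / 16 → (c₀ t : ℝ) = 2 * t

/-- The symmetric element `ν₁ = c₀ c₁`, where `c₁ = ι ∘ c₀ ∘ ι`. (If the support of `c₀` is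
`(0, 1/4)` then `c₀` and `c₁` commute.) -/
def nu₁ (c₀ : unitInterval ≃o unitInterval) : unitInterval ≃o unitInterval := flipConj c₀ * c₀

/-- `ν₂, ν₃` have support in `(1/16, 15/16)` and generate `F_{[1/16, 15/16]}`. -/
structure IsMiddlePair (ν₂ ν₃ : unitInterval ≃o unitInterval) : Prop where
  supp₂ : supp ν₂ ⊆ {t | (1 / 16 : ℝ) < t ∧ (t : ℝ) < 15 / 16}
  supp₃ : supp ν₃ ⊆ {t | (1 / 16 : ℝ) < t ∧ (t : ℝ) < 15 / 16}
  closure_eq : Subgroup.closure {ν₂, ν₃} = thompsonFOn (1 / 16) (15 / 16)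

/-! ### Labellings -/

/-- The four letters `a, b, a⁻¹, b⁻¹`. -/
inductive Letter : Type
  | a : Letter
  | b : Letter
  | aInv : Letter
  | bInv : Letter

/-- The formal inverse of a letter. -/
def Letter.inv : Letter → Letter
  | .a => .aInv
  | .b => .bInv
  | .aInv => .a
  | .bInv => .b

/-- The formal inverse `wₙ⁻¹ ⋯ w₁⁻¹` of a word `w₁ ⋯ wₙ`. -/
def wordInv (w : List Letter) : List Letter := (w.map Letter.inv).reverse

/-- A map `½ℤ → {a, b, a⁻¹, b⁻¹}` is encoded as `ρ : ℤ → Letter`, where `ρ k` is the label of the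
half integer `k / 2`; even `k` stand for the integers, odd `k` for the elements of `½ℤ ∖ ℤ`. It is a
labelling if integers are labelled by `a^{±1}` and the other points by `b^{±1}`. -/
def IsLabelling (ρ : ℤ → Letter) : Prop :=
  (∀ k : ℤ, Even k → ρ k = .a ∨ ρ k = .aInv) ∧ (∀ k : ℤ, Odd k → ρ k = .b ∨ ρ k = .bInv)

/-- The word `ρ(k/2) ρ((k+1)/2) ⋯ ρ((k+n)/2)` of the block `{k/2, (k+1)/2, …, (k+n)/2}` of size
`n + 1`. -/
def blockWord (ρ : ℤ → Letter) (k : ℤ) (n : ℕ) : List Letter :=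
  (List.range (n + 1)).map fun i => ρ (k + (i : ℤ))

/-- Quasi-periodicity: the word of each block occurs as a string of consecutive letters (`<:+:`) in
the word of every sufficiently large block, and its formal inverse is the word of some block. -/
def IsQuasiPeriodic (ρ : ℤ → Letter) : Prop :=
  (∀ (k : ℤ) (n : ℕ), ∃ N : ℕ, ∀ (k' : ℤ) (n' : ℕ), N ≤ n' + 1 →
    blockWord ρ k n <:+: blockWord ρ k' n') ∧
  (∀ (k : ℤ) (n : ℕ), ∃ (k' : ℤ) (n' : ℕ), blockWord ρ k' n' = wordInv (blockWord ρ k n))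

/-! ### The group `G_ρ` -/

theorem fract_mem (x : ℝ) : Int.fract x ∈ unitInterval :=
  ⟨Int.fract_nonneg x, (Int.fract_lt_one x).le⟩

/-- The underlying map of `glue`. -/
noncomputable def glueFun (ν : ℤ → (unitInterval ≃o unitInterval)) (x : ℝ) : ℝ :=
  (⌊x⌋ : ℝ) + (ν ⌊x⌋ ⟨Int.fract x, fract_mem x⟩ : ℝ)

theorem apply_lt_one (f : unitInterval ≃o unitInterval) (t : unitInterval) (ht : (t : ℝ) < 1) :
    (f t : ℝ) < 1 := by
  have h1 : f 1 = 1 := f.map_top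
  have : f t < f 1 := f.lt_iff_lt.2 (Subtype.coe_lt_coe.1 (by simpa using ht))
  rw [h1] at this
  simpa using Subtype.coe_lt_coe.2 this

/-- On `[n, n + 1]`, the map `glueFun ν` is `ν n`, transported by the translation by `n`. -/
theorem glueFun_apply (ν : ℤ → (unitInterval ≃o unitInterval)) (n : ℤ) (t : unitInterval) :
    glueFun ν (n + t) = n + ν n t := by
  rcases (t.2.2 : (t : ℝ) ≤ 1).eq_or_lt with h | h
  · have ht : t = 1 := Subtype.ext h
    subst ht
    have hf : ⌊(n : ℝ) + ((1 : unitInterval) : ℝ)⌋ = n + 1 := by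
      rw [Set.Icc.coe_one]
      exact_mod_cast Int.floor_intCast (R := ℝ) (n + 1)
    have hz : (⟨Int.fract ((n : ℝ) + ((1 : unitInterval) : ℝ)), fract_mem _⟩ : unitInterval) = 0 := by
      apply Subtype.ext
      simp
    have h1 : ν n 1 = 1 := (ν n).map_top
    unfold glueFun
    rw [hz, map_zero', hf, h1]
    push_cast
    simp
  · have hf : ⌊(n : ℝ) + (t : ℝ)⌋ = n := by
      rw [Int.floor_eq_iff]
      exact ⟨by linarith [t.2.1], by linarith⟩
    have hz : (⟨Int.fract ((n : ℝ) + (t : ℝ)), fract_mem _⟩ : unitInterval) = t := by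
      apply Subtype.ext
      change Int.fract ((n : ℝ) + (t : ℝ)) = t
      rw [Int.fract, hf]; ring
    unfold glueFun
    rw [hz, hf]

theorem glueFun_inv (ν : ℤ → (unitInterval ≃o unitInterval)) (x : ℝ) :
    glueFun (fun n => (ν n).symm) (glueFun ν x) = x := by
  change glueFun _ ((⌊x⌋ : ℝ) + _) = x
  rw [glueFun_apply, OrderIso.symm_apply_apply]
  exact Int.floor_add_fract x

theorem glueFun_mono (ν : ℤ → (unitInterval ≃o unitInterval)) : Monotone (glueFun ν) := by
  intro x y hxy
  rcases (Int.floor_mono hxy).eq_or_lt with h | h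
  · have hm : (ν ⌊x⌋ ⟨Int.fract x, fract_mem x⟩ : ℝ) ≤ ν ⌊x⌋ ⟨Int.fract y, fract_mem y⟩ := by
      apply (ν ⌊x⌋).monotone
      change Int.fract x ≤ Int.fract y
      rw [Int.fract, Int.fract, h]
      linarith
    unfold glueFun
    rw [← h]
    linarith
  · have h1 : ((⌊x⌋ : ℝ)) + 1 ≤ ⌊y⌋ := by exact_mod_cast h
    have h2 := (ν ⌊x⌋ ⟨Int.fract x, fract_mem x⟩).2.2
    have h3 := (ν ⌊y⌋ ⟨Int.fract y, fract_mem y⟩).2.1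
    unfold glueFun
    linarith

/-- The homeomorphism of `ℝ` that preserves each `[n, n + 1]`, `n ∈ ℤ`, and acts on it as `ν n`. -/
noncomputable def glue (ν : ℤ → (unitInterval ≃o unitInterval)) : ℝ ≃o ℝ where
  toFun := glueFun ν
  invFun := glueFun fun n => (ν n).symm
  left_inv := glueFun_inv ν
  right_inv := glueFun_inv fun n => (ν n).symm
  map_rel_iff' := by
    intro x y
    refine ⟨fun h => ?_, fun h => glueFun_mono ν h⟩
    have := glueFun_mono (fun n => (ν n).symm) h
    change glueFun (fun n => (ν n).symm) (glueFun ν x) ≤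
      glueFun (fun n => (ν n).symm) (glueFun ν y) at this
    rwa [glueFun_inv, glueFun_inv] at this

/-- The homeomorphism of `ℝ` that preserves each `[n - 1/2, n + 1/2]`, `n ∈ ℤ`, and acts on it as
`ν n`: the conjugate of `glue ν` by the translation by `-1/2`. -/
noncomputable def glueHalf (ν : ℤ → (unitInterval ≃o unitInterval)) : ℝ ≃o ℝ :=
  ((OrderIso.addRight (1 / 2 : ℝ)).trans (glue ν)).trans (OrderIso.addRight (-(1 / 2) : ℝ))

theorem glue_apply (ν : ℤ → (unitInterval ≃o unitInterval)) (n : ℤ) (t : unitInterval) :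
    glue ν (n + t) = n + ν n t := glueFun_apply ν n t

theorem glueHalf_apply (ν : ℤ → (unitInterval ≃o unitInterval)) (n : ℤ) (t : unitInterval) :
    glueHalf ν (n - 1 / 2 + t) = n - 1 / 2 + ν n t := by
  change glueFun ν ((n : ℝ) - 1 / 2 + t + 1 / 2) + -(1 / 2) = _
  rw [show (n : ℝ) - 1 / 2 + t + 1 / 2 = n + t by ring, glueFun_apply]
  ring

/-- `f` for the letters `a, b`, and `ι ∘ f ∘ ι` for the letters `a⁻¹, b⁻¹`. -/
def orient (l : Letter) (f : unitInterval ≃o unitInterval) : unitInterval ≃o unitInterval :=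
  match l with
  | .a => f
  | .b => f
  | .aInv => flipConj f
  | .bInv => flipConj f

/-- The homeomorphism `ζ` attached to `ν`: on `[n, n + 1]` it is a translated copy of `ν` if
`ρ(n + 1/2) = b`, and of `ι ∘ ν ∘ ι` if `ρ(n + 1/2) = b⁻¹`. -/
noncomputable def zeta (ρ : ℤ → Letter) (ν : unitInterval ≃o unitInterval) : ℝ ≃o ℝ :=
  glue fun n => orient (ρ (2 * n + 1)) ν

/-- The homeomorphism `χ` attached to `ν`: on `[n - 1/2, n + 1/2]` it is a translated copy of `ν` if
`ρ(n) = a`, and of `ι ∘ ν ∘ ι` if `ρ(n) = a⁻¹`. -/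
noncomputable def chi (ρ : ℤ → Letter) (ν : unitInterval ≃o unitInterval) : ℝ ≃o ℝ :=
  glueHalf fun n => orient (ρ (2 * n)) ν

/-- The group `G_ρ = ⟨ζ₁, ζ₂, ζ₃, χ₁, χ₂, χ₃⟩`, for the chosen `c₀, ν₂, ν₃`. -/
noncomputable def simpleGroup (ρ : ℤ → Letter) (c₀ ν₂ ν₃ : unitInterval ≃o unitInterval) :
    Subgroup (ℝ ≃o ℝ) :=
  Subgroup.closure
    {zeta ρ (nu₁ c₀), zeta ρ ν₂, zeta ρ ν₃, chi ρ (nu₁ c₀), chi ρ ν₂, chi ρ ν₃}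

end SimpleLeftOrderable

namespace SimpleLeftOrderable

/-! ### Piecewise linear homeomorphisms of the line -/

/-! Every element of `G_ρ` lies in `localGroup ρ`: its displacement is bounded, on bounded intervals
it agrees with elements of `dyadicPL`, and for some radius `r` it commutes at `y` with every
isometry `x ↦ ±x + m` respecting the labels within `r` of `y` (reflections have to invert the
letters). Quasi-periodicity supplies a reflection respecting the labels near `0`; it reverses the
displacement of `f`, so `f` has a fixed point (`exists_fixed_point`). Just to the right of that
point `f` agrees on an interval with a commutator (`exists_commutator_eqOn`). This commutator is
`g₂`, and `g₁ = g₂⁻¹ * f` is the identity on the interval.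

Let `p` be the midpoint of the interval. The images of `p` under the isometries respecting the
labels within `c` of `p`, called marks, are discrete and relatively dense. For `c` large, `g₁` is
the identity near each mark, so it preserves the gaps between consecutive marks. Up to
label-respecting isometries there are finitely many gaps (`finite_gap_classes`), and `g₁` acts in
the same way on equivalent ones. Hence `g₁` is given by a finite family of compactly supported
piecewise linear maps, one for each class (`exists_gapSpread_of_eqOn`). The group `K` consists of
the homeomorphisms given by all such families. Two points remain: each factor is `F'`, and `K` lies
in `G_ρ`.

For the first, `F'` is the group of elements of `F` trivial near `0` and `1`
(`map_commutator_thompsonF`). Commutators are trivial there because the germs at an endpoint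
commute; the converse is the perfectness `compactPL_Ioo_le_commutator`, obtained by factoring into
elementary stretches and counting them modulo commutators.

For the second, the generators yield a copy of `compactF` acting over all occurrences of one letter
(`compactF_le`). If one element acts over the occurrences of a set of labels `B` and another over
those of `C`, their commutator acts only where both occur. By perfectness these commutators give all
patterns on a half interval (`compactPL_le_spreadGroup_union`). Conjugation by one-letter elements
then moves supports through the block and along a gap (`IsGap.compactPL_le_spreadGroup`). -/

@[simp] theorem orderIso_mul_apply {X : Type*} [LE X] (f g : X ≃o X) (x : X) :
    (f * g) x = f (g x) := rfl

@[simp] theorem orderIso_one_apply {X : Type*} [LE X] (x : X) : (1 : X ≃o X) x = x := rfl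

@[simp] theorem orderIso_inv_apply_self {X : Type*} [LE X] (f : X ≃o X) (x : X) :
    f⁻¹ (f x) = x := f.symm_apply_apply x

@[simp] theorem orderIso_apply_inv_self {X : Type*} [LE X] (f : X ≃o X) (x : X) :
    f (f⁻¹ x) = x := f.apply_symm_apply x

theorem orderIso_inv_apply_eq {X : Type*} [LE X] (f : X ≃o X) {x y : X} :
    f⁻¹ x = y ↔ x = f y := f.symm_apply_eq

theorem two_zpow_pos (k : ℤ) : (0 : ℝ) < 2 ^ k := zpow_pos two_pos k

theorem dyadic_intCast (m : ℤ) : (m : ℝ) ∈ dyadic := ⟨m, 0, by simp⟩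

theorem dyadic_half_intCast (m : ℤ) : (m : ℝ) / 2 ∈ dyadic := ⟨m, 1, by simp⟩

theorem dyadic_mul_zpow_iff {x : ℝ} (k : ℤ) : (2 : ℝ) ^ k * x ∈ dyadic ↔ x ∈ dyadic := by
  refine ⟨fun h => ?_, dyadic_zpow_mul k⟩
  have := dyadic_zpow_mul (-k) h
  rwa [← mul_assoc, ← zpow_add₀ two_ne_zero, neg_add_cancel, zpow_zero, one_mul] at this

theorem dyadic_add_iff {x d : ℝ} (hd : d ∈ dyadic) : x + d ∈ dyadic ↔ x ∈ dyadic :=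
  ⟨fun h => by simpa using dyadic_sub h hd, fun h => dyadic_add h hd⟩

theorem exists_dyadic_between {x y : ℝ} (h : x < y) : ∃ d ∈ dyadic, x < d ∧ d < y := by
  obtain ⟨n, hn⟩ := exists_pow_lt_of_lt_one (sub_pos.2 h) (by norm_num : (1 / 2 : ℝ) < 1)
  have h2 : (0 : ℝ) < 2 ^ n := by positivity
  have hn' : 1 < (y - x) * 2 ^ n := by
    rw [one_div, inv_pow] at hn
    rwa [← inv_lt_iff_one_lt_mul₀ h2]
  refine ⟨(⌊x * 2 ^ n⌋ + 1 : ℤ) / 2 ^ n, ⟨_, n, rfl⟩, ?_, ?_⟩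
  · rw [lt_div_iff₀ h2]
    push_cast
    exact Int.lt_floor_add_one _
  · rw [div_lt_iff₀ h2]
    push_cast
    have := Int.floor_le (x * 2 ^ n)
    nlinarith

/-- On `[x, y]` the map `f` is affine with slope an integer power of `2`. -/
def IsTwoAffine (f : ℝ → ℝ) (x y : ℝ) : Prop :=
  ∃ k : ℤ, ∀ z, x ≤ z → z ≤ y → f z = f x + (2 : ℝ) ^ k * (z - x)

theorem IsTwoAffine.congr {f g : ℝ → ℝ} {x y : ℝ} (hxy : x ≤ y) (h : IsTwoAffine g x y)
    (hfg : ∀ z, x ≤ z → z ≤ y → f z = g z) : IsTwoAffine f x y := by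
  obtain ⟨k, hk⟩ := h
  exact ⟨k, fun z h1 h2 => by rw [hfg z h1 h2, hfg x le_rfl hxy, hk z h1 h2]⟩

/-- The group of piecewise linear homeomorphisms of the line with finitely many breakpoints, all
dyadic, with slopes powers of `2`, which preserve the dyadic rationals. -/
def dyadicPL : Subgroup (ℝ ≃o ℝ) where
  carrier := {f | (∀ x, f x ∈ dyadic ↔ x ∈ dyadic) ∧
    ∃ S : Finset ℝ, (∀ s ∈ S, s ∈ dyadic) ∧
      ∀ x y : ℝ, x < y → (∀ s ∈ S, ¬ (x < s ∧ s < y)) → IsTwoAffine f x y}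
  one_mem' := ⟨fun _ => Iff.rfl, ∅, by simp, fun x y _ _ => ⟨0, fun z _ _ => by simp⟩⟩
  mul_mem' := by
    classical
    rintro f g ⟨hf, S, hS, hSf⟩ ⟨hg, T, hT, hTg⟩
    refine ⟨fun x => (hf _).trans (hg x), T ∪ S.image g.symm, fun s hs => ?_, fun x y hxy hno => ?_⟩
    · rcases Finset.mem_union.1 hs with hs | hs
      · exact hT s hs
      · obtain ⟨t, ht, rfl⟩ := Finset.mem_image.1 hs
        rw [← hg]
        simpa using hS t ht
    · obtain ⟨k, hk⟩ := hTg x y hxy fun s hs => hno s (Finset.mem_union_left _ hs)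
      obtain ⟨l, hl⟩ := hSf (g x) (g y) (g.lt_iff_lt.2 hxy) fun s hs hh =>
        hno (g.symm s) (Finset.mem_union_right _ (Finset.mem_image_of_mem _ hs))
          ⟨by rw [← g.lt_iff_lt]; simpa using hh.1, by rw [← g.lt_iff_lt]; simpa using hh.2⟩
      refine ⟨l + k, fun z hxz hzy => ?_⟩
      rw [orderIso_mul_apply, orderIso_mul_apply, hl (g z) (g.monotone hxz) (g.monotone hzy),
        hk z hxz hzy, zpow_add₀ two_ne_zero]
      ring
  inv_mem' := by
    classical
    rintro f ⟨hf, S, hS, hSf⟩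
    refine ⟨fun x => ?_, S.image f, fun s hs => ?_, fun x y hxy hno => ?_⟩
    · rw [← hf, orderIso_apply_inv_self]
    · obtain ⟨t, ht, rfl⟩ := Finset.mem_image.1 hs
      exact (hf t).2 (hS t ht)
    · obtain ⟨k, hk⟩ := hSf (f.symm x) (f.symm y) (f.symm.lt_iff_lt.2 hxy) fun s hs hh =>
        hno (f s) (Finset.mem_image_of_mem _ hs)
          ⟨by rw [← f.symm.lt_iff_lt]; simpa using hh.1, by rw [← f.symm.lt_iff_lt]; simpa using hh.2⟩
      refine ⟨-k, fun z hxz hzy => ?_⟩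
      have h1 := hk (f.symm z) (f.symm.monotone hxz) (f.symm.monotone hzy)
      simp only [OrderIso.apply_symm_apply] at h1
      change f.symm z = f.symm x + _
      have h2 : (2 : ℝ) ^ k ≠ 0 := zpow_ne_zero _ two_ne_zero
      have h3 : f.symm z - f.symm x = (2 ^ k : ℝ)⁻¹ * (z - x) := by
        rw [eq_inv_mul_iff_mul_eq₀ h2]
        linarith
      rw [zpow_neg]
      linarith

/-- The affine map `x ↦ 2 ^ k * x + d`. -/
noncomputable def affineMap (k : ℤ) (d : ℝ) : ℝ ≃o ℝ where
  toFun x := 2 ^ k * x + d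
  invFun x := 2 ^ (-k) * (x - d)
  left_inv x := by
    have := (two_zpow_pos k).ne'
    rw [zpow_neg]; field_simp; ring
  right_inv x := by
    have := (two_zpow_pos k).ne'
    rw [zpow_neg]; field_simp; ring
  map_rel_iff' := by
    intro x y
    have := two_zpow_pos k
    simp [this]

@[simp] theorem affineMap_apply (k : ℤ) (d x : ℝ) : affineMap k d x = 2 ^ k * x + d := rfl

theorem affineMap_mem (k : ℤ) {d : ℝ} (hd : d ∈ dyadic) : affineMap k d ∈ dyadicPL :=
  ⟨fun x => by rw [affineMap_apply, dyadic_add_iff hd, dyadic_mul_zpow_iff], ∅, by simp,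
    fun x y _ _ => ⟨k, fun z _ _ => by simp only [affineMap_apply]; ring⟩⟩

theorem join_strictMono (a : ℝ) (f g : ℝ ≃o ℝ) (h : f a = g a) :
    StrictMono fun x => if x ≤ a then f x else g x := by
  intro x y hxy
  dsimp only
  split_ifs with h1 h2 h2
  · exact f.strictMono hxy
  · exact (f.monotone h1).trans_lt (h ▸ g.strictMono (not_le.1 h2))
  · exact absurd (hxy.le.trans h2) h1
  · exact g.strictMono hxy

theorem join_surjective (a : ℝ) (f g : ℝ ≃o ℝ) (h : f a = g a) :
    Function.Surjective fun x => if x ≤ a then f x else g x := by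
  intro y
  by_cases hy : y ≤ f a
  · refine ⟨f.symm y, ?_⟩
    have : f.symm y ≤ a := by rw [OrderIso.symm_apply_le]; exact hy
    simp [this]
  · refine ⟨g.symm y, ?_⟩
    have : ¬ g.symm y ≤ a := by rw [OrderIso.symm_apply_le, ← h]; exact hy
    simp [this]

/-- The homeomorphism which agrees with `f` on `(-∞, a]` and with `g` on `[a, ∞)`. -/
noncomputable def join (a : ℝ) (f g : ℝ ≃o ℝ) (h : f a = g a) : ℝ ≃o ℝ :=
  StrictMono.orderIsoOfSurjective _ (join_strictMono a f g h) (join_surjective a f g h)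

theorem join_of_le {a : ℝ} {f g : ℝ ≃o ℝ} (h : f a = g a) {x : ℝ} (hx : x ≤ a) :
    join a f g h x = f x := by
  change (if x ≤ a then f x else g x) = _
  simp [hx]

theorem join_of_ge {a : ℝ} {f g : ℝ ≃o ℝ} (h : f a = g a) {x : ℝ} (hx : a ≤ x) :
    join a f g h x = g x := by
  change (if x ≤ a then f x else g x) = _
  split_ifs with h1
  · rw [le_antisymm h1 hx, h]
  · rfl

theorem join_mem {a : ℝ} (ha : a ∈ dyadic) {f g : ℝ ≃o ℝ} (h : f a = g a) (hf : f ∈ dyadicPL)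
    (hg : g ∈ dyadicPL) : join a f g h ∈ dyadicPL := by
  classical
  obtain ⟨hf, S, hS, hSf⟩ := hf
  obtain ⟨hg, T, hT, hTg⟩ := hg
  refine ⟨fun x => ?_, insert a (S ∪ T), fun s hs => ?_, fun x y hxy hno => ?_⟩
  · rcases le_total x a with hx | hx
    · rw [join_of_le h hx, hf]
    · rw [join_of_ge h hx, hg]
  · rcases Finset.mem_insert.1 hs with rfl | hs
    · exact ha
    · exact (Finset.mem_union.1 hs).elim (hS s) (hT s)
  · rcases le_or_gt y a with hy | hy
    · refine (hSf x y hxy fun s hs => hno s (by simp [hs])).congr hxy.le fun z _ h2 => ?_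
      exact join_of_le h (h2.trans hy)
    · have hx : a ≤ x := not_lt.1 fun hx => hno a (by simp) ⟨hx, hy⟩
      refine (hTg x y hxy fun s hs => hno s (by simp [hs])).congr hxy.le fun z h1 _ => ?_
      exact join_of_ge h (hx.trans h1)

/-- The homeomorphism which is the identity on `(-∞, i]`, has slope `2 ^ k` on `[i, i + 1]` and is a
translation on `[i + 1, ∞)`. -/
noncomputable def stretch (i : ℤ) (k : ℕ) : ℝ ≃o ℝ :=
  join i 1 (join (i + 1) (affineMap k (i - 2 ^ k * i)) (affineMap 0 (2 ^ k - 1))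
    (by simp; ring)) (by rw [join_of_le _ (by linarith)]; simp)

theorem stretch_of_le {i : ℤ} {k : ℕ} {x : ℝ} (hx : x ≤ i) : stretch i k x = x := by
  rw [stretch, join_of_le _ hx, orderIso_one_apply]

theorem stretch_of_mem {i : ℤ} {k : ℕ} {x : ℝ} (hx : (i : ℝ) ≤ x) (hx' : x ≤ i + 1) :
    stretch i k x = i + 2 ^ k * (x - i) := by
  rw [stretch, join_of_ge _ hx, join_of_le _ hx', affineMap_apply, zpow_natCast]
  ring

theorem stretch_of_ge {i : ℤ} {k : ℕ} {x : ℝ} (hx : (i : ℝ) + 1 ≤ x) :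
    stretch i k x = x + (2 ^ k - 1) := by
  rw [stretch, join_of_ge _ (by linarith), join_of_ge _ hx, affineMap_apply, zpow_zero, one_mul]

theorem stretch_mem (i : ℤ) (k : ℕ) : stretch i k ∈ dyadicPL := by
  have h1 : (i : ℝ) + 1 ∈ dyadic := by exact_mod_cast dyadic_intCast (i + 1)
  have h2 : (i : ℝ) - 2 ^ k * i ∈ dyadic := by exact_mod_cast dyadic_intCast (i - 2 ^ k * i)
  have h3 : (2 : ℝ) ^ k - 1 ∈ dyadic := by exact_mod_cast dyadic_intCast (2 ^ k - 1)
  exact join_mem (dyadic_intCast i) _ (one_mem _)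
    (join_mem h1 _ (affineMap_mem _ h2) (affineMap_mem _ h3))

/-- Each application of `stretch 0 1` fixes `0` and translates `[1, ∞)` by one, so it lengthens the
interval by one. -/
theorem exists_mem_map_natCast (m n : ℕ) :
    ∃ α ∈ dyadicPL, α 0 = 0 ∧ α ((m : ℝ) + 1) = (m : ℝ) + 1 + n := by
  induction n with
  | zero => exact ⟨1, one_mem _, rfl, by simp⟩
  | succ n ih =>
    obtain ⟨α, hα, h0, h1⟩ := ih
    refine ⟨stretch 0 1 * α, mul_mem (stretch_mem _ _) hα, ?_, ?_⟩
    · rw [orderIso_mul_apply, h0, stretch_of_le (by simp)]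
    · have hm : (0 : ℝ) ≤ m := m.cast_nonneg
      have hn : (0 : ℝ) ≤ n := n.cast_nonneg
      rw [orderIso_mul_apply, h1, stretch_of_ge (by push_cast; linarith)]
      push_cast
      ring

theorem exists_mem_map_pos_natCast {m n : ℕ} (hm : 0 < m) (hn : 0 < n) :
    ∃ α ∈ dyadicPL, α 0 = 0 ∧ α m = n := by
  wlog h : m ≤ n generalizing m n
  · obtain ⟨α, hα, h0, h1⟩ := this hn hm (by omega)
    exact ⟨α⁻¹, inv_mem hα, by rw [orderIso_inv_apply_eq, h0], by rw [orderIso_inv_apply_eq, h1]⟩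
  obtain ⟨α, hα, h0, h1⟩ := exists_mem_map_natCast (m - 1) (n - m)
  refine ⟨α, hα, h0, ?_⟩
  rw [Nat.cast_sub hm, Nat.cast_sub h] at h1
  simpa using h1

theorem dyadic_pos_eq {x : ℝ} (hx : x ∈ dyadic) (h0 : 0 < x) :
    ∃ (m n : ℕ), 0 < m ∧ (2 : ℝ) ^ (n : ℤ) * x = m := by
  obtain ⟨m, n, rfl⟩ := hx
  have h2 : (0 : ℝ) < 2 ^ n := by positivity
  have hm : 0 < m := by
    rw [div_pos_iff_of_pos_right h2] at h0
    exact_mod_cast h0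
  refine ⟨m.toNat, n, by omega, ?_⟩
  rw [show ((m.toNat : ℕ) : ℝ) = m by exact_mod_cast Int.toNat_of_nonneg hm.le, zpow_natCast]
  field_simp

/-- Scaling by powers of two gives both intervals positive integer lengths, which stretches can make
equal. -/
theorem exists_mem_map {a b c d : ℝ} (hab : a < b) (hcd : c < d) (ha : a ∈ dyadic)
    (hb : b ∈ dyadic) (hc : c ∈ dyadic) (hd : d ∈ dyadic) :
    ∃ α ∈ dyadicPL, α a = c ∧ α b = d := by
  obtain ⟨m, k, hm, hk⟩ := dyadic_pos_eq (dyadic_sub hb ha) (sub_pos.2 hab)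
  obtain ⟨n, l, hn, hl⟩ := dyadic_pos_eq (dyadic_sub hd hc) (sub_pos.2 hcd)
  obtain ⟨α, hα, h0, h1⟩ := exists_mem_map_pos_natCast hm hn
  have e1 : affineMap k (-(2 ^ (k : ℤ) * a)) ∈ dyadicPL :=
    affineMap_mem _ (dyadic_neg (dyadic_zpow_mul _ ha))
  have e2 : affineMap l (-(2 ^ (l : ℤ) * c)) ∈ dyadicPL :=
    affineMap_mem _ (dyadic_neg (dyadic_zpow_mul _ hc))
  refine ⟨_, mul_mem (inv_mem e2) (mul_mem hα e1), ?_, ?_⟩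
  · rw [orderIso_mul_apply, orderIso_inv_apply_eq, orderIso_mul_apply, affineMap_apply,
      affineMap_apply, add_neg_cancel, add_neg_cancel, h0]
  · rw [orderIso_mul_apply, orderIso_inv_apply_eq, orderIso_mul_apply, affineMap_apply,
      affineMap_apply, ← sub_eq_add_neg, ← sub_eq_add_neg, ← mul_sub, ← mul_sub, hk, hl, h1]

/-- The elements of `dyadicPL` with compact support in `U`. -/
def compactPL (U : Set ℝ) : Subgroup (ℝ ≃o ℝ) where
  carrier := {f | f ∈ dyadicPL ∧ ∃ K, IsCompact K ∧ K ⊆ U ∧ ∀ x, x ∉ K → f x = x}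
  one_mem' := ⟨one_mem _, ∅, isCompact_empty, Set.empty_subset _, fun _ _ => rfl⟩
  mul_mem' := by
    rintro f g ⟨hf, K, hK, hKU, hfK⟩ ⟨hg, L, hL, hLU, hgL⟩
    refine ⟨mul_mem hf hg, K ∪ L, hK.union hL, Set.union_subset hKU hLU, fun x hx => ?_⟩
    rw [Set.mem_union, not_or] at hx
    rw [orderIso_mul_apply, hgL x hx.2, hfK x hx.1]
  inv_mem' := by
    rintro f ⟨hf, K, hK, hKU, hfK⟩
    exact ⟨inv_mem hf, K, hK, hKU, fun x hx => by rw [orderIso_inv_apply_eq, hfK x hx]⟩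

theorem compactPL_mono {U V : Set ℝ} (h : U ⊆ V) : compactPL U ≤ compactPL V := by
  rintro f ⟨hf, K, hK, hKU, hfK⟩
  exact ⟨hf, K, hK, hKU.trans h, hfK⟩

theorem compactPL_apply_of_notMem {U : Set ℝ} {f : ℝ ≃o ℝ} (hf : f ∈ compactPL U) {x : ℝ}
    (hx : x ∉ U) : f x = x := by
  obtain ⟨-, K, -, hKU, hfK⟩ := hf
  exact hfK x fun h => hx (hKU h)

theorem conj_mem_compactPL {U : Set ℝ} {f γ : ℝ ≃o ℝ} (hf : f ∈ compactPL U) (hγ : γ ∈ dyadicPL) :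
    γ * f * γ⁻¹ ∈ compactPL (γ '' U) := by
  obtain ⟨hf, K, hK, hKU, hfK⟩ := hf
  refine ⟨mul_mem (mul_mem hγ hf) (inv_mem hγ), γ '' K, hK.image γ.continuous,
    Set.image_mono hKU, fun x hx => ?_⟩
  have : γ⁻¹ x ∉ K := fun h => hx ⟨_, h, by simp⟩
  simp [hfK _ this]

theorem exists_dyadic_support {a b : ℝ} (hab : a < b) {f : ℝ ≃o ℝ} (hf : f ∈ compactPL (Set.Ioo a b)) :
    ∃ a' b', a' ∈ dyadic ∧ b' ∈ dyadic ∧ a < a' ∧ a' < b' ∧ b' < b ∧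
      ∀ x, x ∉ Set.Ioo a' b' → f x = x := by
  obtain ⟨-, K, hK, hKU, hfK⟩ := hf
  rcases K.eq_empty_or_nonempty with rfl | hne
  · obtain ⟨d, hd, h1, h2⟩ := exists_dyadic_between hab
    obtain ⟨e, he, h3, h4⟩ := exists_dyadic_between h2
    exact ⟨d, e, hd, he, h1, h3, h4, fun x _ => hfK x (by simp)⟩
  · have h1 := hKU (hK.sInf_mem hne)
    have h2 := hKU (hK.sSup_mem hne)
    obtain ⟨d, hd, h3, h4⟩ := exists_dyadic_between h1.1
    obtain ⟨e, he, h5, h6⟩ := exists_dyadic_between h2.2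
    have key : ∀ x ∈ K, d < x ∧ x < e := fun x hx =>
      ⟨h4.trans_le (csInf_le hK.bddBelow hx), (le_csSup hK.bddAbove hx).trans_lt h5⟩
    obtain ⟨x, hx⟩ := hne
    exact ⟨d, e, hd, he, h3, (key x hx).1.trans (key x hx).2, h6,
      fun x hx => hfK x fun h => hx (key x h)⟩

theorem mem_compactPL_Ioo {a b a' b' : ℝ} {f : ℝ ≃o ℝ} (hf : f ∈ dyadicPL) (ha : a < a') (hb : b' < b)
    (h : ∀ x, x ∉ Set.Icc a' b' → f x = x) : f ∈ compactPL (Set.Ioo a b) :=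
  ⟨hf, Set.Icc a' b', isCompact_Icc, Set.Icc_subset_Ioo ha hb, h⟩

/-- An element of `dyadicPL` agrees on `[r, s]` with one of compact support in `(a, b)`, if `(a, b)`
contains `[r, s]` and its image. -/
theorem exists_compactPL_eqOn {a b r s : ℝ} {γ : ℝ ≃o ℝ} (hγ : γ ∈ dyadicPL) (hr : r ∈ dyadic)
    (hs : s ∈ dyadic) (hrs : r ≤ s) (har : a < r) (hsb : s < b) (har' : a < γ r) (hsb' : γ s < b) :
    ∃ u ∈ compactPL (Set.Ioo a b), ∀ x ∈ Set.Icc r s, u x = γ x := by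
  obtain ⟨a', ha', h1, h2⟩ := exists_dyadic_between (lt_min har har')
  obtain ⟨b', hb', h3, h4⟩ := exists_dyadic_between (max_lt hsb hsb')
  rw [lt_min_iff] at h2
  rw [max_lt_iff] at h3
  -- `α` and `β` interpolate: the map is the identity outside `[a', b']`, `α` on `[a', r]`, `γ` on
  -- `[r, s]` and `β` on `[s, b']`.
  obtain ⟨α, hα, hα1, hα2⟩ := exists_mem_map h2.1 h2.2 ha' hr ha' ((hγ.1 r).2 hr)
  obtain ⟨β, hβ, hβ1, hβ2⟩ := exists_mem_map h3.1 h3.2 hs hb' ((hγ.1 s).2 hs) hb'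
  have e1 : β b' = (1 : ℝ ≃o ℝ) b' := hβ2
  have e2 : γ s = join b' β 1 e1 s := by rw [join_of_le _ h3.1.le, hβ1]
  have e3 : α r = join s γ (join b' β 1 e1) e2 r := by rw [join_of_le _ hrs, hα2]
  have e4 : (1 : ℝ ≃o ℝ) a' = join r α (join s γ (join b' β 1 e1) e2) e3 a' := by
    rw [join_of_le _ h2.1.le, hα1, orderIso_one_apply]
  refine ⟨join a' 1 (join r α (join s γ (join b' β 1 e1) e2) e3) e4, ?_, fun x hx => ?_⟩
  · refine mem_compactPL_Ioo (join_mem ha' _ (one_mem _) (join_mem hr _ hα (join_mem hs _ hγ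
      (join_mem hb' _ hβ (one_mem _))))) h1 h4 fun x hx => ?_
    rcases le_or_gt x a' with hxa | hxa
    · rw [join_of_le _ hxa, orderIso_one_apply]
    · have hxb : b' ≤ x := (not_le.1 fun h => hx ⟨hxa.le, h⟩).le
      have := h3.1
      rw [join_of_ge _ hxa.le, join_of_ge _ (by linarith), join_of_ge _ (by linarith),
        join_of_ge _ hxb, orderIso_one_apply]
  · have := h2.1
    rw [join_of_ge _ (by linarith [hx.1]), join_of_ge _ hx.1, join_of_le _ hx.2]


/-! ### Perfectness of the compactly supported piecewise linear groups -/

/-- The derived group of the group of all compactly supported elements. -/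
noncomputable def derivedPL : Subgroup (ℝ ≃o ℝ) := ⁅compactPL Set.univ, compactPL Set.univ⁆

/-- A conjugate of `f` depends on the conjugator only where `f` acts. This lets an unbounded
conjugator be replaced by a compactly supported one, and conversely. -/
theorem conj_eq_of_eqOn {X : Type*} [Preorder X] {f γ u : X ≃o X} {S : Set X}
    (hf : ∀ x, x ∉ S → f x = x) (hu : ∀ x ∈ S, u x = γ x) : γ * f * γ⁻¹ = u * f * u⁻¹ := by
  have hfS : ∀ x ∈ S, f x ∈ S := by
    intro x hx
    by_contra h
    have := f.injective (hf _ h)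
    rw [this] at h
    exact h hx
  have key : ∀ z, (γ * f * γ⁻¹) (u z) = u (f z) := by
    intro z
    by_cases hz : z ∈ S
    · simp [hu z hz, hu _ (hfS z hz)]
    · have hw : γ⁻¹ (u z) ∉ S := fun hw => by
        have := hu _ hw
        rw [orderIso_apply_inv_self] at this
        rw [u.injective this] at hw
        exact hz hw
      simp [hf _ hw, hf z hz]
  ext y
  simpa using key (u⁻¹ y)

theorem exists_nat_support {f : ℝ ≃o ℝ} (hf : f ∈ compactPL Set.univ) :
    ∃ n : ℕ, ∀ x, x ∉ Set.Icc (-(n : ℝ)) n → f x = x := by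
  obtain ⟨-, K, hK, -, hfK⟩ := hf
  obtain ⟨r, hr⟩ := hK.isBounded.subset_closedBall 0
  obtain ⟨n, hn⟩ := exists_nat_ge r
  refine ⟨n, fun x hx => hfK x fun h => hx ?_⟩
  have := hr h
  rw [Metric.mem_closedBall, dist_zero_right, Real.norm_eq_abs] at this
  exact abs_le.1 (this.trans hn)

/-- Replacing `γ` by a compactly supported map that agrees with it around the support of `f` turns
the expression into a genuine commutator. Thus `dyadicPL` acts trivially on the abelianization of
`compactPL Set.univ`. -/
theorem conj_mul_inv_mem_derivedPL {f γ : ℝ ≃o ℝ} (hf : f ∈ compactPL Set.univ) (hγ : γ ∈ dyadicPL) :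
    γ * f * γ⁻¹ * f⁻¹ ∈ derivedPL := by
  obtain ⟨n, hn⟩ := exists_nat_support hf
  have hd : (n : ℝ) ∈ dyadic := dyadic_intCast n
  obtain ⟨u, hu, hu'⟩ := exists_compactPL_eqOn (a := min (-n : ℝ) (γ (-n)) - 1) (b := max (n : ℝ) (γ n) + 1)
    hγ (dyadic_neg hd) hd (by linarith [n.cast_nonneg (α := ℝ)])
    (by linarith [min_le_left (-n : ℝ) (γ (-n))]) (by linarith [le_max_left (n : ℝ) (γ n)])
    (by linarith [min_le_right (-n : ℝ) (γ (-n))]) (by linarith [le_max_right (n : ℝ) (γ n)])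
  rw [conj_eq_of_eqOn hn hu']
  exact Subgroup.commutator_mem_commutator (compactPL_mono (Set.subset_univ _) hu) hf

theorem derivedPL_le : derivedPL ≤ compactPL Set.univ := Subgroup.commutator_le_self _

theorem conj_mem_derivedPL {f γ : ℝ ≃o ℝ} (hf : f ∈ derivedPL) (hγ : γ ∈ dyadicPL) :
    γ * f * γ⁻¹ ∈ derivedPL := by
  simpa using mul_mem (conj_mul_inv_mem_derivedPL (derivedPL_le hf) hγ) hf

theorem conj_mem_derivedPL_iff {f γ : ℝ ≃o ℝ} (hγ : γ ∈ dyadicPL) :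
    γ * f * γ⁻¹ ∈ derivedPL ↔ f ∈ derivedPL := by
  refine ⟨fun h => ?_, fun h => conj_mem_derivedPL h hγ⟩
  have := conj_mem_derivedPL h (inv_mem hγ)
  simpa [mul_assoc] using this

/-- Thompson's relation: stretching at `i` translates `[i + 1, ∞)` by one, hence moves `[j, j + 1]`
to `[j + 1, j + 2]`. -/
theorem stretch_comm {i j : ℤ} (h : i < j) :
    stretch (j + 1) 1 * stretch i 1 = stretch i 1 * stretch j 1 := by
  have hij : (i : ℝ) + 1 ≤ j := by exact_mod_cast h
  ext x
  simp only [orderIso_mul_apply]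
  rcases le_total x i with h1 | h1
  · rw [stretch_of_le h1, stretch_of_le (i := j) (by linarith), stretch_of_le h1,
      stretch_of_le (by push_cast; linarith)]
  rcases le_total x (i + 1) with h2 | h2
  · rw [stretch_of_mem h1 h2, stretch_of_le (i := j) (by linarith), stretch_of_mem h1 h2,
      stretch_of_le (by push_cast; linarith)]
  rw [stretch_of_ge (i := i) h2]
  rcases le_total x j with h3 | h3
  · rw [stretch_of_le (i := j) (by linarith), stretch_of_le (by push_cast; linarith),
      stretch_of_ge h2]
  rcases le_total x (j + 1) with h4 | h4
  · rw [stretch_of_mem h3 h4, stretch_of_ge (i := i) (by linarith),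
      stretch_of_mem (by push_cast; linarith) (by push_cast; linarith)]
    push_cast
    ring
  · rw [stretch_of_ge h4, stretch_of_ge (i := i) (by linarith),
      stretch_of_ge (by push_cast; linarith)]

theorem stretch_zero (i : ℤ) : stretch i 0 = 1 := by
  ext x
  rcases le_total x i with h1 | h1
  · rw [stretch_of_le h1]; rfl
  rcases le_total x (i + 1) with h2 | h2
  · rw [stretch_of_mem h1 h2]; simp
  · rw [stretch_of_ge h2]; simp

/-- After doubling, the two halves of `[i, i + 1]` fill `[i, i + 1]` and `[i + 1, i + 2]`. The right
one is stretched before the left one, which would displace it. -/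
theorem stretch_succ (i : ℤ) (k : ℕ) :
    stretch i (k + 1) = stretch i k * stretch (i + 1) k * stretch i 1 := by
  have hk : (1 : ℝ) ≤ 2 ^ k := one_le_pow₀ one_le_two
  ext x
  simp only [orderIso_mul_apply]
  rcases le_total x i with h1 | h1
  · rw [stretch_of_le h1, stretch_of_le (k := 1) h1,
      stretch_of_le (i := i + 1) (by push_cast; linarith), stretch_of_le h1]
  rcases le_total x (i + 1 / 2) with h2 | h2
  · rw [stretch_of_mem h1 (by linarith), stretch_of_mem (i := i) (k := 1) h1 (by linarith),
      stretch_of_le (i := i + 1) (by push_cast; linarith), stretch_of_mem (by linarith) (by linarith)]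
    ring
  rcases le_total x (i + 1) with h3 | h3
  · rw [stretch_of_mem h1 h3, stretch_of_mem (i := i) (k := 1) h1 h3,
      stretch_of_mem (i := i + 1) (by push_cast; linarith) (by push_cast; linarith), stretch_of_ge]
    · push_cast; ring
    · push_cast; nlinarith
  · rw [stretch_of_ge h3, stretch_of_ge (i := i) (k := 1) h3,
      stretch_of_ge (i := i + 1) (by push_cast; linarith), stretch_of_ge (by linarith)]
    ring

/-- Both factors are the identity far to the left and translations by one unit far to the right, in
opposite directions. -/
theorem stretch_mul_inv_mem_compactPL {i j : ℤ} (h : i < j) :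
    stretch i 1 * (stretch j 1)⁻¹ ∈ compactPL Set.univ := by
  have hij : (i : ℝ) + 1 ≤ j := by exact_mod_cast h
  refine ⟨mul_mem (stretch_mem _ _) (inv_mem (stretch_mem _ _)), Set.Icc i (j + 2), isCompact_Icc,
    Set.subset_univ _, fun x hx => ?_⟩
  rw [orderIso_mul_apply]
  rcases lt_or_ge x i with h1 | h1
  · have : (stretch j 1)⁻¹ x = x := by
      rw [orderIso_inv_apply_eq, stretch_of_le (by linarith)]
    rw [this, stretch_of_le h1.le]
  · have h2 : (j : ℝ) + 2 < x := not_le.1 fun h2 => hx ⟨h1, h2⟩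
    have : (stretch j 1)⁻¹ x = x - 1 := by
      rw [orderIso_inv_apply_eq, stretch_of_ge (by linarith)]
      ring
    rw [this, stretch_of_ge (by linarith)]
    ring

/-- By Thompson's relation the commutator of `D (j - 1)` with `D (j - 1) * (D j)⁻¹` is a conjugate
of `(D (j + 1))⁻¹ * D j`, and `derivedPL` is normalized by `dyadicPL`. -/
theorem stretch_mul_inv_succ_mem_derivedPL (j : ℤ) :
    stretch j 1 * (stretch (j + 1) 1)⁻¹ ∈ derivedPL := by
  set D := fun j : ℤ => stretch j 1
  have hD : ∀ j, D j ∈ dyadicPL := fun j => stretch_mem j 1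
  have h1 : D (j - 1) * (D (j - 1) * (D j)⁻¹) * (D (j - 1))⁻¹ * (D (j - 1) * (D j)⁻¹)⁻¹ ∈ derivedPL :=
    conj_mul_inv_mem_derivedPL (stretch_mul_inv_mem_compactPL (by omega)) (hD _)
  have h2 : D (j + 1) * D (j - 1) = D (j - 1) * D j := stretch_comm (by omega)
  have h3 : D (j - 1) * (D (j - 1) * (D j)⁻¹) * (D (j - 1))⁻¹ * (D (j - 1) * (D j)⁻¹)⁻¹ =
      D (j - 1) * ((D (j + 1))⁻¹ * D j) * (D (j - 1))⁻¹ := by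
    have : (D j)⁻¹ * (D (j - 1))⁻¹ = (D (j - 1))⁻¹ * (D (j + 1))⁻¹ := by
      rw [← mul_inv_rev, ← mul_inv_rev, h2]
    simp only [mul_assoc, mul_inv_rev, inv_inv]
    rw [← mul_assoc (D j)⁻¹ (D (j - 1))⁻¹, this]
    group
  rw [h3, conj_mem_derivedPL_iff (hD _)] at h1
  have h4 := conj_mem_derivedPL h1 (hD (j + 1))
  simpa [mul_assoc] using h4

theorem stretch_mul_inv_mem_derivedPL (i : ℤ) (n : ℕ) :
    stretch i 1 * (stretch (i + n) 1)⁻¹ ∈ derivedPL := by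
  induction n with
  | zero => simp [one_mem]
  | succ n ih =>
    have := mul_mem ih (stretch_mul_inv_succ_mem_derivedPL (i + n))
    simpa [mul_assoc, add_assoc] using this

/-- `H` is congruent to the `L`-th power of `stretch 0 1`, modulo `derivedPL`. -/
def HasDegree (H : ℝ ≃o ℝ) (L : ℕ) : Prop :=
  H ∈ dyadicPL ∧ H * (stretch 0 1 ^ L)⁻¹ ∈ derivedPL

theorem HasDegree.mul {H H' : ℝ ≃o ℝ} {L L' : ℕ} (h : HasDegree H L) (h' : HasDegree H' L') :
    HasDegree (H * H') (L + L') := by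
  refine ⟨mul_mem h.1 h'.1, ?_⟩
  have := mul_mem (conj_mem_derivedPL h'.2 h.1) h.2
  rw [pow_add]
  simpa [mul_assoc] using this

theorem hasDegree_one : HasDegree 1 0 := ⟨one_mem _, by simp [one_mem]⟩

theorem hasDegree_stretch_one (i : ℕ) : HasDegree (stretch i 1) 1 := by
  refine ⟨stretch_mem _ _, ?_⟩
  have := inv_mem (stretch_mul_inv_mem_derivedPL 0 i)
  simpa using this

/-- The degree is the translation length at `+∞`. The factorization `stretch_succ` doubles it and
adds one. -/
theorem hasDegree_stretch (i k : ℕ) : HasDegree (stretch i k) (2 ^ k - 1) := by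
  induction k generalizing i with
  | zero => simpa [stretch_zero] using hasDegree_one
  | succ k ih =>
    have h := ((ih i).mul (ih (i + 1))).mul (hasDegree_stretch_one i)
    have hk : 1 ≤ 2 ^ k := Nat.one_le_two_pow
    rw [stretch_succ, show 2 ^ (k + 1) - 1 = 2 ^ k - 1 + (2 ^ k - 1) + 1 by rw [pow_succ]; omega]
    exact_mod_cast h

/-- A map that is affine on the grid intervals with slopes `2 ^ k`, `k ≥ 0`, is a product of
stretches, one for each grid interval. The rightmost interval is stretched first, while it is still
in its original position. -/
theorem exists_hasDegree (h : ℝ → ℝ) (n : ℕ) (h0 : h 0 = 0)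
    (hk : ∀ j : ℕ, j < n → ∃ k : ℕ, ∀ x : ℝ, j ≤ x → x ≤ j + 1 → h x = h j + 2 ^ k * (x - j)) :
    ∃ H L, HasDegree H L ∧ h n = n + L ∧ (∀ x : ℝ, x ≤ 0 → H x = x) ∧
      (∀ x : ℝ, 0 ≤ x → x ≤ n → H x = h x) ∧ ∀ x : ℝ, n ≤ x → H x = x + L := by
  induction n with
  | zero =>
    refine ⟨1, 0, hasDegree_one, by simp [h0], fun _ _ => rfl, fun x h1 h2 => ?_, by simp⟩
    have : x = 0 := le_antisymm (by simpa using h2) h1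
    simp [this, h0]
  | succ n ih =>
    obtain ⟨H, L, hH, hn, h1, h2, h3⟩ := ih fun j hj => hk j (by omega)
    obtain ⟨k, hk⟩ := hk n (by omega)
    have hk1 : (1 : ℝ) ≤ 2 ^ k := one_le_pow₀ one_le_two
    have hc : ((L + (2 ^ k - 1) : ℕ) : ℝ) = L + (2 ^ k - 1) := by
      rw [Nat.cast_add, Nat.cast_sub Nat.one_le_two_pow]; push_cast; rfl
    have hn0 : (0 : ℝ) ≤ n := n.cast_nonneg
    refine ⟨H * stretch n k, L + (2 ^ k - 1), hH.mul (hasDegree_stretch n k), ?_, fun x hx => ?_,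
      fun x hx hx' => ?_, fun x hx => ?_⟩
    · push_cast [hc]
      rw [hk _ (by linarith) le_rfl, hn]
      ring
    · rw [orderIso_mul_apply, stretch_of_le (by push_cast; linarith), h1 x hx]
    · push_cast at hx'
      rw [orderIso_mul_apply]
      rcases le_total x n with hxn | hxn
      · rw [stretch_of_le (by exact_mod_cast hxn), h2 x hx hxn]
      · rw [stretch_of_mem (by exact_mod_cast hxn) (by exact_mod_cast hx'), h3, hk x hxn hx', hn]
        · push_cast; ring
        · push_cast; nlinarith
    · push_cast at hx
      rw [orderIso_mul_apply, stretch_of_ge (by exact_mod_cast hx), h3 _ (by linarith), hc]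
      ring

/-- Slopes of `f` may be below one, so `2 ^ N * f x` and `2 ^ N * x` are factored instead, giving
`H` and `H'`. Since `f n = n`, both have the same degree, hence are congruent modulo `derivedPL`,
and `f = H'⁻¹ * H`. -/
theorem mem_derivedPL_of_grid {f : ℝ ≃o ℝ} {n : ℕ} (hf : ∀ x, x ∉ Set.Icc (0 : ℝ) n → f x = x)
    (hn : f n = n) (h0 : f 0 = 0)
    (hk : ∀ j : ℕ, j < n → IsTwoAffine f j (j + 1)) : f ∈ derivedPL := by
  have hN : ∃ N : ℕ, ∀ j : ℕ, j < n → ∃ k : ℕ, ∀ x : ℝ, j ≤ x → x ≤ j + 1 →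
      2 ^ N * f x = 2 ^ N * f j + 2 ^ k * (x - j) := by
    choose! k hk using hk
    refine ⟨(Finset.range n).sup fun j => (k j).natAbs, fun j hj => ?_⟩
    set N := (Finset.range n).sup fun j => (k j).natAbs
    have hle : (k j).natAbs ≤ N := Finset.le_sup (f := fun j => (k j).natAbs) (Finset.mem_range.2 hj)
    refine ⟨(N + k j).toNat, fun x h1 h2 => ?_⟩
    rw [hk j hj x h1 h2, mul_add, ← mul_assoc, ← zpow_natCast, ← zpow_natCast, ← zpow_add₀ two_ne_zero,
      Int.toNat_of_nonneg (by omega)]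
  obtain ⟨N, hN⟩ := hN
  obtain ⟨H, L, hH, e, h1, h2, h3⟩ := exists_hasDegree (fun x => 2 ^ N * f x) n (by simp [h0]) hN
  obtain ⟨H', L', hH', e', h1', h2', h3'⟩ := exists_hasDegree (fun x => 2 ^ N * x) n (by simp)
    fun j _ => ⟨N, fun x _ _ => by ring⟩
  have hL : L = L' := by
    rw [hn] at e
    exact_mod_cast (add_left_cancel (e.symm.trans e'))
  subst hL
  have hfH : H' * f = H := by
    ext x
    rw [orderIso_mul_apply]
    rcases lt_or_ge x 0 with hx | hx
    · rw [hf x fun h => by linarith [h.1], h1 x hx.le, h1' x hx.le]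
    rcases lt_or_ge (n : ℝ) x with hx' | hx'
    · rw [hf x fun h => by linarith [h.2], h3 x hx'.le, h3' x hx'.le]
    · rw [h2 x hx hx', h2']
      · rw [← h0]; exact f.monotone hx
      · rw [← hn]; exact f.monotone hx'
  have key := mul_mem hH.2 (inv_mem hH'.2)
  have key2 := conj_mem_derivedPL key (inv_mem hH'.1)
  have : f = H'⁻¹ * H := by rw [← hfH]; simp
  rw [this]
  simpa [mul_assoc] using key2

theorem exists_common_denominator (S : Finset ℝ) (hS : ∀ s ∈ S, s ∈ dyadic) :
    ∃ M : ℕ, ∀ s ∈ S, ∃ m : ℤ, 2 ^ M * s = m := by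
  have h : ∀ s : ℝ, s ∈ dyadic → ∃ n : ℕ, ∀ M ≥ n, ∃ m : ℤ, 2 ^ M * s = m := by
    rintro s ⟨m, n, rfl⟩
    refine ⟨n, fun M hM => ⟨m * 2 ^ (M - n), ?_⟩⟩
    have : (2 : ℝ) ^ M = 2 ^ (M - n) * 2 ^ n := by rw [← pow_add]; congr 1; omega
    push_cast
    rw [this]
    field_simp
  choose! n hn using h
  exact ⟨S.sup n, fun s hs => hn s (hS s hs) _ (Finset.le_sup hs)⟩

theorem compactPL_univ_le_derivedPL : compactPL Set.univ ≤ derivedPL := by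
  intro f hf
  obtain ⟨q, hq⟩ := exists_nat_support hf
  obtain ⟨⟨-, S, hS, hSf⟩, -⟩ := hf
  obtain ⟨M, hM⟩ := exists_common_denominator S hS
  have h2M : (0 : ℝ) < 2 ^ M := by positivity
  -- Conjugation by `γ` puts the breakpoints at integers and the left end of the support at or
  -- beyond `0`.
  have hγ : affineMap M (2 ^ M * q : ℕ) ∈ dyadicPL := affineMap_mem _ (dyadic_intCast (2 ^ M * q : ℕ))
  set γ := affineMap M (2 ^ M * q : ℕ)
  have hγx : ∀ x, γ x = 2 ^ M * (x + q) := fun x => by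
    simp only [γ, affineMap_apply, zpow_natCast]; push_cast; ring
  have hγi : ∀ x, γ⁻¹ x = x / 2 ^ M - q := fun x => by
    rw [orderIso_inv_apply_eq, hγx]; field_simp; ring
  rw [← conj_mem_derivedPL_iff hγ]
  -- The endpoints `±q` are fixed too: if one were moved, then so would be its image and its
  -- preimage, and one of these lies outside the interval.
  have hfix : ∀ x, x ∉ Set.Ioo (-(q : ℝ)) q → f x = x := by
    intro x hx
    by_contra hne
    have h1 : ∀ y, f y ≠ y → y ∈ Set.Icc (-(q : ℝ)) q := fun y hy => by
      by_contra h; exact hy (hq y h)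
    have h2 := h1 x hne
    have h3 := h1 (f x) fun h => hne (f.injective h)
    have h4 := h1 (f⁻¹ x) fun h => hne (by
      rw [orderIso_apply_inv_self] at h
      conv_lhs => rw [h]
      simp)
    rcases h2.1.eq_or_lt with h5 | h5
    · rcases lt_or_gt_of_ne hne with h6 | h6
      · linarith [h3.1]
      · have := (f⁻¹).strictMono h6
        rw [orderIso_inv_apply_self] at this
        linarith [h4.1]
    · have h5' : x = q := le_antisymm h2.2 (not_lt.1 fun h => hx ⟨h5, h⟩)
      rcases lt_or_gt_of_ne hne with h6 | h6
      · have := (f⁻¹).strictMono h6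
        rw [orderIso_inv_apply_self] at this
        linarith [h4.2]
      · linarith [h3.2]
  have hout : ∀ x, x ∉ Set.Ioo (0 : ℝ) (2 * 2 ^ M * q : ℕ) → (γ * f * γ⁻¹) x = x := by
    intro x hx
    rw [orderIso_mul_apply, orderIso_mul_apply, hfix, orderIso_apply_inv_self]
    intro h
    apply hx
    rw [hγi] at h
    constructor
    · have : 0 < x / 2 ^ M := by linarith [h.1]
      rwa [div_pos_iff_of_pos_right h2M] at this
    · have : x / 2 ^ M < 2 * q := by linarith [h.2]
      rw [div_lt_iff₀ h2M] at this
      push_cast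
      linarith
  refine mem_derivedPL_of_grid (n := 2 * 2 ^ M * q) (fun x hx => hout x fun h => hx ⟨h.1.le, h.2.le⟩)
    (hout _ (by simp)) (hout _ (by simp)) fun j _ => ?_
  obtain ⟨k, hk⟩ := hSf (γ⁻¹ j) (γ⁻¹ (j + 1)) ((γ⁻¹).strictMono (by linarith)) fun s hs hh => by
    obtain ⟨m, hm⟩ := hM s hs
    have h1 := γ.strictMono hh.1
    have h2 := γ.strictMono hh.2
    rw [orderIso_apply_inv_self, hγx, mul_add, hm] at h1 h2
    have h1' : (j : ℤ) < m + 2 ^ M * q := by exact_mod_cast h1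
    have h2' : m + 2 ^ M * q < (j : ℤ) + 1 := by exact_mod_cast h2
    omega
  refine ⟨k, fun z h1 h2 => ?_⟩
  simp only [orderIso_mul_apply]
  rw [hk (γ⁻¹ z) ((γ⁻¹).monotone h1) ((γ⁻¹).monotone h2)]
  simp only [hγx, hγi]
  field_simp
  ring

theorem exists_mem_commutator_Ioo {f : ℝ ≃o ℝ} (hf : f ∈ derivedPL) (n : ℕ) :
    ∃ N : ℕ, n ≤ N ∧ f ∈ ⁅compactPL (Set.Ioo (-(N : ℝ)) N), compactPL (Set.Ioo (-(N : ℝ)) N)⁆ := by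
  have hmono : ∀ {M N : ℕ}, M ≤ N → compactPL (Set.Ioo (-(M : ℝ)) M) ≤ compactPL (Set.Ioo (-(N : ℝ)) N) :=
    fun h => compactPL_mono (Set.Ioo_subset_Ioo (by simpa using h) (by simpa using h))
  have hmono' : ∀ {M N : ℕ}, M ≤ N → ⁅compactPL (Set.Ioo (-(M : ℝ)) M), compactPL (Set.Ioo (-(M : ℝ)) M)⁆
      ≤ ⁅compactPL (Set.Ioo (-(N : ℝ)) N), compactPL (Set.Ioo (-(N : ℝ)) N)⁆ :=
    fun h => Subgroup.commutator_mono (hmono h) (hmono h)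
  have hex : ∀ g ∈ compactPL Set.univ, ∃ N : ℕ, g ∈ compactPL (Set.Ioo (-(N : ℝ)) N) := fun g hg => by
    obtain ⟨N, hN⟩ := exists_nat_support hg
    exact ⟨N + 1, mem_compactPL_Ioo hg.1 (by push_cast; linarith) (by push_cast; linarith) hN⟩
  rw [derivedPL, Subgroup.commutator_def] at hf
  induction hf using Subgroup.closure_induction with
  | mem x hx =>
    obtain ⟨g, hg, h, hh, rfl⟩ := hx
    obtain ⟨N, hN⟩ := hex g hg
    obtain ⟨N', hN'⟩ := hex h hh
    exact ⟨n + N + N', by omega, Subgroup.commutator_mem_commutator (hmono (by omega) hN)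
      (hmono (by omega) hN')⟩
  | one => exact ⟨n, le_rfl, one_mem _⟩
  | mul x y _ _ hx hy =>
    obtain ⟨N, hn, hN⟩ := hx
    obtain ⟨N', hn', hN'⟩ := hy
    exact ⟨N + N', by omega, mul_mem (hmono' (by omega) hN) (hmono' (by omega) hN')⟩
  | inv x _ hx =>
    obtain ⟨N, hn, hN⟩ := hx
    exact ⟨N, hn, inv_mem hN⟩

/-- The group of compactly supported elements of `dyadicPL` on an open interval is perfect. -/
theorem compactPL_Ioo_le_commutator {a b : ℝ} (hab : a < b) :
    compactPL (Set.Ioo a b) ≤ ⁅compactPL (Set.Ioo a b), compactPL (Set.Ioo a b)⁆ := by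
  intro f hf
  obtain ⟨a', b', ha', hb', h1, h2, h3, hfix⟩ := exists_dyadic_support hab hf
  obtain ⟨n, hn⟩ := exists_nat_gt (max (-a') b')
  obtain ⟨N, hnN, hN⟩ := exists_mem_commutator_Ioo
    (compactPL_univ_le_derivedPL (compactPL_mono (Set.subset_univ _) hf)) n
  have hN1 : (n : ℝ) ≤ N := by exact_mod_cast hnN
  have hN2 := (le_max_left (-a') b').trans_lt hn
  have hN3 := (le_max_right (-a') b').trans_lt hn
  obtain ⟨c, hc, hc1, hc2⟩ := exists_dyadic_between h1
  obtain ⟨d, hd, hd1, hd2⟩ := exists_dyadic_between h3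
  have hNd : (N : ℝ) ∈ dyadic := dyadic_intCast N
  -- `γ` squeezes `(-N, N)` into `(a, b)` and is the identity on `[a', b']`, where `f` lives.
  -- Conjugation by `γ` thus fixes `f` and carries its expression by commutators into `(a, b)`.
  obtain ⟨α, hα, hα1, hα2⟩ := exists_mem_map (a := -N) (by linarith) hc2 (dyadic_neg hNd) ha' hc ha'
  obtain ⟨β, hβ, hβ1, hβ2⟩ := exists_mem_map (b := N) (by linarith) hd1 hb' hNd hb' hd
  have e1 : (1 : ℝ ≃o ℝ) b' = β b' := hβ1.symm
  have e2 : α a' = join b' 1 β e1 a' := by rw [join_of_le _ h2.le, hα2]; rfl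
  set γ := join a' α (join b' 1 β e1) e2
  have hγ : γ ∈ dyadicPL := join_mem ha' _ hα (join_mem hb' _ (one_mem _) hβ)
  have hγ1 : ∀ x ∈ Set.Ioo a' b', γ x = (1 : ℝ ≃o ℝ) x := fun x hx => by
    rw [join_of_ge _ hx.1.le, join_of_le _ hx.2.le]
  have hconj : f = γ * f * γ⁻¹ := by
    have := conj_eq_of_eqOn (γ := 1) (u := γ) hfix hγ1
    simpa using this
  have hle : (compactPL (Set.Ioo (-(N : ℝ)) N)).map (MulAut.conj γ).toMonoidHom ≤
      compactPL (Set.Ioo a b) := by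
    rintro _ ⟨g, hg, rfl⟩
    refine compactPL_mono ?_ (conj_mem_compactPL hg hγ)
    rintro _ ⟨x, hx, rfl⟩
    have h4 : γ (-N) = c := by rw [join_of_le _ (by linarith), hα1]
    have h5 : γ N = d := by rw [join_of_ge _ (by linarith), join_of_ge _ (by linarith), hβ2]
    have h6 := γ.strictMono hx.1
    have h7 := γ.strictMono hx.2
    exact ⟨by linarith, by linarith⟩
  have := Subgroup.mem_map_of_mem (MulAut.conj γ).toMonoidHom hN
  rw [Subgroup.map_commutator] at this
  have h8 := Subgroup.commutator_mono hle hle this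
  rw [hconj]
  exact h8


/-! ### Thompson's group and the piecewise linear homeomorphisms of the line -/

theorem exists_int_add_unit (x : ℝ) : ∃ (n : ℤ) (t : unitInterval), x = n + t :=
  ⟨⌊x⌋, ⟨Int.fract x, fract_mem x⟩, (Int.floor_add_fract x).symm⟩

/-- `glue` as a homomorphism. -/
noncomputable def glueHom : (ℤ → (unitInterval ≃o unitInterval)) →* (ℝ ≃o ℝ) where
  toFun := glue
  map_one' := by
    ext x
    obtain ⟨n, t, rfl⟩ := exists_int_add_unit x
    rw [glue_apply]; rfl
  map_mul' ν μ := by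
    ext x
    obtain ⟨n, t, rfl⟩ := exists_int_add_unit x
    rw [orderIso_mul_apply, glue_apply, glue_apply, glue_apply]; rfl

@[simp] theorem glueHom_apply (ν : ℤ → (unitInterval ≃o unitInterval)) : glueHom ν = glue ν := rfl

/-- The extension by the identity of a homeomorphism of `[0, 1]` to the line. -/
noncomputable def extendUnit : (unitInterval ≃o unitInterval) →* (ℝ ≃o ℝ) :=
  glueHom.comp (MonoidHom.mulSingle (fun _ : ℤ => (unitInterval ≃o unitInterval)) 0)

theorem extendUnit_coe (u : unitInterval ≃o unitInterval) (t : unitInterval) :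
    extendUnit u t = u t := by
  have := glue_apply (Pi.mulSingle 0 u) 0 t
  simpa [extendUnit] using this

theorem extendUnit_of_notMem (u : unitInterval ≃o unitInterval) {x : ℝ} (hx : x ∉ Set.Ioo (0 : ℝ) 1) :
    extendUnit u x = x := by
  obtain ⟨n, t, rfl⟩ := exists_int_add_unit x
  change glue (Pi.mulSingle 0 u) _ = _
  rw [glue_apply]
  by_cases hn : n = 0
  · subst hn
    rw [Int.cast_zero, zero_add] at hx
    have ht : t = 0 ∨ t = 1 := by
      rcases t.2.1.eq_or_lt with h | h
      · exact Or.inl (Subtype.ext h.symm)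
      rcases t.2.2.eq_or_lt with h' | h'
      · exact Or.inr (Subtype.ext h')
      · exact absurd ⟨h, h'⟩ hx
    have h0 : u 0 = 0 := u.map_bot
    have h1 : u 1 = 1 := u.map_top
    rcases ht with rfl | rfl <;> simp [h0, h1]
  · simp [hn]

theorem extendUnit_injective : Function.Injective extendUnit := by
  intro u v h
  ext t
  rw [← extendUnit_coe, ← extendUnit_coe, h]

/-- The restriction to `[0, 1]` of a homeomorphism of the line which fixes `0` and `1`. -/
noncomputable def restrictUnit (h : ℝ ≃o ℝ) (h0 : h 0 = 0) (h1 : h 1 = 1) :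
    unitInterval ≃o unitInterval where
  toFun t := ⟨h t, h0 ▸ h.monotone t.2.1, h1 ▸ h.monotone t.2.2⟩
  invFun t := ⟨h.symm t, by rw [h.le_symm_apply, h0]; exact t.2.1,
    by rw [h.symm_apply_le, h1]; exact t.2.2⟩
  left_inv t := by simp
  right_inv t := by simp
  map_rel_iff' := by
    intro s t
    exact h.le_iff_le

theorem extendUnit_restrictUnit {h : ℝ ≃o ℝ} (h0 : h 0 = 0) (h1 : h 1 = 1)
    (hout : ∀ x, x ∉ Set.Ioo (0 : ℝ) 1 → h x = x) : extendUnit (restrictUnit h h0 h1) = h := by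
  ext x
  by_cases hx : x ∈ Set.Ioo (0 : ℝ) 1
  · exact extendUnit_coe _ ⟨x, hx.1.le, hx.2.le⟩
  · rw [extendUnit_of_notMem _ hx, hout x hx]

theorem extendUnit_mem_dyadicPL {u : unitInterval ≃o unitInterval} (hu : u ∈ thompsonF) :
    extendUnit u ∈ dyadicPL := by
  classical
  obtain ⟨S, hS⟩ := hu
  refine ⟨fun x => ?_, S.image (↑) ∪ {0, 1}, fun s hs => ?_, fun x y hxy hno => ?_⟩
  · by_cases hx : x ∈ Set.Ioo (0 : ℝ) 1
    · lift x to unitInterval using ⟨hx.1.le, hx.2.le⟩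
      rw [extendUnit_coe]
      exact ⟨hS.dyadic_of_map x, hS.map_dyadic x⟩
    · rw [extendUnit_of_notMem _ hx]
  · simp only [Finset.mem_union, Finset.mem_image, Finset.mem_insert, Finset.mem_singleton] at hs
    rcases hs with ⟨t, ht, rfl⟩ | rfl | rfl
    · exact hS.1 t ht
    · exact dyadic_zero
    · exact_mod_cast dyadic_intCast 1
  · have h0 := hno 0 (by simp)
    have h1 := hno 1 (by simp)
    rcases le_or_gt y 0 with hy | hy
    · exact ⟨0, fun z h2 h3 => by
        rw [extendUnit_of_notMem _ fun h => by linarith [h.1],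
          extendUnit_of_notMem _ fun h => by linarith [h.1]]; simp⟩
    have hx0 : 0 ≤ x := not_lt.1 fun h => h0 ⟨h, hy⟩
    rcases le_or_gt 1 x with hx | hx
    · exact ⟨0, fun z h2 h3 => by
        rw [extendUnit_of_notMem _ fun h => by linarith [h.2],
          extendUnit_of_notMem _ fun h => by linarith [h.2]]; simp⟩
    have hy1 : y ≤ 1 := not_lt.1 fun h => h1 ⟨hx, h⟩
    lift x to unitInterval using ⟨hx0, hx.le⟩
    lift y to unitInterval using ⟨hy.le, hy1⟩
    obtain ⟨k, hk⟩ := hS.2 x y hxy fun s hs hh =>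
      hno s (Finset.mem_union_left _ (Finset.mem_image_of_mem _ hs)) hh
    refine ⟨k, fun z h2 h3 => ?_⟩
    lift z to unitInterval using ⟨hx0.trans h2, h3.trans hy1⟩
    rw [extendUnit_coe, extendUnit_coe, hk z h2 h3]

theorem mem_thompsonF_of_extendUnit {u : unitInterval ≃o unitInterval}
    (hu : extendUnit u ∈ dyadicPL) : u ∈ thompsonF := by
  obtain ⟨-, S, hS, hSf⟩ := hu
  refine ⟨S.preimage (↑) Subtype.val_injective.injOn, fun s hs => hS _ (Finset.mem_preimage.1 hs),
    fun x y hxy hno => ?_⟩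
  have hno' : ∀ s ∈ S, ¬ ((x : ℝ) < s ∧ s < y) := fun s hs hh => by
    refine hno ⟨s, x.2.1.trans hh.1.le, hh.2.le.trans y.2.2⟩ (by simpa using hs) hh
  obtain ⟨k, hk⟩ := hSf x y hxy hno'
  exact ⟨k, fun z h1 h2 => by simpa only [extendUnit_coe] using hk z h1 h2⟩

theorem exists_extendUnit_eq {h : ℝ ≃o ℝ} (hh : h ∈ compactPL (Set.Ioo 0 1)) :
    ∃ u ∈ thompsonF, extendUnit u = h := by
  have hout := fun x (hx : x ∉ Set.Ioo (0 : ℝ) 1) => compactPL_apply_of_notMem hh hx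
  have := extendUnit_restrictUnit (hout 0 (by simp)) (hout 1 (by simp)) hout
  exact ⟨_, mem_thompsonF_of_extendUnit (by rw [this]; exact hh.1), this⟩

/-! ### Germs at the endpoints and the derived subgroup of `F` -/

theorem exists_eq_mul_near_zero {u : unitInterval ≃o unitInterval} (hu : u ∈ thompsonF) :
    ∃ ε : ℝ, 0 < ε ∧ ∃ k : ℤ, ∀ x, 0 ≤ x → x ≤ ε → extendUnit u x = 2 ^ k * x := by
  obtain ⟨-, S, -, hS⟩ := extendUnit_mem_dyadicPL hu
  obtain ⟨ε, hε, hεS⟩ : ∃ ε : ℝ, 0 < ε ∧ ∀ s ∈ S, 0 < s → ε ≤ s := by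
    rcases (S.filter (0 < ·)).eq_empty_or_nonempty with h | h
    · exact ⟨1, one_pos, fun s hs hs0 => by
        have := Finset.mem_filter.2 ⟨hs, hs0⟩; rw [h] at this; simp at this⟩
    · refine ⟨(S.filter (0 < ·)).min' h, (Finset.mem_filter.1 (Finset.min'_mem _ h)).2, fun s hs hs0 => ?_⟩
      exact Finset.min'_le _ _ (Finset.mem_filter.2 ⟨hs, hs0⟩)
  obtain ⟨k, hk⟩ := hS 0 ε hε fun s hs hh => absurd (hεS s hs hh.1) (not_le.2 hh.2)
  refine ⟨ε, hε, k, fun x h1 h2 => ?_⟩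
  rw [hk x h1 h2, extendUnit_of_notMem u (by simp)]
  ring

theorem flipConj_mem_thompsonF {u : unitInterval ≃o unitInterval} (hu : u ∈ thompsonF) :
    flipConj u ∈ thompsonF := by
  classical
  obtain ⟨S, hS, hSu⟩ := hu
  refine ⟨S.image unitInterval.symm, fun s hs => ?_, fun x y hxy hno => ?_⟩
  · obtain ⟨t, ht, rfl⟩ := Finset.mem_image.1 hs
    rw [unitInterval.coe_symm_eq]
    exact dyadic_sub (by exact_mod_cast dyadic_intCast 1) (hS t ht)
  · have h1 : unitInterval.symm y < unitInterval.symm x := by simpa using hxy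
    obtain ⟨k, hk⟩ := hSu _ _ h1 fun s hs hh => hno _ (Finset.mem_image_of_mem _ hs)
      ⟨by rw [← unitInterval.symm_lt_symm, unitInterval.symm_symm]; exact hh.2,
       by rw [← unitInterval.symm_lt_symm, unitInterval.symm_symm]; exact hh.1⟩
    refine ⟨k, fun z hxz hzy => ?_⟩
    have h2 := hk (unitInterval.symm z) (by simpa using hzy) (by simpa using hxz)
    have h3 := hk (unitInterval.symm x) h1.le le_rfl
    change ((unitInterval.symm (u (unitInterval.symm z)) : unitInterval) : ℝ) =
      ((unitInterval.symm (u (unitInterval.symm x)) : unitInterval) : ℝ) + _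
    rw [unitInterval.coe_symm_eq, unitInterval.coe_symm_eq, h2, h3]
    simp only [unitInterval.coe_symm_eq]
    ring

@[simp] theorem coe_flipConj_apply (u : unitInterval ≃o unitInterval) (t : unitInterval) :
    (flipConj u t : ℝ) = 1 - u (unitInterval.symm t) := rfl

/-- The elements of `F` which are the identity near `0` and near `1`. -/
def compactF : Subgroup (unitInterval ≃o unitInterval) where
  carrier := {u | u ∈ thompsonF ∧ ∃ α : ℝ, 0 < α ∧ ∀ t : unitInterval, (t : ℝ) ∉ Set.Icc α (1 - α) → u t = t}
  one_mem' := ⟨one_mem _, 1, one_pos, fun _ _ => rfl⟩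
  mul_mem' := by
    rintro u v ⟨hu, α, hα, h⟩ ⟨hv, β, hβ, h'⟩
    refine ⟨mul_mem hu hv, min α β, lt_min hα hβ, fun t ht => ?_⟩
    rw [orderIso_mul_apply, h' t, h t]
    · exact fun hh => ht ⟨(min_le_left _ _).trans hh.1, hh.2.trans (by linarith [min_le_left α β])⟩
    · exact fun hh => ht ⟨(min_le_right _ _).trans hh.1, hh.2.trans (by linarith [min_le_right α β])⟩
  inv_mem' := by
    rintro u ⟨hu, α, hα, h⟩
    exact ⟨inv_mem hu, α, hα, fun t ht => by rw [orderIso_inv_apply_eq, h t ht]⟩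

theorem extendUnit_mem_compactPL_iff {u : unitInterval ≃o unitInterval} :
    extendUnit u ∈ compactPL (Set.Ioo 0 1) ↔ u ∈ compactF := by
  constructor
  · intro h
    obtain ⟨a, b, -, -, ha, hab, hb, hfix⟩ := exists_dyadic_support one_pos h
    refine ⟨mem_thompsonF_of_extendUnit h.1, min a (1 - b), lt_min ha (by linarith), fun t ht => ?_⟩
    apply Subtype.ext
    rw [← extendUnit_coe]
    refine hfix _ fun h => ht ⟨(min_le_left _ _).trans h.1.le, ?_⟩
    have := min_le_right a (1 - b)
    linarith [h.2]
  · rintro ⟨hu, α, hα, h⟩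
    refine mem_compactPL_Ioo (extendUnit_mem_dyadicPL hu) hα (b' := 1 - α) (by linarith) fun x hx => ?_
    by_cases hx' : x ∈ Set.Ioo (0 : ℝ) 1
    · lift x to unitInterval using ⟨hx'.1.le, hx'.2.le⟩
      rw [extendUnit_coe, h x hx]
    · exact extendUnit_of_notMem _ hx'

theorem flipConj_mem_compactF {u : unitInterval ≃o unitInterval} (hu : u ∈ compactF) :
    flipConj u ∈ compactF := by
  obtain ⟨hu, α, hα, h⟩ := hu
  refine ⟨flipConj_mem_thompsonF hu, α, hα, fun t ht => ?_⟩
  apply Subtype.ext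
  rw [coe_flipConj_apply, h, unitInterval.coe_symm_eq]
  · ring
  · rw [unitInterval.coe_symm_eq]
    exact fun hh => ht ⟨by linarith [hh.2], by linarith [hh.1]⟩

theorem flipConj_mul (u v : unitInterval ≃o unitInterval) :
    flipConj (u * v) = flipConj u * flipConj v := by
  ext t
  simp [flipConj]

@[simp] theorem flipConj_flipConj (u : unitInterval ≃o unitInterval) : flipConj (flipConj u) = u := by
  ext t
  simp [flipConj]

/-- `flipConj` as a homomorphism. -/
def flipHom : (unitInterval ≃o unitInterval) →* (unitInterval ≃o unitInterval) :=
  MonoidHom.mk' flipConj flipConj_mul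

/-- Near `0` both maps are multiplications by powers of two, and these commute. The bound keeps all
intermediate points in the range where both are linear. -/
theorem commutator_near_zero {u v : unitInterval ≃o unitInterval} (hu : u ∈ thompsonF)
    (hv : v ∈ thompsonF) : ∃ ε : ℝ, 0 < ε ∧ ∀ t : unitInterval, (t : ℝ) < ε → (u * v * u⁻¹ * v⁻¹) t = t := by
  obtain ⟨ε₁, h₁, k₁, hk₁⟩ := exists_eq_mul_near_zero hu
  obtain ⟨ε₂, h₂, k₂, hk₂⟩ := exists_eq_mul_near_zero hv
  have p₁ := two_zpow_pos k₁
  have p₂ := two_zpow_pos k₂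
  refine ⟨min (2 ^ k₂ * (2 ^ k₁ * (ε₁ ⊓ ε₂))) (min (2 ^ k₁ * (ε₁ ⊓ ε₂)) (2 ^ k₂ * (ε₁ ⊓ ε₂) ) ⊓
    (2 ^ k₁ * (2 ^ k₂ * (ε₁ ⊓ ε₂)))), by positivity, fun t ht => ?_⟩
  simp only [lt_min_iff] at ht
  apply Subtype.ext
  rw [← extendUnit_coe, map_mul, map_mul, map_mul, map_inv, map_inv]
  have hε₁ : ε₁ ⊓ ε₂ ≤ ε₁ := inf_le_left
  have hε₂ : ε₁ ⊓ ε₂ ≤ ε₂ := inf_le_right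
  set ε := ε₁ ⊓ ε₂
  have ht0 := t.2.1
  obtain ⟨y, hy⟩ : ∃ y : ℝ, y = (t : ℝ) / 2 ^ k₁ / 2 ^ k₂ := ⟨_, rfl⟩
  have hty : (t : ℝ) = 2 ^ k₂ * (2 ^ k₁ * y) := by rw [hy]; field_simp
  have hy0 : 0 ≤ y := by rw [hy]; positivity
  have e1 : y < ε := by
    have := ht.1
    rw [hty] at this
    exact lt_of_mul_lt_mul_left (lt_of_mul_lt_mul_left this p₂.le) p₁.le
  have e2 : 2 ^ k₁ * y < ε := by
    have := ht.2.1.2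
    rw [hty] at this
    exact lt_of_mul_lt_mul_left this p₂.le
  have e3 : 2 ^ k₂ * y < ε := by
    have := ht.2.1.1
    rw [hty, mul_left_comm] at this
    exact lt_of_mul_lt_mul_left this p₁.le
  have c1 : (extendUnit v)⁻¹ (t : ℝ) = 2 ^ k₁ * y := by
    rw [orderIso_inv_apply_eq, hk₂ _ (by positivity) (e2.le.trans hε₂), hty]
  have c2 : (extendUnit u)⁻¹ (2 ^ k₁ * y) = y := by
    rw [orderIso_inv_apply_eq, hk₁ _ hy0 (e1.le.trans hε₁)]
  simp only [orderIso_mul_apply]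
  rw [c1, c2, hk₂ _ hy0 (e1.le.trans hε₂), hk₁ _ (by positivity) (e3.le.trans hε₁), hty]
  ring

theorem commutator_mem_compactF {u v : unitInterval ≃o unitInterval} (hu : u ∈ thompsonF)
    (hv : v ∈ thompsonF) : u * v * u⁻¹ * v⁻¹ ∈ compactF := by
  obtain ⟨ε, hε, h⟩ := commutator_near_zero hu hv
  obtain ⟨ε', hε', h'⟩ := commutator_near_zero (flipConj_mem_thompsonF hu) (flipConj_mem_thompsonF hv)
  refine ⟨mul_mem (mul_mem (mul_mem hu hv) (inv_mem hu)) (inv_mem hv), min ε ε', lt_min hε hε',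
    fun t ht => ?_⟩
  rcases lt_or_ge (t : ℝ) (min ε ε') with h1 | h1
  · exact h t (h1.trans_le (min_le_left _ _))
  · have h2 : 1 - min ε ε' < (t : ℝ) := not_le.1 fun h2 => ht ⟨h1, h2⟩
    have h3 := h' (unitInterval.symm t) (by
      rw [unitInterval.coe_symm_eq]; linarith [min_le_right ε ε'])
    have h4 : flipConj u * flipConj v * (flipConj u)⁻¹ * (flipConj v)⁻¹ =
        flipConj (u * v * u⁻¹ * v⁻¹) := by
      change flipHom u * flipHom v * (flipHom u)⁻¹ * (flipHom v)⁻¹ = flipHom _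
      simp only [map_mul, map_inv]
    rw [h4] at h3
    have := congrArg Subtype.val h3
    rw [coe_flipConj_apply, unitInterval.symm_symm, unitInterval.coe_symm_eq] at this
    exact Subtype.ext (by linarith)

/-- One inclusion holds since commutators are trivial near the endpoints. The other holds since the
right side is perfect and contained in the image of `F`. -/
theorem map_commutator_thompsonF :
    (commutator thompsonF).map (extendUnit.comp thompsonF.subtype) = compactPL (Set.Ioo 0 1) := by
  rw [commutator_def, Subgroup.map_commutator]
  apply le_antisymm
  · rw [Subgroup.commutator_le]
    rintro _ ⟨u, -, rfl⟩ _ ⟨v, -, rfl⟩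
    have := extendUnit_mem_compactPL_iff.2 (commutator_mem_compactF u.2 v.2)
    simp only [map_mul, map_inv] at this
    exact this
  · refine (compactPL_Ioo_le_commutator one_pos).trans ?_
    have : compactPL (Set.Ioo 0 1) ≤ Subgroup.map (extendUnit.comp thompsonF.subtype) ⊤ := by
      intro h hh
      obtain ⟨u, hu, rfl⟩ := exists_extendUnit_eq hh
      exact ⟨⟨u, hu⟩, trivial, rfl⟩
    exact Subgroup.commutator_mono this this

theorem nonempty_mulEquiv_compactPL {a b : ℝ} (ha : a ∈ dyadic) (hb : b ∈ dyadic) (hab : a < b) :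
    Nonempty (compactPL (Set.Ioo a b) ≃* commutator thompsonF) := by
  obtain ⟨γ, hγ, h1, h2⟩ := exists_mem_map hab one_pos ha hb dyadic_zero
    (by exact_mod_cast dyadic_intCast 1)
  have himg : γ '' Set.Ioo a b = Set.Ioo 0 1 := by rw [OrderIso.image_Ioo, h1, h2]
  have himg' : (γ⁻¹ : ℝ ≃o ℝ) '' Set.Ioo 0 1 = Set.Ioo a b := by
    rw [OrderIso.image_Ioo, (orderIso_inv_apply_eq γ).2 h1.symm, (orderIso_inv_apply_eq γ).2 h2.symm]
  have hmap : (compactPL (Set.Ioo a b)).map (MulAut.conj γ).toMonoidHom = compactPL (Set.Ioo 0 1) := by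
    apply le_antisymm
    · rintro _ ⟨f, hf, rfl⟩
      have := conj_mem_compactPL hf hγ
      rwa [himg] at this
    · intro f hf
      have := conj_mem_compactPL hf (inv_mem hγ)
      rw [himg'] at this
      exact ⟨_, this, by simp [mul_assoc]⟩
  have e1 := Subgroup.equivMapOfInjective (compactPL (Set.Ioo a b)) (MulAut.conj γ).toMonoidHom
    (MulAut.conj γ).injective
  have e2 := Subgroup.equivMapOfInjective (commutator thompsonF) (extendUnit.comp thompsonF.subtype)
    (extendUnit_injective.comp Subtype.val_injective)
  exact ⟨(e1.trans (MulEquiv.subgroupCongr (hmap.trans map_commutator_thompsonF.symm))).trans e2.symm⟩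


/-! ### The generators of `G_ρ` and their localized versions -/

theorem orient_mul (l : Letter) (u v : unitInterval ≃o unitInterval) :
    orient l (u * v) = orient l u * orient l v := by
  cases l <;> first | rfl | exact flipConj_mul u v

@[simp] theorem orient_orient (l : Letter) (u : unitInterval ≃o unitInterval) :
    orient l (orient l u) = u := by
  cases l <;> simp [orient]

theorem orient_mem_thompsonF (l : Letter) {u : unitInterval ≃o unitInterval} (hu : u ∈ thompsonF) :
    orient l u ∈ thompsonF := by
  cases l <;> first | exact hu | exact flipConj_mem_thompsonF hu

theorem orient_mem_compactF (l : Letter) {u : unitInterval ≃o unitInterval} (hu : u ∈ compactF) :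
    orient l u ∈ compactF := by
  cases l <;> first | exact hu | exact flipConj_mem_compactF hu

theorem orient_inv_apply (l : Letter) (u : unitInterval ≃o unitInterval) (t : unitInterval) :
    (orient l.inv u (unitInterval.symm t) : ℝ) = 1 - orient l u t := by
  cases l <;> simp [orient, Letter.inv]

theorem glueHalf_mul (ν μ : ℤ → (unitInterval ≃o unitInterval)) :
    glueHalf (ν * μ) = glueHalf ν * glueHalf μ := by
  have h : glue (ν * μ) = glue ν * glue μ := glueHom.map_mul ν μ
  ext x
  change glue (ν * μ) (x + 1 / 2) + -(1 / 2) =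
    glue ν (glue μ (x + 1 / 2) + -(1 / 2) + 1 / 2) + -(1 / 2)
  rw [h, neg_add_cancel_right]
  rfl

/-- `zeta ρ` as a homomorphism. -/
noncomputable def zetaHom (ρ : ℤ → Letter) : (unitInterval ≃o unitInterval) →* (ℝ ≃o ℝ) :=
  MonoidHom.mk' (zeta ρ) fun u v => by
    simp only [zeta, orient_mul]
    exact glueHom.map_mul _ _

/-- `chi ρ` as a homomorphism. -/
noncomputable def chiHom (ρ : ℤ → Letter) : (unitInterval ≃o unitInterval) →* (ℝ ≃o ℝ) :=
  MonoidHom.mk' (chi ρ) fun u v => by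
    simp only [chi, orient_mul]
    exact glueHalf_mul _ _

/-- The letters of the same parity as `i` act on the line through `gen ρ i`. -/
noncomputable def gen (ρ : ℤ → Letter) (i : ℤ) : (unitInterval ≃o unitInterval) →* (ℝ ≃o ℝ) :=
  if Even i then chiHom ρ else zetaHom ρ

theorem gen_apply (ρ : ℤ → Letter) (i m : ℤ) (u : unitInterval ≃o unitInterval) (t : unitInterval) :
    gen ρ i u (((i + 2 * m : ℤ) - 1) / 2 + t) =
      ((i + 2 * m : ℤ) - 1) / 2 + orient (ρ (i + 2 * m)) u t := by
  rcases Int.even_or_odd' i with ⟨n, rfl | rfl⟩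
  · have h : gen ρ (2 * n) = chiHom ρ := by simp [gen]
    rw [h]
    have := glueHalf_apply (fun n => orient (ρ (2 * n)) u) (n + m) t
    rw [mul_add] at this
    convert this using 2 <;> first | rfl | (push_cast; ring)
  · have h : gen ρ (2 * n + 1) = zetaHom ρ := by simp [gen]
    rw [h]
    have := glue_apply (fun n => orient (ρ (2 * n + 1)) u) (n + m) t
    rw [show 2 * n + 1 + 2 * m = 2 * (n + m) + 1 by ring]
    convert this using 2 <;> first | rfl | (push_cast; ring)

theorem gen_apply_self (ρ : ℤ → Letter) (i : ℤ) (u : unitInterval ≃o unitInterval) (t : unitInterval) :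
    gen ρ i u ((i - 1) / 2 + t) = (i - 1) / 2 + orient (ρ i) u t := by
  simpa using gen_apply ρ i 0 u t

section Generators

variable {c₀ ν₂ ν₃ : unitInterval ≃o unitInterval}

theorem IsBaseElement.nu₁_mem (hc : IsBaseElement c₀) : nu₁ c₀ ∈ thompsonF :=
  mul_mem (flipConj_mem_thompsonF hc.mem) hc.mem

theorem IsBaseElement.apply_of_ge (hc : IsBaseElement c₀) {t : unitInterval} (ht : (1 / 4 : ℝ) ≤ t) :
    c₀ t = t := by
  by_contra h
  have : (t : ℝ) ∈ Subtype.val '' supp c₀ := ⟨t, h, rfl⟩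
  rw [hc.supp_eq] at this
  exact not_lt.2 ht this.2

theorem IsBaseElement.flipConj_apply (hc : IsBaseElement c₀) {t : unitInterval} (ht : (t : ℝ) ≤ 3 / 4) :
    flipConj c₀ t = t := by
  apply Subtype.ext
  rw [coe_flipConj_apply, hc.apply_of_ge, unitInterval.coe_symm_eq]
  · ring
  · rw [unitInterval.coe_symm_eq]; linarith

theorem IsBaseElement.le_apply (hc : IsBaseElement c₀) (t : unitInterval) : t ≤ c₀ t := by
  rcases le_or_gt (1 / 4 : ℝ) t with h | h
  · rw [hc.apply_of_ge h]
  rcases t.2.1.eq_or_lt with h0 | h0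
  · exact Subtype.coe_le_coe.1 (h0.ge.trans (c₀ t).2.1)
  · exact (hc.lt_apply t h0 h).le

/-- `c₀` doubles points below `1/16` and moves nothing to the left, while its mirror image fixes
everything up to `3/4`. -/
theorem IsBaseElement.nu₁_expand (hc : IsBaseElement c₀) {α : ℝ} {t : unitInterval}
    (ht : α ≤ t) (hα : 0 < α) : min (2 * α) (1 / 16) ≤ nu₁ c₀ t := by
  change _ ≤ (flipConj c₀ (c₀ t) : ℝ)
  rcases lt_or_ge (t : ℝ) (1 / 16) with h | h
  · have e := hc.apply_eq t (by linarith) h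
    rw [hc.flipConj_apply (by rw [e]; linarith), e]
    exact (min_le_left _ _).trans (by linarith)
  · refine (min_le_right _ _).trans ?_
    let s : unitInterval := ⟨1 / 16, by norm_num, by norm_num⟩
    have h1 : s ≤ c₀ t := le_trans (Subtype.coe_le_coe.1 h) (hc.le_apply t)
    have h2 := (flipConj c₀).monotone h1
    rw [hc.flipConj_apply (t := s) (by norm_num [s])] at h2
    exact h2

/-- `c₀` and its mirror image have disjoint supports, so they commute. -/
theorem IsBaseElement.flipConj_nu₁ (hc : IsBaseElement c₀) : flipConj (nu₁ c₀) = nu₁ c₀ := by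
  have hflip : ∀ t : unitInterval, flipConj c₀ t ≤ t := fun t => by
    have := hc.le_apply (unitInterval.symm t)
    rw [← Subtype.coe_le_coe, coe_flipConj_apply]
    rw [← Subtype.coe_le_coe, unitInterval.coe_symm_eq] at this
    linarith
  rw [nu₁, flipConj_mul, flipConj_flipConj]
  ext t
  congr 1
  simp only [orderIso_mul_apply]
  have hq : (1 / 4 : ℝ) ∈ unitInterval := by constructor <;> norm_num
  have hq' : (3 / 4 : ℝ) ∈ unitInterval := by constructor <;> norm_num
  rcases le_total (t : ℝ) (1 / 4) with h | h
  · have h1 : c₀ t ≤ ⟨1 / 4, hq⟩ := by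
      rw [← hc.apply_of_ge (t := ⟨1 / 4, hq⟩) le_rfl]
      exact c₀.monotone h
    have h2 : ((c₀ t : unitInterval) : ℝ) ≤ 1 / 4 := h1
    rw [hc.flipConj_apply (by linarith), hc.flipConj_apply (by linarith)]
  · rw [hc.apply_of_ge h, hc.apply_of_ge]
    rcases le_total (t : ℝ) (3 / 4) with h' | h'
    · rwa [hc.flipConj_apply h']
    · have h1 : (⟨3 / 4, hq'⟩ : unitInterval) ≤ flipConj c₀ t := by
        rw [← hc.flipConj_apply (t := ⟨3 / 4, hq'⟩) le_rfl]
        exact (flipConj c₀).monotone h'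
      have h2 : (3 / 4 : ℝ) ≤ (flipConj c₀ t : unitInterval) := h1
      linarith

theorem IsBaseElement.nu₁_pow_expand (hc : IsBaseElement c₀) {α : ℝ} (hα : 0 < α) (hα' : α ≤ 1 / 16)
    (n : ℕ) (t : unitInterval) (ht : (t : ℝ) ∈ Set.Icc α (1 - α)) :
    (((nu₁ c₀) ^ n) t : ℝ) ∈ Set.Icc (min (2 ^ n * α) (1 / 16)) (1 - min (2 ^ n * α) (1 / 16)) := by
  induction n with
  | zero => rw [pow_zero, one_mul, min_eq_left hα']; exact ht
  | succ n ih =>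
    rw [pow_succ' (nu₁ c₀), orderIso_mul_apply]
    set s := ((nu₁ c₀) ^ n) t
    have hpos : 0 < min (2 ^ n * α) (1 / 16) := by positivity
    have hle : min (2 ^ (n + 1) * α) (1 / 16) ≤ min (2 * min (2 ^ n * α) (1 / 16)) (1 / 16) := by
      refine le_min ?_ (min_le_right _ _)
      rw [mul_min_of_nonneg _ _ two_pos.le, ← mul_assoc, ← pow_succ']
      exact le_min (min_le_left _ _) ((min_le_right _ _).trans (by norm_num))
    have h1 := hc.nu₁_expand ih.1 hpos
    have h2 := hc.nu₁_expand (t := unitInterval.symm s) (α := min (2 ^ n * α) (1 / 16))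
      (by rw [unitInterval.coe_symm_eq]; linarith [ih.2]) hpos
    have h3 : (nu₁ c₀ s : ℝ) = 1 - nu₁ c₀ (unitInterval.symm s) := by
      conv_lhs => rw [← hc.flipConj_nu₁]
      rw [coe_flipConj_apply]
    exact ⟨hle.trans h1, by rw [h3]; linarith⟩

/-- Powers of `nu₁ c₀` push points away from `0` and `1`, so some power conjugates a given element
of `compactF` into `F_{[1/16, 15/16]}`, which `ν₂` and `ν₃` generate. -/
theorem compactF_le {H : Subgroup (unitInterval ≃o unitInterval)} (hc : IsBaseElement c₀)
    (hν : IsMiddlePair ν₂ ν₃) (h1 : nu₁ c₀ ∈ H) (h2 : ν₂ ∈ H) (h3 : ν₃ ∈ H) : compactF ≤ H := by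
  have hmid : thompsonFOn (1 / 16) (15 / 16) ≤ H := by
    rw [← hν.closure_eq, Subgroup.closure_le]
    rintro _ (rfl | rfl)
    · exact h2
    · exact h3
  rintro u ⟨hu, α, hα, hfix⟩
  obtain ⟨n, hn⟩ := pow_unbounded_of_one_lt (1 / 16 / min α (1 / 16)) one_lt_two
  have hβ : 0 < min α (1 / 16) := by positivity
  have hn' : (1 / 16 : ℝ) ≤ 2 ^ n * min α (1 / 16) := by
    rw [div_lt_iff₀ hβ] at hn
    exact hn.le
  have key : nu₁ c₀ ^ n * u * (nu₁ c₀ ^ n)⁻¹ ∈ H := by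
    refine hmid ⟨mul_mem (mul_mem (pow_mem hc.nu₁_mem n) hu) (inv_mem (pow_mem hc.nu₁_mem n)),
      fun x hx => ?_⟩
    by_contra hxout
    apply hx
    have hy : u ((nu₁ c₀ ^ n)⁻¹ x) = (nu₁ c₀ ^ n)⁻¹ x := by
      by_contra hne
      have hmem : (((nu₁ c₀ ^ n)⁻¹ x : unitInterval) : ℝ) ∈ Set.Icc α (1 - α) := by
        by_contra h
        exact hne (hfix _ h)
      have := hc.nu₁_pow_expand hβ (min_le_right _ _) n _
        ⟨(min_le_left _ _).trans hmem.1, hmem.2.trans (by linarith [min_le_left α (1 / 16)])⟩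
      rw [orderIso_apply_inv_self, min_eq_right hn'] at this
      exact hxout ⟨this.1, this.2.trans (by norm_num)⟩
    simp [hy]
  have hp := pow_mem h1 n
  have := mul_mem (mul_mem (inv_mem hp) key) hp
  simpa [mul_assoc] using this

theorem gen_mem_simpleGroup (ρ : ℤ → Letter) (hc : IsBaseElement c₀) (hν : IsMiddlePair ν₂ ν₃) (i : ℤ)
    {u : unitInterval ≃o unitInterval} (hu : u ∈ compactF) : gen ρ i u ∈ simpleGroup ρ c₀ ν₂ ν₃ := by
  have hle : compactF ≤ (simpleGroup ρ c₀ ν₂ ν₃).comap (gen ρ i) := by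
    apply compactF_le hc hν <;> rw [Subgroup.mem_comap, gen] <;> split_ifs <;>
      exact Subgroup.subset_closure (by simp [zetaHom, chiHom])
  exact hle hu

end Generators


/-! ### The symmetries of the half integers -/

/-- The isometry `x ↦ e * x + m` of the line, where `e = ±1`. -/
@[ext] structure Dihedral where
  /-- the linear part -/
  e : ℤˣ
  /-- the translation part -/
  m : ℤ

namespace Dihedral

instance : Mul Dihedral := ⟨fun σ τ => ⟨σ.e * τ.e, σ.e * τ.m + σ.m⟩⟩
instance : One Dihedral := ⟨⟨1, 0⟩⟩
instance : Inv Dihedral := ⟨fun σ => ⟨σ.e⁻¹, -((σ.e⁻¹ : ℤˣ) * σ.m)⟩⟩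

@[simp] theorem mul_e (σ τ : Dihedral) : (σ * τ).e = σ.e * τ.e := rfl
@[simp] theorem mul_m (σ τ : Dihedral) : (σ * τ).m = σ.e * τ.m + σ.m := rfl
@[simp] theorem one_e : (1 : Dihedral).e = 1 := rfl
@[simp] theorem one_m : (1 : Dihedral).m = 0 := rfl
@[simp] theorem inv_e (σ : Dihedral) : (σ⁻¹).e = σ.e⁻¹ := rfl
@[simp] theorem inv_m (σ : Dihedral) : (σ⁻¹).m = -((σ.e⁻¹ : ℤˣ) * σ.m) := rfl

instance : Group Dihedral := Group.ofLeftAxioms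
  (fun σ τ υ => by ext <;> simp [mul_assoc]; ring)
  (fun σ => by ext <;> simp) (fun σ => by ext <;> simp)

instance : MulAction Dihedral ℝ where
  smul σ x := (σ.e : ℤ) * x + σ.m
  one_smul x := by change (((1 : ℤˣ) : ℤ) : ℝ) * x + ((0 : ℤ) : ℝ) = x; simp
  mul_smul σ τ x := by
    change (((σ.e * τ.e : ℤˣ) : ℤ) : ℝ) * x + ((σ.e * τ.m + σ.m : ℤ) : ℝ) =
      ((σ.e : ℤ) : ℝ) * (((τ.e : ℤ) : ℝ) * x + (τ.m : ℝ)) + (σ.m : ℝ)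
    push_cast; ring

/-- An index `j` stands for the half integer `j / 2`, so the translation part is doubled. -/
instance : MulAction Dihedral ℤ where
  smul σ j := σ.e * j + 2 * σ.m
  one_smul j := by change ((1 : ℤˣ) : ℤ) * j + 2 * 0 = j; simp
  mul_smul σ τ j := by
    change ((σ.e * τ.e : ℤˣ) : ℤ) * j + 2 * (σ.e * τ.m + σ.m) =
      (σ.e : ℤ) * ((τ.e : ℤ) * j + 2 * τ.m) + 2 * σ.m
    push_cast; ring

theorem inv_letter_inv (l : Letter) : l.inv.inv = l := by cases l <;> rfl

theorem letter_inv_ne (l : Letter) : l.inv ≠ l := by cases l <;> simp [Letter.inv]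

/-- Reflections invert letters, matching the exchange of `ν` and `ι ∘ ν ∘ ι` in the definition of
the generators. -/
instance : MulAction Dihedral Letter where
  smul σ l := if σ.e = 1 then l else l.inv
  one_smul l := rfl
  mul_smul σ τ l := by
    change (if σ.e * τ.e = 1 then l else l.inv) =
      if σ.e = 1 then (if τ.e = 1 then l else l.inv) else (if τ.e = 1 then l else l.inv).inv
    rcases Int.units_eq_one_or σ.e with h | h <;> rcases Int.units_eq_one_or τ.e with h' | h' <;>
      simp [h, h', inv_letter_inv]

theorem smul_real_def (σ : Dihedral) (x : ℝ) : σ • x = (σ.e : ℤ) * x + σ.m := rfl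

theorem smul_real_of_one {σ : Dihedral} (h : σ.e = 1) (x : ℝ) : σ • x = x + σ.m := by
  simp [smul_real_def, h]

theorem smul_real_of_neg {σ : Dihedral} (h : σ.e = -1) (x : ℝ) : σ • x = -x + σ.m := by
  simp [smul_real_def, h]

theorem smul_int_of_one {σ : Dihedral} (h : σ.e = 1) (j : ℤ) : σ • j = j + 2 * σ.m := by
  change (σ.e : ℤ) * j + 2 * σ.m = _
  simp [h]

theorem smul_int_of_neg {σ : Dihedral} (h : σ.e = -1) (j : ℤ) : σ • j = -j + 2 * σ.m := by
  change (σ.e : ℤ) * j + 2 * σ.m = _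
  simp [h]

theorem smul_letter_of_one {σ : Dihedral} (h : σ.e = 1) (l : Letter) : σ • l = l := by
  change (if σ.e = 1 then l else l.inv) = _
  simp [h]

theorem smul_letter_of_neg {σ : Dihedral} (h : σ.e = -1) (l : Letter) : σ • l = l.inv := by
  change (if σ.e = 1 then l else l.inv) = _
  simp [h]

theorem smul_half (σ : Dihedral) (j : ℤ) : ((σ • j : ℤ) : ℝ) / 2 = σ • ((j : ℝ) / 2) := by
  rcases Int.units_eq_one_or σ.e with h | h
  · rw [smul_int_of_one h, smul_real_of_one h]; push_cast; ring
  · rw [smul_int_of_neg h, smul_real_of_neg h]; push_cast; ring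

theorem abs_smul_sub_smul (σ : Dihedral) (x y : ℝ) : |σ • x - σ • y| = |x - y| := by
  rcases Int.units_eq_one_or σ.e with h | h
  · rw [smul_real_of_one h, smul_real_of_one h]; congr 1; ring
  · rw [smul_real_of_neg h, smul_real_of_neg h, ← abs_neg]; congr 1; ring

end Dihedral

/-- The closed unit interval with centre `i / 2`. -/
def unitI (i : ℤ) : Set ℝ := Set.Icc (((i : ℝ) - 1) / 2) ((i + 1) / 2)

/-- The closed half unit interval with left endpoint `j / 2`. -/
def halfI (j : ℤ) : Set ℝ := Set.Icc ((j : ℝ) / 2) ((j + 1) / 2)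

theorem mem_unitI_iff {i : ℤ} {x : ℝ} : x ∈ unitI i ↔ |x - i / 2| ≤ 1 / 2 := by
  rw [unitI, Set.mem_Icc, abs_le]
  constructor <;> rintro ⟨h1, h2⟩ <;> constructor <;> linarith

theorem smul_mem_unitI {σ : Dihedral} {i : ℤ} {x : ℝ} : σ • x ∈ unitI (σ • i) ↔ x ∈ unitI i := by
  rw [mem_unitI_iff, mem_unitI_iff, Dihedral.smul_half, Dihedral.abs_smul_sub_smul]

/-- Half unit intervals are fundamental domains: translations reach the intervals of one parity and
reflections the others. Uniqueness is `eq_of_smul_eq_smul_halfI`. -/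
theorem exists_smul_halfI (j : ℤ) (x : ℝ) : ∃ σ : Dihedral, ∃ y ∈ halfI j, x = σ • y := by
  set k := ⌊2 * x⌋
  have h1 := Int.floor_le (2 * x)
  have h2 := (Int.lt_floor_add_one (2 * x)).le
  rcases Int.even_or_odd' (k - j) with ⟨m, hm | hm⟩
  · have hm' : (k : ℝ) - j = 2 * m := by exact_mod_cast hm
    refine ⟨⟨1, m⟩, x - m, ⟨?_, ?_⟩, ?_⟩
    · linarith
    · linarith
    · rw [Dihedral.smul_real_of_one rfl]; simp
  · have hm' : (k : ℝ) - j = 2 * m + 1 := by exact_mod_cast hm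
    refine ⟨⟨-1, m + j + 1⟩, -x + (m + j + 1), ⟨?_, ?_⟩, ?_⟩
    · linarith
    · linarith
    · rw [Dihedral.smul_real_of_neg rfl]; push_cast; ring

theorem eq_of_smul_eq_smul_halfI {σ τ : Dihedral} {j : ℤ} {x y : ℝ} (hx : x ∈ halfI j)
    (hy : y ∈ Set.Ioo ((j : ℝ) / 2) ((j + 1) / 2)) (h : σ • x = τ • y) : σ = τ := by
  have hx1 := hx.1
  have hx2 := hx.2
  have hy1 := hy.1
  have hy2 := hy.2
  rcases Int.units_eq_one_or σ.e with hσ | hσ <;> rcases Int.units_eq_one_or τ.e with hτ | hτ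
  · rw [Dihedral.smul_real_of_one hσ, Dihedral.smul_real_of_one hτ] at h
    have h1 : (σ.m : ℝ) < τ.m + 1 := by linarith
    have h2 : (τ.m : ℝ) < σ.m + 1 := by linarith
    norm_cast at h1 h2
    ext
    · rw [hσ, hτ]
    · omega
  · rw [Dihedral.smul_real_of_one hσ, Dihedral.smul_real_of_neg hτ] at h
    have h1 : (j : ℝ) < τ.m - σ.m := by linarith
    have h2 : (τ.m : ℝ) - σ.m < j + 1 := by linarith
    norm_cast at h1 h2
    omega
  · rw [Dihedral.smul_real_of_neg hσ, Dihedral.smul_real_of_one hτ] at h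
    have h1 : (j : ℝ) < σ.m - τ.m := by linarith
    have h2 : (σ.m : ℝ) - τ.m < j + 1 := by linarith
    norm_cast at h1 h2
    omega
  · rw [Dihedral.smul_real_of_neg hσ, Dihedral.smul_real_of_neg hτ] at h
    have h1 : (σ.m : ℝ) < τ.m + 1 := by linarith
    have h2 : (τ.m : ℝ) < σ.m + 1 := by linarith
    norm_cast at h1 h2
    ext
    · rw [hσ, hτ]
    · omega

/-- The symmetry `σ` respects the labels of the elements of `B`. -/
def Matches (ρ : ℤ → Letter) (σ : Dihedral) (B : Set ℤ) : Prop :=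
  ∀ j ∈ B, ρ (σ • j) = σ • ρ j

theorem Matches.mono {ρ : ℤ → Letter} {σ : Dihedral} {B C : Set ℤ} (h : Matches ρ σ C) (hBC : B ⊆ C) :
    Matches ρ σ B := fun j hj => h j (hBC hj)

theorem matches_one (ρ : ℤ → Letter) (B : Set ℤ) : Matches ρ 1 B := fun j _ => by
  rw [one_smul, one_smul]

theorem Matches.mul {ρ : ℤ → Letter} {σ τ : Dihedral} {B C : Set ℤ} (hσ : Matches ρ σ C)
    (hτ : Matches ρ τ B) (h : ∀ j ∈ B, τ • j ∈ C) : Matches ρ (σ * τ) B := fun j hj => by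
  rw [mul_smul, hσ _ (h j hj), hτ j hj, mul_smul]

theorem Matches.inv {ρ : ℤ → Letter} {σ : Dihedral} {B C : Set ℤ} (hσ : Matches ρ σ C)
    (h : ∀ j ∈ B, σ⁻¹ • j ∈ C) : Matches ρ σ⁻¹ B := fun j hj => by
  have := hσ _ (h j hj)
  rw [smul_inv_smul] at this
  rw [this, inv_smul_smul]

/-- As no letter is its own inverse, the label at the common image of `j` determines the
orientation; the image then determines the translation part. -/
theorem Matches.eq_of_smul_eq {ρ : ℤ → Letter} {σ τ : Dihedral} {B : Set ℤ} (hσ : Matches ρ σ B)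
    (hτ : Matches ρ τ B) {j : ℤ} (hj : j ∈ B) (h : σ • j = τ • j) : σ = τ := by
  have h1 : σ • ρ j = τ • ρ j := by rw [← hσ j hj, ← hτ j hj, h]
  rcases Int.units_eq_one_or σ.e with hs | hs <;> rcases Int.units_eq_one_or τ.e with ht | ht
  · rw [Dihedral.smul_int_of_one hs, Dihedral.smul_int_of_one ht] at h
    ext
    · rw [hs, ht]
    · omega
  · rw [Dihedral.smul_letter_of_one hs, Dihedral.smul_letter_of_neg ht] at h1
    exact absurd h1.symm (Dihedral.letter_inv_ne _)
  · rw [Dihedral.smul_letter_of_neg hs, Dihedral.smul_letter_of_one ht] at h1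
    exact absurd h1 (Dihedral.letter_inv_ne _)
  · rw [Dihedral.smul_int_of_neg hs, Dihedral.smul_int_of_neg ht] at h
    ext
    · rw [hs, ht]
    · omega

/-- The labels of the same parity agree up to inversion, so that one of any two symmetries which differ
by the reflection in `i / 2` respects the label of `i`. -/
theorem IsLabelling.eq_or_eq_inv {ρ : ℤ → Letter} (hρ : IsLabelling ρ) (i m : ℤ) :
    ρ (i + 2 * m) = ρ i ∨ ρ (i + 2 * m) = (ρ i).inv := by
  rcases Int.even_or_odd i with h | h
  · rcases hρ.1 i h with h1 | h1 <;>
      rcases hρ.1 (i + 2 * m) (h.add (even_two_mul m)) with h2 | h2 <;> simp [h1, h2, Letter.inv]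
  · rcases hρ.2 i h with h1 | h1 <;>
      rcases hρ.2 (i + 2 * m) (h.add_even (even_two_mul m)) with h2 | h2 <;> simp [h1, h2, Letter.inv]

theorem gen_smul {ρ : ℤ → Letter} {σ : Dihedral} {i : ℤ} (h : ρ (σ • i) = σ • ρ i)
    (u : unitInterval ≃o unitInterval) {x : ℝ} (hx : x ∈ unitI i) :
    gen ρ i u (σ • x) = σ • gen ρ i u x := by
  obtain ⟨t, rfl⟩ : ∃ t : unitInterval, x = (i - 1) / 2 + t :=
    ⟨⟨x - (i - 1) / 2, by linarith [hx.1], by linarith [hx.2]⟩, by simp⟩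
  rw [gen_apply_self]
  rcases Int.units_eq_one_or σ.e with hs | hs
  · rw [Dihedral.smul_int_of_one hs, Dihedral.smul_letter_of_one hs] at h
    have := gen_apply ρ i σ.m u t
    rw [h] at this
    rw [Dihedral.smul_real_of_one hs, Dihedral.smul_real_of_one hs,
      show ((i : ℝ) - 1) / 2 + t + σ.m = ((i + 2 * σ.m : ℤ) - 1) / 2 + t by push_cast; ring, this]
    push_cast
    ring
  · rw [Dihedral.smul_int_of_neg hs, Dihedral.smul_letter_of_neg hs] at h
    have := gen_apply ρ i (σ.m - i) u (unitInterval.symm t)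
    rw [show i + 2 * (σ.m - i) = -i + 2 * σ.m by ring, h, orient_inv_apply] at this
    rw [unitInterval.coe_symm_eq] at this
    rw [Dihedral.smul_real_of_neg hs, Dihedral.smul_real_of_neg hs,
      show -(((i : ℝ) - 1) / 2 + t) + σ.m = ((-i + 2 * σ.m : ℤ) - 1) / 2 + (1 - t) by
        push_cast; ring, this]
    push_cast
    ring

/-- The half integers in `[a, b]`. -/
def window (a b : ℝ) : Set ℤ := {j | a ≤ (j : ℝ) / 2 ∧ (j : ℝ) / 2 ≤ b}

theorem window_mono {a b a' b' : ℝ} (h : a' ≤ a) (h' : b ≤ b') : window a b ⊆ window a' b' :=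
  fun _ hj => ⟨h.trans hj.1, hj.2.trans h'⟩

/-- The homeomorphisms of the line which are locally piecewise linear, have bounded displacement, and
commute with the symmetries which respect the labels of large neighbourhoods. -/
def localGroup (ρ : ℤ → Letter) : Subgroup (ℝ ≃o ℝ) where
  carrier := {f | (∃ d, ∀ x, |f x - x| ≤ d) ∧
    (∃ r, ∀ (σ : Dihedral) (y : ℝ), Matches ρ σ (window (y - r) (y + r)) → f (σ • y) = σ • f y) ∧
    ∀ a b, ∃ γ ∈ dyadicPL, ∀ x ∈ Set.Icc a b, f x = γ x}
  one_mem' := ⟨⟨0, by simp⟩, ⟨0, fun _ _ _ => rfl⟩, fun _ _ => ⟨1, one_mem _, fun _ _ => rfl⟩⟩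
  mul_mem' := by
    rintro f g ⟨⟨d, hd⟩, ⟨r, hr⟩, hf⟩ ⟨⟨d', hd'⟩, ⟨r', hr'⟩, hg⟩
    refine ⟨⟨d + d', fun x => ?_⟩, ⟨max r' (r + d'), fun σ y h => ?_⟩, fun a b => ?_⟩
    · calc |f (g x) - x| = |(f (g x) - g x) + (g x - x)| := by congr 1; ring
        _ ≤ _ := (abs_add_le _ _).trans (add_le_add (hd _) (hd' _))
    -- `g` moves `y` by at most `d'`, so radius `r + d'` around `y` contains radius `r` around `g
    -- y`.
    · have h1 := abs_le.1 (hd' y)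
      have h2 := le_max_left r' (r + d')
      have h3 := le_max_right r' (r + d')
      rw [orderIso_mul_apply, hr' σ y (h.mono (window_mono (by linarith) (by linarith))),
        hr σ (g y) (h.mono (window_mono (by linarith) (by linarith))), orderIso_mul_apply]
    · obtain ⟨γ, hγ, h1⟩ := hg a b
      obtain ⟨δ, hδ, h2⟩ := hf (g a) (g b)
      exact ⟨δ * γ, mul_mem hδ hγ, fun x hx => by
        rw [orderIso_mul_apply, orderIso_mul_apply, ← h1 x hx,
          h2 _ ⟨g.monotone hx.1, g.monotone hx.2⟩]⟩
  inv_mem' := by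
    rintro f ⟨⟨d, hd⟩, ⟨r, hr⟩, hf⟩
    have hd' : ∀ x, |f⁻¹ x - x| ≤ d := fun x => by
      have := hd (f⁻¹ x)
      rwa [orderIso_apply_inv_self, abs_sub_comm] at this
    refine ⟨⟨d, hd'⟩, ⟨r + d, fun σ y h => ?_⟩, fun a b => ?_⟩
    · have h1 := abs_le.1 (hd' y)
      rw [orderIso_inv_apply_eq, hr σ (f⁻¹ y) (h.mono (window_mono (by linarith) (by linarith))),
        orderIso_apply_inv_self]
    · obtain ⟨γ, hγ, h1⟩ := hf (f⁻¹ a) (f⁻¹ b)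
      exact ⟨γ⁻¹, inv_mem hγ, fun x hx => by
        have := h1 (f⁻¹ x) ⟨(f⁻¹).monotone hx.1, (f⁻¹).monotone hx.2⟩
        rw [orderIso_apply_inv_self] at this
        rw [eq_comm, orderIso_inv_apply_eq, ← this]⟩

theorem gen_add_two_mul (ρ : ℤ → Letter) (i m : ℤ) : gen ρ (i + 2 * m) = gen ρ i := by
  simp [gen, Int.even_add]

theorem exists_mem_unitI (i : ℤ) (x : ℝ) : ∃ m : ℤ, x ∈ unitI (i + 2 * m) := by
  refine ⟨⌊x - (i - 1) / 2⌋, ?_, ?_⟩ <;> push_cast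
  · linarith [Int.floor_le (x - (i - 1) / 2)]
  · linarith [Int.lt_floor_add_one (x - (i - 1) / 2)]

theorem glue_mulSingle_mem (n : ℤ) {u : unitInterval ≃o unitInterval} (hu : u ∈ thompsonF) :
    glue (Pi.mulSingle n u) ∈ dyadicPL := by
  have hT := affineMap_mem 0 (dyadic_intCast n)
  have : glue (Pi.mulSingle n u) = affineMap 0 n * extendUnit u * (affineMap 0 n)⁻¹ := by
    rw [eq_mul_inv_iff_mul_eq]
    ext x
    obtain ⟨k, t, rfl⟩ := exists_int_add_unit x
    have h1 : extendUnit u (k + t) = k + (Pi.mulSingle (M := fun _ : ℤ => (unitInterval ≃o unitInterval)) 0 u) k t :=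
      glue_apply _ k t
    have h2 := glue_apply (Pi.mulSingle n u) (k + n) t
    have h3 : (Pi.mulSingle (M := fun _ : ℤ => (unitInterval ≃o unitInterval)) n u) (k + n) =
        (Pi.mulSingle (M := fun _ : ℤ => (unitInterval ≃o unitInterval)) 0 u) k := by
      by_cases hk : k = 0 <;> simp [hk]
    rw [orderIso_mul_apply, orderIso_mul_apply, h1, affineMap_apply, affineMap_apply, zpow_zero,
      one_mul, one_mul, ← h3, show (k : ℝ) + t + n = ((k + n : ℤ) : ℝ) + t by push_cast; ring, h2]
    push_cast
    ring
  rw [this]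
  exact mul_mem (mul_mem hT (extendUnit_mem_dyadicPL hu)) (inv_mem hT)

/-- Only finitely many pieces meet a bounded interval, and a finite product of single pieces lies in
`dyadicPL`. -/
theorem glue_eqOn_dyadicPL {ν : ℤ → (unitInterval ≃o unitInterval)} (hν : ∀ n, ν n ∈ thompsonF)
    (a b : ℝ) : ∃ γ ∈ dyadicPL, ∀ x ∈ Set.Icc a b, glue ν x = γ x := by
  classical
  have hfin : ∀ A : Finset ℤ, glue (fun n => if n ∈ A then ν n else 1) ∈ dyadicPL := by
    intro A
    induction A using Finset.induction_on with
    | empty =>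
      simp only [Finset.notMem_empty, if_false]
      have h1 : glue (fun _ => 1) = 1 := map_one glueHom
      exact h1 ▸ one_mem dyadicPL
    | insert n A hn ih =>
      have : (fun k => if k ∈ insert n A then ν k else 1) =
          Pi.mulSingle n (ν n) * fun k => if k ∈ A then ν k else 1 := by
        ext k : 1
        by_cases hk : k = n
        · subst hk; simp [hn]
        · simp [hk]
      rw [this, ← glueHom_apply, map_mul]
      exact mul_mem (glue_mulSingle_mem n (hν n)) ih
  refine ⟨_, hfin (Finset.Icc ⌊a⌋ ⌊b⌋), fun x hx => ?_⟩
  have hmem : ⌊x⌋ ∈ Finset.Icc ⌊a⌋ ⌊b⌋ :=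
    Finset.mem_Icc.2 ⟨Int.floor_mono hx.1, Int.floor_mono hx.2⟩
  have e : x = ⌊x⌋ + ((⟨Int.fract x, fract_mem x⟩ : unitInterval) : ℝ) := (Int.floor_add_fract x).symm
  rw [e, glue_apply, glue_apply, if_pos hmem]

theorem glueHalf_eqOn_dyadicPL {ν : ℤ → (unitInterval ≃o unitInterval)} (hν : ∀ n, ν n ∈ thompsonF)
    (a b : ℝ) : ∃ γ ∈ dyadicPL, ∀ x ∈ Set.Icc a b, glueHalf ν x = γ x := by
  obtain ⟨γ, hγ, h⟩ := glue_eqOn_dyadicPL hν (a + 1 / 2) (b + 1 / 2)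
  have hd : (1 / 2 : ℝ) ∈ dyadic := ⟨1, 1, by norm_num⟩
  refine ⟨affineMap 0 (-(1 / 2)) * γ * affineMap 0 (1 / 2),
    mul_mem (mul_mem (affineMap_mem _ (dyadic_neg hd)) hγ) (affineMap_mem _ hd), fun x hx => ?_⟩
  change glue ν (x + 1 / 2) + -(1 / 2) = _
  simp only [orderIso_mul_apply, affineMap_apply, zpow_zero, one_mul]
  rw [h _ ⟨by linarith [hx.1], by linarith [hx.2]⟩]

theorem gen_mem_localGroup (ρ : ℤ → Letter) (i : ℤ) {u : unitInterval ≃o unitInterval}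
    (hu : u ∈ thompsonF) : gen ρ i u ∈ localGroup ρ := by
  refine ⟨⟨1, fun x => ?_⟩, ⟨1, fun σ y h => ?_⟩, fun a b => ?_⟩
  · obtain ⟨m, hm⟩ := exists_mem_unitI i x
    rw [← gen_add_two_mul ρ i m]
    set i' := i + 2 * m
    obtain ⟨t, rfl⟩ : ∃ t : unitInterval, x = (i' - 1) / 2 + t :=
      ⟨⟨x - (i' - 1) / 2, by linarith [hm.1], by linarith [hm.2]⟩, by simp⟩
    rw [gen_apply_self, abs_le]
    have h1 := t.2.1
    have h2 := t.2.2
    have h3 := (orient (ρ i') u t).2.1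
    have h4 := (orient (ρ i') u t).2.2
    constructor <;> linarith
  · obtain ⟨m, hm⟩ := exists_mem_unitI i y
    rw [← gen_add_two_mul ρ i m]
    refine gen_smul (h _ ?_) u hm
    rw [mem_unitI_iff, abs_le] at hm
    constructor <;> linarith [hm.1, hm.2]
  · rw [gen]
    split_ifs
    · exact glueHalf_eqOn_dyadicPL (fun n => orient_mem_thompsonF _ hu) a b
    · exact glue_eqOn_dyadicPL (fun n => orient_mem_thompsonF _ hu) a b

theorem simpleGroup_le_localGroup (ρ : ℤ → Letter) {c₀ ν₂ ν₃ : unitInterval ≃o unitInterval}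
    (hc : IsBaseElement c₀) (hν : IsMiddlePair ν₂ ν₃) : simpleGroup ρ c₀ ν₂ ν₃ ≤ localGroup ρ := by
  have hz : ∀ u ∈ thompsonF, zeta ρ u ∈ localGroup ρ := fun u hu => by
    simpa [gen, zetaHom] using gen_mem_localGroup ρ 1 hu
  have hx : ∀ u ∈ thompsonF, chi ρ u ∈ localGroup ρ := fun u hu => by
    simpa [gen, chiHom] using gen_mem_localGroup ρ 0 hu
  have hν' : ∀ u ∈ ({ν₂, ν₃} : Set (unitInterval ≃o unitInterval)), u ∈ thompsonF := fun u hu => by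
    have : u ∈ thompsonFOn (1 / 16) (15 / 16) := hν.closure_eq ▸ Subgroup.subset_closure hu
    exact this.1
  have h2 := hν' ν₂ (by simp)
  have h3 := hν' ν₃ (by simp)
  rw [simpleGroup, Subgroup.closure_le]
  rintro _ (rfl | rfl | rfl | rfl | rfl | rfl)
  · exact hz _ hc.nu₁_mem
  · exact hz _ h2
  · exact hz _ h3
  · exact hx _ hc.nu₁_mem
  · exact hx _ h2
  · exact hx _ h3


/-! ### Elements which act by copies of a given homeomorphism on the occurrences of a block -/

/-- `f` acts on `σ • S` as the conjugate of `h` by `σ`, for all symmetries `σ` which respect the labels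
of `B`, and is the identity elsewhere. -/
def Spread (ρ : ℤ → Letter) (B : Set ℤ) (S : Set ℝ) (h f : ℝ ≃o ℝ) : Prop :=
  (∀ σ, Matches ρ σ B → ∀ y ∈ S, f (σ • y) = σ • h y) ∧
  ∀ x, (∀ σ, Matches ρ σ B → ∀ y ∈ S, x ≠ σ • y) → f x = x

theorem Spread.shrink {ρ : ℤ → Letter} {B : Set ℤ} {S S' : Set ℝ} {h f : ℝ ≃o ℝ}
    (H : Spread ρ B S h f) (hS : S' ⊆ S) (hfix : ∀ y ∈ S, y ∉ S' → h y = y) : Spread ρ B S' h f := by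
  refine ⟨fun σ hσ y hy => H.1 σ hσ y (hS hy), fun x hx => ?_⟩
  by_cases hx' : ∃ σ, Matches ρ σ B ∧ ∃ y ∈ S, x = σ • y
  · obtain ⟨σ, hσ, y, hy, rfl⟩ := hx'
    rw [H.1 σ hσ y hy, hfix y hy fun h => hx σ hσ y h rfl]
  · exact H.2 x fun σ hσ y hy he => hx' ⟨σ, hσ, y, hy, he⟩

/-- A point of `σ • S` outside `σ • S'` might lie in another copy `τ • S'` and be moved there;
`hfree` excludes this. -/
theorem Spread.enlarge {ρ : ℤ → Letter} {B : Set ℤ} {S S' : Set ℝ} {h f : ℝ ≃o ℝ}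
    (H : Spread ρ B S' h f) (hS : S' ⊆ S) (hfix : ∀ y ∈ S, y ∉ S' → h y = y)
    (hfree : ∀ σ τ, Matches ρ σ B → Matches ρ τ B → ∀ y ∈ S, ∀ y' ∈ S', σ • y = τ • y' → σ = τ) :
    Spread ρ B S h f := by
  refine ⟨fun σ hσ y hy => ?_, fun x hx => H.2 x fun σ hσ y hy => hx σ hσ y (hS hy)⟩
  by_cases hy' : y ∈ S'
  · exact H.1 σ hσ y hy'
  · rw [hfix y hy hy', H.2]
    intro τ hτ y' hy'' he
    have := hfree σ τ hσ hτ y hy y' hy'' he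
    subst this
    exact hy' (smul_left_cancel σ he ▸ hy'')

theorem Spread.conj {ρ : ℤ → Letter} {B : Set ℤ} {S : Set ℝ} {h f U γ : ℝ ≃o ℝ}
    (H : Spread ρ B S h f) (hS : ∀ y ∈ S, h y ∈ S)
    (hU : ∀ σ, Matches ρ σ B → ∀ y ∈ S, U (σ • y) = σ • γ y) :
    Spread ρ B (γ '' S) (γ * h * γ⁻¹) (U * f * U⁻¹) := by
  constructor
  · rintro σ hσ _ ⟨y, hy, rfl⟩
    simp only [orderIso_mul_apply]
    rw [← hU σ hσ y hy, orderIso_inv_apply_self, orderIso_inv_apply_self, H.1 σ hσ y hy,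
      hU σ hσ _ (hS y hy)]
  · intro x hx
    simp only [orderIso_mul_apply]
    rw [H.2, orderIso_apply_inv_self]
    intro σ hσ y hy he
    refine hx σ hσ _ ⟨y, hy, rfl⟩ ?_
    rw [← hU σ hσ y hy, ← he, orderIso_apply_inv_self]

theorem Spread.conj_inv {ρ : ℤ → Letter} {B : Set ℤ} {S : Set ℝ} {h f U γ : ℝ ≃o ℝ}
    (H : Spread ρ B (γ '' S) (γ * h * γ⁻¹) f) (hS : ∀ y ∈ S, h y ∈ S)
    (hU : ∀ σ, Matches ρ σ B → ∀ y ∈ S, U (σ • y) = σ • γ y) :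
    Spread ρ B S h (U⁻¹ * f * U) := by
  have := H.conj (U := U⁻¹) (γ := γ⁻¹) (by
    rintro _ ⟨y, hy, rfl⟩
    exact ⟨h y, hS y hy, by simp⟩) (by
    rintro σ hσ _ ⟨y, hy, rfl⟩
    rw [orderIso_inv_apply_eq, orderIso_inv_apply_self, hU σ hσ y hy])
  have e1 : (γ⁻¹ : ℝ ≃o ℝ) '' (γ '' S) = S := by
    ext x
    simp
  have e2 : γ⁻¹ * (γ * h * γ⁻¹) * γ⁻¹⁻¹ = h := by group
  rwa [e1, e2, inv_inv] at this

/-- The homeomorphisms `h` preserving `S` whose spread over the occurrences of `B` lies in `G`. -/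
def spreadGroup (G : Subgroup (ℝ ≃o ℝ)) (ρ : ℤ → Letter) (B : Set ℤ) (S : Set ℝ) :
    Subgroup (ℝ ≃o ℝ) where
  carrier := {h | (∀ y, h y ∈ S ↔ y ∈ S) ∧ ∃ f ∈ G, Spread ρ B S h f}
  one_mem' := ⟨fun _ => Iff.rfl, 1, one_mem _, fun _ _ _ _ => rfl, fun _ _ => rfl⟩
  mul_mem' := by
    rintro h h' ⟨hS, f, hf, H⟩ ⟨hS', f', hf', H'⟩
    refine ⟨fun y => (hS _).trans (hS' y), f * f', mul_mem hf hf', fun σ hσ y hy => ?_, fun x hx => ?_⟩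
    · rw [orderIso_mul_apply, H'.1 σ hσ y hy, H.1 σ hσ _ ((hS' y).2 hy), orderIso_mul_apply]
    · rw [orderIso_mul_apply, H'.2 x hx, H.2 x hx]
  inv_mem' := by
    rintro h ⟨hS, f, hf, H⟩
    have hS' : ∀ y, h⁻¹ y ∈ S ↔ y ∈ S := fun y => by rw [← hS, orderIso_apply_inv_self]
    refine ⟨hS', f⁻¹, inv_mem hf, fun σ hσ y hy => ?_, fun x hx => ?_⟩
    · rw [orderIso_inv_apply_eq, H.1 σ hσ _ ((hS' y).2 hy), orderIso_apply_inv_self]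
    · rw [orderIso_inv_apply_eq, H.2 x hx]

/-- The interior of `unitI i`. -/
def openUnitI (i : ℤ) : Set ℝ := Set.Ioo (((i : ℝ) - 1) / 2) ((i + 1) / 2)

/-- The interior of `halfI j`. -/
def openHalfI (j : ℤ) : Set ℝ := Set.Ioo ((j : ℝ) / 2) ((j + 1) / 2)

theorem compactPL_apply_mem_iff {U S : Set ℝ} (hUS : U ⊆ S) {h : ℝ ≃o ℝ} (hh : h ∈ compactPL U)
    (y : ℝ) : h y ∈ S ↔ y ∈ S := by
  have hfix : ∀ y, y ∉ S → h y = y := fun y hy => compactPL_apply_of_notMem hh fun h => hy (hUS h)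
  constructor
  · intro h1
    by_contra h2
    rw [hfix y h2] at h1
    exact h2 h1
  · intro h1
    by_contra h2
    have := h.injective (hfix _ h2)
    rw [this] at h2
    exact h2 h1

theorem exists_gen_eqOn (ρ : ℤ → Letter) (i : ℤ) {h : ℝ ≃o ℝ} (hh : h ∈ compactPL (openUnitI i)) :
    ∃ u ∈ compactF, ∀ y ∈ unitI i, gen ρ i u y = h y := by
  have hd : ((i : ℝ) - 1) / 2 ∈ dyadic := by exact_mod_cast dyadic_half_intCast (i - 1)
  have hτ := affineMap_mem 0 hd
  set τ := affineMap 0 (((i : ℝ) - 1) / 2)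
  have hτx : ∀ x, τ x = ((i : ℝ) - 1) / 2 + x := fun x => by simp [τ, add_comm]
  have h1 := conj_mem_compactPL hh (inv_mem hτ)
  have himg : (τ⁻¹ : ℝ ≃o ℝ) '' openUnitI i = Set.Ioo 0 1 := by
    rw [openUnitI, OrderIso.image_Ioo, (orderIso_inv_apply_eq τ (y := 0)).2 (by rw [hτx]; ring),
      (orderIso_inv_apply_eq τ (y := 1)).2 (by rw [hτx]; ring)]
  rw [himg, inv_inv] at h1
  obtain ⟨u, -, hu⟩ := exists_extendUnit_eq h1
  have huc : u ∈ compactF := extendUnit_mem_compactPL_iff.1 (hu ▸ h1)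
  refine ⟨orient (ρ i) u, orient_mem_compactF _ huc, fun y hy => ?_⟩
  obtain ⟨t, rfl⟩ : ∃ t : unitInterval, y = (i - 1) / 2 + t :=
    ⟨⟨y - (i - 1) / 2, by linarith [hy.1], by linarith [hy.2]⟩, by simp⟩
  rw [gen_apply_self, orient_orient, ← extendUnit_coe, hu, ← hτx, ← hτx]
  simp

section

variable {G : Subgroup (ℝ ≃o ℝ)} {ρ : ℤ → Letter}

theorem smul_int_eq_of_unitI {σ τ : Dihedral} {i : ℤ} {x y : ℝ} (hx : x ∈ unitI i)
    (hy : y ∈ openUnitI i) (h : σ • x = τ • y) : σ • i = τ • i := by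
  rw [mem_unitI_iff, ← Dihedral.abs_smul_sub_smul σ, ← Dihedral.smul_half, abs_le] at hx
  have hy' : |y - i / 2| < 1 / 2 := by
    rw [abs_lt]; constructor <;> linarith [hy.1, hy.2]
  rw [← Dihedral.abs_smul_sub_smul τ, ← Dihedral.smul_half, ← h, abs_lt] at hy'
  have h1 : ((σ • i : ℤ) : ℝ) < (τ • i : ℤ) + 2 := by linarith [hx.1, hx.2, hy'.1, hy'.2]
  have h2 : ((τ • i : ℤ) : ℝ) < (σ • i : ℤ) + 2 := by linarith [hx.1, hx.2, hy'.1, hy'.2]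
  norm_cast at h1 h2
  rcases Int.units_eq_one_or σ.e with hs | hs <;> rcases Int.units_eq_one_or τ.e with ht | ht <;>
    simp only [Dihedral.smul_int_of_one, Dihedral.smul_int_of_neg, hs, ht] at h1 h2 ⊢ <;> omega

/-- Each unit interval whose centre has the parity of `i` is the image of `unitI i` under a
translation and a reflection, one of which respects the label of `i`. These intervals cover the
line, so `gen ρ i u` is itself the required spread. -/
theorem compactPL_le_spreadGroup_singleton (hρ : IsLabelling ρ)
    (hG : ∀ i, ∀ u ∈ compactF, gen ρ i u ∈ G) (i : ℤ) :
    compactPL (openUnitI i) ≤ spreadGroup G ρ {i} (unitI i) := by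
  intro h hh
  refine ⟨compactPL_apply_mem_iff Set.Ioo_subset_Icc_self hh, ?_⟩
  obtain ⟨u, hu, hu'⟩ := exists_gen_eqOn ρ i hh
  refine ⟨gen ρ i u, hG i u hu, fun σ hσ y hy => ?_, fun x hx => ?_⟩
  · rw [gen_smul (hσ i rfl) u hy, hu' y hy]
  · exfalso
    obtain ⟨m, hm⟩ := exists_mem_unitI i x
    have key : ∀ σ : Dihedral, σ • i = i + 2 * m → ρ (i + 2 * m) = σ • ρ i → False := by
      intro σ h1 h2
      refine hx σ (fun j hj => ?_) (σ⁻¹ • x) ?_ (smul_inv_smul σ x).symm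
      · rw [Set.mem_singleton_iff.1 hj, h1, h2]
      · rwa [← smul_mem_unitI (σ := σ), smul_inv_smul, h1]
    rcases hρ.eq_or_eq_inv i m with h1 | h1
    · refine key ⟨1, m⟩ (Dihedral.smul_int_of_one rfl _) ?_
      rw [h1, Dihedral.smul_letter_of_one rfl]
    · refine key ⟨-1, m + i⟩ ?_ ?_
      · rw [Dihedral.smul_int_of_neg rfl]; ring
      · rw [h1, Dihedral.smul_letter_of_neg rfl]

/-- Conjugation by a one-letter element moves the support of `h` into one half of the unit interval.
Since `i ∈ B`, that element acts compatibly on all occurrences of `B`. -/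
theorem compactPL_le_spreadGroup_unitI (hG : ∀ i, ∀ u ∈ compactF, gen ρ i u ∈ G) {B : Set ℤ} {i j : ℤ}
    (hi : i ∈ B) (hij : j = i ∨ j = i - 1)
    (H : compactPL (openHalfI j) ≤ spreadGroup G ρ B (halfI j)) :
    compactPL (openUnitI i) ≤ spreadGroup G ρ B (unitI i) := by
  intro h hh
  refine ⟨compactPL_apply_mem_iff Set.Ioo_subset_Icc_self hh, ?_⟩
  have hj1 : ((i : ℝ) - 1) / 2 ≤ j / 2 := by rcases hij with rfl | rfl <;> push_cast <;> linarith
  have hj2 : ((j : ℝ) + 1) / 2 ≤ (i + 1) / 2 := by rcases hij with rfl | rfl <;> push_cast <;> linarith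
  obtain ⟨a, b, ha, hb, ha1, hab, hb1, hfix⟩ := exists_dyadic_support (by linarith) hh
  obtain ⟨c, hc, hc1, hc2⟩ := exists_dyadic_between (show (j : ℝ) / 2 < (j + 1) / 2 by linarith)
  obtain ⟨d, hd, hd1, hd2⟩ := exists_dyadic_between hc2
  obtain ⟨α, hα, hαa, hαb⟩ := exists_mem_map hab hd1 ha hb hc hd
  obtain ⟨γ, hγ, hγα⟩ := exists_compactPL_eqOn (a := ((i : ℝ) - 1) / 2) (b := ((i : ℝ) + 1) / 2) hα
    ha hb hab.le ha1 hb1 (by linarith) (by linarith)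
  have hγa : γ a = c := by rw [hγα a ⟨le_rfl, hab.le⟩, hαa]
  have hγb : γ b = d := by rw [hγα b ⟨hab.le, le_rfl⟩, hαb]
  have himg : γ '' Set.Icc a b = Set.Icc c d := by rw [OrderIso.image_Icc, hγa, hγb]
  obtain ⟨u, hu, huγ⟩ := exists_gen_eqOn ρ i (h := γ) hγ
  have hfix' : ∀ x, x ∉ Set.Icc c d → (γ * h * γ⁻¹) x = x := by
    intro x hx
    rw [orderIso_mul_apply, orderIso_mul_apply, hfix, orderIso_apply_inv_self]
    intro hx'
    refine hx (himg ▸ ⟨_, ⟨hx'.1.le, hx'.2.le⟩, ?_⟩)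
    simp
  have hmem : γ * h * γ⁻¹ ∈ compactPL (openHalfI j) :=
    mem_compactPL_Ioo (mul_mem (mul_mem hγ.1 hh.1) (inv_mem hγ.1)) hc1 hd2 hfix'
  obtain ⟨-, f, hf, Hf⟩ := H hmem
  have hsub : Set.Icc a b ⊆ unitI i := Set.Icc_subset_Icc ha1.le hb1.le
  have hhab : h ∈ compactPL (Set.Icc a b) :=
    ⟨hh.1, Set.Icc a b, isCompact_Icc, subset_rfl, fun x hx => hfix x fun h => hx ⟨h.1.le, h.2.le⟩⟩
  have H1 := Hf.shrink (S' := γ '' Set.Icc a b)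
    (himg ▸ Set.Icc_subset_Icc hc1.le hd2.le) fun y _ hy => hfix' y (himg ▸ hy)
  have H2 := H1.conj_inv (U := gen ρ i u) (fun y hy => (compactPL_apply_mem_iff subset_rfl hhab y).2 hy)
    fun σ hσ y hy => by rw [gen_smul (hσ i hi) u (hsub hy), huγ y (hsub hy)]
  refine ⟨_, mul_mem (mul_mem (inv_mem (hG i u hu)) hf) (hG i u hu), H2.enlarge hsub
    (fun y _ hy => hfix y fun h => hy ⟨h.1.le, h.2.le⟩) fun σ τ hσ hτ y hy y' hy' he => ?_⟩
  -- An overlap of this kind forces equal centres, and then the label of `i` forces equal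
  -- symmetries.
  exact hσ.eq_of_smul_eq hτ hi
    (smul_int_eq_of_unitI hy ⟨ha1.trans_le hy'.1, hy'.2.trans_lt hb1⟩ he)

theorem compactPL_le_spreadGroup_halfI {B : Set ℤ} {i j : ℤ} (hij : j = i ∨ j = i - 1)
    (H : compactPL (openUnitI i) ≤ spreadGroup G ρ B (unitI i)) :
    compactPL (openHalfI j) ≤ spreadGroup G ρ B (halfI j) := by
  have hj1 : ((i : ℝ) - 1) / 2 ≤ j / 2 := by rcases hij with rfl | rfl <;> push_cast <;> linarith
  have hj2 : ((j : ℝ) + 1) / 2 ≤ (i + 1) / 2 := by rcases hij with rfl | rfl <;> push_cast <;> linarith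
  intro h hh
  refine ⟨compactPL_apply_mem_iff Set.Ioo_subset_Icc_self hh, ?_⟩
  obtain ⟨-, f, hf, Hf⟩ := H (compactPL_mono (Set.Ioo_subset_Ioo hj1 hj2) hh)
  exact ⟨f, hf, Hf.shrink (Set.Icc_subset_Icc hj1 hj2) fun y _ hy =>
    compactPL_apply_of_notMem hh fun h => hy ⟨h.1.le, h.2.le⟩⟩

theorem Spread.apply_of_not_matches {B : Set ℤ} {j : ℤ} {h f : ℝ ≃o ℝ} (hh : h ∈ compactPL (openHalfI j))
    (H : Spread ρ B (halfI j) h f) {σ : Dihedral} (hσ : ¬ Matches ρ σ B) {y : ℝ} (hy : y ∈ halfI j) :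
    f (σ • y) = σ • y := by
  by_cases hex : ∃ τ, Matches ρ τ B ∧ ∃ y' ∈ halfI j, σ • y = τ • y'
  · obtain ⟨τ, hτ, y', hy', he⟩ := hex
    rw [he, H.1 τ hτ y' hy', compactPL_apply_of_notMem hh]
    intro hy''
    exact hσ (eq_of_smul_eq_smul_halfI hy hy'' he ▸ hτ)
  · exact H.2 _ fun τ hτ y' hy' he => hex ⟨τ, hτ, y', hy', he⟩

/-- By perfectness it suffices to treat commutators `⁅h₁, h₂⁆`. Spread `h₁` over `B` and `h₂` over
`C`: where `B` or `C` fails to match, one of the two spreads is trivial, so their commutator acts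
exactly over `B ∪ C`. -/
theorem compactPL_le_spreadGroup_union {B C : Set ℤ} {j : ℤ}
    (HB : compactPL (openHalfI j) ≤ spreadGroup G ρ B (halfI j))
    (HC : compactPL (openHalfI j) ≤ spreadGroup G ρ C (halfI j)) :
    compactPL (openHalfI j) ≤ spreadGroup G ρ (B ∪ C) (halfI j) := by
  refine (compactPL_Ioo_le_commutator (by linarith)).trans (Subgroup.commutator_le.2 ?_)
  intro h₁ hh₁ h₂ hh₂
  have e₁ := compactPL_apply_mem_iff (S := halfI j) Set.Ioo_subset_Icc_self hh₁
  have e₂ := compactPL_apply_mem_iff (S := halfI j) Set.Ioo_subset_Icc_self hh₂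
  have e₁' := compactPL_apply_mem_iff (S := halfI j) Set.Ioo_subset_Icc_self (inv_mem hh₁)
  have e₂' := compactPL_apply_mem_iff (S := halfI j) Set.Ioo_subset_Icc_self (inv_mem hh₂)
  refine ⟨compactPL_apply_mem_iff Set.Ioo_subset_Icc_self
    (Subgroup.commutator_le_self _ (Subgroup.commutator_mem_commutator hh₁ hh₂)), ?_⟩
  obtain ⟨-, f₁, hf₁, H₁⟩ := HB hh₁
  obtain ⟨-, f₂, hf₂, H₂⟩ := HC hh₂
  have i₁ : ∀ σ, Matches ρ σ B → ∀ y ∈ halfI j, f₁⁻¹ (σ • y) = σ • h₁⁻¹ y := fun σ hσ y hy => by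
    rw [orderIso_inv_apply_eq, H₁.1 σ hσ _ ((e₁' y).2 hy), orderIso_apply_inv_self]
  have i₂ : ∀ σ, Matches ρ σ C → ∀ y ∈ halfI j, f₂⁻¹ (σ • y) = σ • h₂⁻¹ y := fun σ hσ y hy => by
    rw [orderIso_inv_apply_eq, H₂.1 σ hσ _ ((e₂' y).2 hy), orderIso_apply_inv_self]
  have n₁ : ∀ σ, ¬ Matches ρ σ B → ∀ y ∈ halfI j, f₁ (σ • y) = σ • y := fun σ hσ y hy =>
    H₁.apply_of_not_matches hh₁ hσ hy
  have n₂ : ∀ σ, ¬ Matches ρ σ C → ∀ y ∈ halfI j, f₂ (σ • y) = σ • y := fun σ hσ y hy =>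
    H₂.apply_of_not_matches hh₂ hσ hy
  have m₁ : ∀ σ, ¬ Matches ρ σ B → ∀ y ∈ halfI j, f₁⁻¹ (σ • y) = σ • y := fun σ hσ y hy => by
    rw [orderIso_inv_apply_eq, n₁ σ hσ y hy]
  have m₂ : ∀ σ, ¬ Matches ρ σ C → ∀ y ∈ halfI j, f₂⁻¹ (σ • y) = σ • y := fun σ hσ y hy => by
    rw [orderIso_inv_apply_eq, n₂ σ hσ y hy]
  refine ⟨f₁ * f₂ * f₁⁻¹ * f₂⁻¹, mul_mem (mul_mem (mul_mem hf₁ hf₂) (inv_mem hf₁)) (inv_mem hf₂),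
    fun σ hσ y hy => ?_, fun x hx => ?_⟩
  · have hB := hσ.mono Set.subset_union_left
    have hC := hσ.mono Set.subset_union_right
    simp only [orderIso_mul_apply, commutatorElement_def]
    rw [i₂ σ hC y hy, i₁ σ hB _ ((e₂' _).2 hy), H₂.1 σ hC _ ((e₁' _).2 ((e₂' _).2 hy)),
      H₁.1 σ hB _ ((e₂ _).2 ((e₁' _).2 ((e₂' _).2 hy)))]
  · obtain ⟨σ, y, hy, rfl⟩ := exists_smul_halfI j x
    simp only [orderIso_mul_apply]
    by_cases hB : Matches ρ σ B
    · have hC : ¬ Matches ρ σ C := fun hC =>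
        hx σ (fun k hk => hk.elim (hB k) (hC k)) y hy rfl
      rw [m₂ σ hC y hy, i₁ σ hB y hy, n₂ σ hC _ ((e₁' y).2 hy), H₁.1 σ hB _ ((e₁' y).2 hy),
        orderIso_apply_inv_self]
    · by_cases hC : Matches ρ σ C
      · rw [i₂ σ hC y hy, m₁ σ hB _ ((e₂' y).2 hy), H₂.1 σ hC _ ((e₂' y).2 hy),
          orderIso_apply_inv_self, n₁ σ hB y hy]
      · rw [m₂ σ hC y hy, m₁ σ hB y hy, n₂ σ hC y hy, n₁ σ hB y hy]

/-- All compactly supported elements on the unit interval of a letter of a block can be spread over the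
occurrences of the block. -/
theorem compactPL_le_spreadGroup (hρ : IsLabelling ρ) (hG : ∀ i, ∀ u ∈ compactF, gen ρ i u ∈ G)
    (b : ℤ) (n : ℕ) : ∀ i ∈ Set.Icc b (b + n),
      compactPL (openUnitI i) ≤ spreadGroup G ρ (Set.Icc b (b + n)) (unitI i) := by
  induction n with
  | zero =>
    intro i hi
    have : i = b := by
      have h1 := hi.1
      have h2 := hi.2
      push_cast at h2
      omega
    subst this
    simpa using compactPL_le_spreadGroup_singleton hρ hG i
  | succ n ih =>
    have hB : Set.Icc b (b + (n + 1 : ℕ)) = Set.Icc b (b + n) ∪ {b + n + 1} := by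
      ext k
      simp only [Set.mem_Icc, Set.mem_union, Set.mem_singleton_iff]
      push_cast
      omega
    set B := Set.Icc b (b + (n + 1 : ℕ))
    -- `halfI (b + n)` is shared by the unit intervals of the old last letter and of the new letter,
    -- so the two conditions can be combined there.
    have h1 : compactPL (openHalfI (b + n)) ≤ spreadGroup G ρ B (halfI (b + n)) := by
      rw [hB]
      exact compactPL_le_spreadGroup_union
        (compactPL_le_spreadGroup_halfI (Or.inl rfl) (ih (b + n) ⟨by omega, le_rfl⟩))
        (compactPL_le_spreadGroup_halfI (Or.inr (by omega))
          (compactPL_le_spreadGroup_singleton hρ hG (b + n + 1)))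
    -- From the new letter the result travels to the left, each unit interval sharing its left half
    -- with the preceding letter.
    have key : ∀ k : ℕ, k ≤ n + 1 → compactPL (openUnitI (b + n + 1 - k)) ≤
        spreadGroup G ρ B (unitI (b + n + 1 - k)) := by
      intro k
      induction k with
      | zero =>
        intro _
        refine compactPL_le_spreadGroup_unitI hG ⟨?_, ?_⟩ (Or.inr ?_) h1 <;> push_cast <;> omega
      | succ k ihk =>
        intro hk
        refine compactPL_le_spreadGroup_unitI hG ⟨?_, ?_⟩ (Or.inl rfl)
          (compactPL_le_spreadGroup_halfI (Or.inr ?_) (ihk (by omega))) <;> push_cast <;> omega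
    intro i hi
    have h2 := hi.1
    have h3 := hi.2
    push_cast at h3
    have := key (b + n + 1 - i).toNat (by omega)
    rwa [show b + n + 1 - ((b + n + 1 - i).toNat : ℤ) = i by omega] at this

end


/-! ### Consequences of quasi-periodicity -/

theorem blockWord_getElem? (ρ : ℤ → Letter) (k : ℤ) (n i : ℕ) (hi : i ≤ n) :
    (blockWord ρ k n)[i]? = some (ρ (k + i)) := by
  have : i < n + 1 := by omega
  simp [blockWord, ← List.map_eq_flatMap, this]

theorem length_blockWord (ρ : ℤ → Letter) (k : ℤ) (n : ℕ) : (blockWord ρ k n).length = n + 1 := by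
  simp [blockWord]

theorem exists_shift_of_infix {ρ : ℤ → Letter} {k k' : ℤ} {n n' : ℕ}
    (h : blockWord ρ k n <:+: blockWord ρ k' n') :
    ∃ i : ℕ, i ≤ n' ∧ ∀ l : ℕ, l ≤ n → ρ (k' + i + l) = ρ (k + l) := by
  obtain ⟨s, t, hst⟩ := h
  have hlen := congrArg List.length hst
  simp only [List.length_append, length_blockWord] at hlen
  refine ⟨s.length, by omega, fun l hl => ?_⟩
  have h1 := blockWord_getElem? ρ k' n' (s.length + l) (by omega)
  rw [← hst, List.append_assoc, List.getElem?_append_right (by omega),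
    List.getElem?_append_left (by rw [length_blockWord]; omega), Nat.add_sub_cancel_left,
    blockWord_getElem? ρ k n l hl] at h1
  push_cast at h1
  rw [add_assoc]
  exact (Option.some_injective _ h1).symm

theorem eq_of_blockWord_eq_wordInv {ρ : ℤ → Letter} {k k' : ℤ} {n n' : ℕ}
    (h : blockWord ρ k' n' = wordInv (blockWord ρ k n)) (l : ℕ) (hl : l ≤ n) :
    ρ (k' + n - l) = (ρ (k + l)).inv := by
  have hlen := congrArg List.length h
  simp only [wordInv, List.length_reverse, List.length_map, length_blockWord] at hlen
  obtain rfl : n' = n := by omega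
  have h1 := blockWord_getElem? ρ k' n' (n' - l) (by omega)
  rw [h, wordInv, List.getElem?_reverse (by simp [length_blockWord]), List.getElem?_map,
    List.length_map, length_blockWord, show n' + 1 - 1 - (n' - l) = l by omega,
    blockWord_getElem? ρ k n' l hl, Option.map_some, Nat.cast_sub hl, ← add_sub_assoc] at h1
  exact (Option.some_injective _ h1).symm

/-- This parity statement ensures that coincidences of words shift indices by even amounts, hence
come from elements of `Dihedral`. -/
theorem IsLabelling.even_iff {ρ : ℤ → Letter} (hρ : IsLabelling ρ) {x y : ℤ}
    (h : ρ x = ρ y ∨ ρ x = (ρ y).inv) : Even x ↔ Even y := by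
  have hx := hρ.1 x
  have hx' := hρ.2 x
  have hy := hρ.1 y
  have hy' := hρ.2 y
  rw [← Int.not_even_iff_odd] at hx' hy'
  by_cases h1 : Even x <;> by_cases h2 : Even y <;> simp only [h1, h2, not_true, not_false_iff,
    forall_const, false_imp_iff] at hx hx' hy hy' ⊢
  · rcases hx with hx | hx <;> rcases hy' with hy | hy <;> simp [hx, hy, Letter.inv] at h
  · rcases hx' with hx | hx <;> rcases hy with hy | hy <;> simp [hx, hy, Letter.inv] at h

theorem exists_block_of_window (a b : ℝ) : ∃ (k : ℤ) (n : ℕ), ∀ j ∈ window a b, ∃ l : ℕ, l ≤ n ∧ j = k + l := by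
  refine ⟨⌈2 * a⌉, (⌊2 * b⌋ - ⌈2 * a⌉).toNat, fun j hj => ⟨(j - ⌈2 * a⌉).toNat, ?_, ?_⟩⟩
  all_goals
    have h1 : ⌈2 * a⌉ ≤ j := Int.ceil_le.2 (by linarith [hj.1])
    have h2 : j ≤ ⌊2 * b⌋ := Int.le_floor.2 (by linarith [hj.2])
    omega

theorem exists_reflection_matches {ρ : ℤ → Letter} (hρ : IsLabelling ρ) (hq : IsQuasiPeriodic ρ) (a b : ℝ) :
    ∃ σ : Dihedral, σ.e = -1 ∧ Matches ρ σ (window a b) := by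
  obtain ⟨k, n, hkn⟩ := exists_block_of_window a b
  obtain ⟨k', n', h⟩ := hq.2 k n
  have key := eq_of_blockWord_eq_wordInv h
  have h0 := key 0 (Nat.zero_le _)
  have hpar := hρ.even_iff (Or.inr h0)
  rw [Nat.cast_zero, sub_zero, add_zero] at hpar
  obtain ⟨m, hm⟩ : Even (k' + n + k) := by rw [Int.even_add]; exact hpar
  refine ⟨⟨-1, m⟩, rfl, fun j hj => ?_⟩
  obtain ⟨l, hl, rfl⟩ := hkn j hj
  rw [Dihedral.smul_int_of_neg rfl, Dihedral.smul_letter_of_neg rfl, ← key l hl]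
  congr 1
  change -(k + l) + 2 * m = _
  omega

theorem exists_translation_matches {ρ : ℤ → Letter} (hρ : IsLabelling ρ) (hq : IsQuasiPeriodic ρ) (a b : ℝ) :
    ∃ L : ℝ, ∀ x : ℝ, ∃ σ : Dihedral, σ.e = 1 ∧ Matches ρ σ (window a b) ∧ x < σ.m ∧ σ.m ≤ x + L := by
  obtain ⟨k, n, hkn⟩ := exists_block_of_window a b
  obtain ⟨N, hN⟩ := hq.1 k n
  refine ⟨N + 1, fun x => ?_⟩
  -- The starting index, up to the even `2 * (⌊x⌋ + 1)`, makes the translation exceed `x`; half of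
  -- the further shift `i ≤ N` is what remains.
  obtain ⟨i, hi, key⟩ := exists_shift_of_infix (hN (k + 2 * (⌊x⌋ + 1)) N (by omega))
  have h0 := key 0 (Nat.zero_le _)
  have hpar := hρ.even_iff (Or.inl h0)
  have hi' : Even (i : ℤ) := by
    rw [Nat.cast_zero, add_zero, add_zero, Int.even_add, Int.even_add] at hpar
    have h2 : Even (2 * (⌊x⌋ + 1)) := even_two_mul _
    tauto
  obtain ⟨m, hm⟩ := hi'
  have h1 := Int.floor_le x
  have h2 := Int.lt_floor_add_one x
  have h3 : (0 : ℝ) ≤ m := by exact_mod_cast (by omega : 0 ≤ m)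
  have h4 : (m : ℝ) ≤ N := by exact_mod_cast (by omega : m ≤ N)
  refine ⟨⟨1, ⌊x⌋ + 1 + m⟩, rfl, fun j hj => ?_, ?_, ?_⟩
  · obtain ⟨l, hl, rfl⟩ := hkn j hj
    rw [Dihedral.smul_int_of_one rfl, Dihedral.smul_letter_of_one rfl, ← key l hl]
    congr 1
    change k + l + 2 * (⌊x⌋ + 1 + m) = _
    omega
  · push_cast; linarith
  · push_cast; linarith

/-- A reflection respecting the labels near `0` makes the displacement at the image of `0` opposite
to that at `0`, so the displacement vanishes in between. -/
theorem exists_fixed_point {ρ : ℤ → Letter} (hρ : IsLabelling ρ) (hq : IsQuasiPeriodic ρ) {f : ℝ ≃o ℝ}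
    (hf : f ∈ localGroup ρ) : ∃ p, f p = p := by
  obtain ⟨-, ⟨r, hr⟩, -⟩ := hf
  obtain ⟨σ, hσ, hm⟩ := exists_reflection_matches hρ hq (0 - r) (0 + r)
  have h := hr σ 0 hm
  rw [Dihedral.smul_real_of_neg hσ, Dihedral.smul_real_of_neg hσ, neg_zero, zero_add] at h
  have hc : Continuous fun x => f x - x := f.continuous.sub continuous_id
  have h0 : (0 : ℝ) ∈ Set.uIcc (f 0 - 0) (f σ.m - σ.m) := by
    rw [h, Set.mem_uIcc]
    rcases le_total (f 0) 0 with h1 | h1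
    · left; constructor <;> linarith
    · right; constructor <;> linarith
  obtain ⟨p, -, hp⟩ := intermediate_value_uIcc hc.continuousOn h0
  exact ⟨p, by simpa [sub_eq_zero] using hp⟩

/-- An element of `G` with a fixed point agrees with a commutator on some interval. -/
theorem exists_commutator_eqOn {G : Subgroup (ℝ ≃o ℝ)} {ρ : ℤ → Letter}
    (hG : ∀ i, ∀ u ∈ compactF, gen ρ i u ∈ G) {f : ℝ ≃o ℝ} (hf : f ∈ localGroup ρ) {p : ℝ} (hp : f p = p) :
    ∃ r s, r ∈ dyadic ∧ s ∈ dyadic ∧ r < s ∧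
      ∃ x ∈ G, ∃ y ∈ G, ∀ z ∈ Set.Icc r s, (x * y * x⁻¹ * y⁻¹) z = f z := by
  obtain ⟨-, -, hf⟩ := hf
  obtain ⟨γ, hγ, hfγ⟩ := hf (p - 1) (p + 1)
  -- With this choice `p ∈ [i/2, (i + 1)/2)`, which is interior to `unitI i`.
  set i := ⌊2 * p⌋
  have hi1 := Int.floor_le (2 * p)
  have hi2 := Int.lt_floor_add_one (2 * p)
  have hpe : p < ((i : ℝ) + 1) / 2 := by linarith
  have hpe' : p < f⁻¹ (((i : ℝ) + 1) / 2) := by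
    have h1 := (f⁻¹).strictMono hpe
    rwa [(orderIso_inv_apply_eq f).2 hp.symm] at h1
  obtain ⟨s, hs, hs1, hs2⟩ := exists_dyadic_between (lt_min hpe hpe')
  obtain ⟨r, hr, hr1, hr2⟩ := exists_dyadic_between hs1
  rw [lt_min_iff] at hs2
  have hfs : f s < ((i : ℝ) + 1) / 2 := by
    have := f.strictMono hs2.2
    rwa [orderIso_apply_inv_self] at this
  have hfr : p < f r := by rw [← hp]; exact f.strictMono hr1
  have hγf : ∀ z ∈ Set.Icc r s, f z = γ z := fun z hz =>
    hfγ z ⟨by linarith [hz.1], by linarith [hz.2, hs2.1]⟩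
  obtain ⟨u, hu, huγ⟩ := exists_compactPL_eqOn (a := ((i : ℝ) - 1) / 2) (b := ((i : ℝ) + 1) / 2) hγ hr hs
    hr2.le (by linarith) hs2.1 (by rw [← hγf r ⟨le_rfl, hr2.le⟩]; linarith)
    (by rwa [← hγf s ⟨hr2.le, le_rfl⟩])
  obtain ⟨a, b, ha, hb, ha1, hab, hb1, hfix⟩ := exists_dyadic_support (by linarith) hu
  -- `v` will send the left end `a` of the support of `u` beyond `s`. Then `v⁻¹` maps `[r, s]` to
  -- the left of that support, where `u⁻¹` is trivial, and the commutator of `u` and `v` agrees with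
  -- `u` on `[r, s]`.
  obtain ⟨c, hc, hc1, hc2⟩ := exists_dyadic_between (max_lt hs2.1 hb1)
  rw [max_lt_iff] at hc1
  obtain ⟨v, hv, hva⟩ := exists_compactPL_eqOn (a := ((i : ℝ) - 1) / 2) (b := ((i : ℝ) + 1) / 2)
    (affineMap_mem 0 (dyadic_sub hc ha)) ha ha le_rfl ha1 (by linarith)
    (by simp only [affineMap_apply, zpow_zero]; linarith)
    (by simp only [affineMap_apply, zpow_zero]; linarith)
  have hvac : v a = c := by
    rw [hva a ⟨le_rfl, le_rfl⟩, affineMap_apply, zpow_zero]; ring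
  obtain ⟨u', hu', hU⟩ := exists_gen_eqOn ρ i (h := u) hu
  obtain ⟨v', hv', hV⟩ := exists_gen_eqOn ρ i (h := v) hv
  refine ⟨r, s, hr, hs, hr2, gen ρ i u', hG i u' hu', gen ρ i v', hG i v' hv', fun z hz => ?_⟩
  have hzI : z ∈ unitI i := ⟨by linarith [hz.1], by linarith [hz.2, hs2.1]⟩
  obtain ⟨w, rfl⟩ := v.surjective z
  have hwI : w ∈ unitI i := (compactPL_apply_mem_iff Set.Ioo_subset_Icc_self hv w).1 hzI
  have hwa : w < a := v.lt_iff_lt.1 (by rw [hvac]; linarith [hz.2])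
  have h1 : (gen ρ i v')⁻¹ (v w) = w := by rw [orderIso_inv_apply_eq, hV w hwI]
  have h2 : (gen ρ i u')⁻¹ w = w := by
    rw [orderIso_inv_apply_eq, hU w hwI, hfix w fun h => by linarith [h.1]]
  simp only [orderIso_mul_apply]
  rw [h1, h2, hV w hwI, hU _ hzI, huγ _ hz, hγf _ hz]


/-! ### Marks and gaps -/

/-- The half integers at distance at most `c` from `S`. -/
def nearby (c : ℝ) (S : Set ℝ) : Set ℤ := {j | ∃ x ∈ S, |(j : ℝ) / 2 - x| ≤ c}

theorem nearby_mono {c : ℝ} {S T : Set ℝ} (h : S ⊆ T) : nearby c S ⊆ nearby c T :=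
  fun _ ⟨x, hx, h'⟩ => ⟨x, h hx, h'⟩

theorem smul_mem_nearby {c : ℝ} {S T : Set ℝ} {σ : Dihedral} (h : ∀ x ∈ S, σ • x ∈ T) {j : ℤ}
    (hj : j ∈ nearby c S) : σ • j ∈ nearby c T := by
  obtain ⟨x, hx, hjx⟩ := hj
  exact ⟨σ • x, h x hx, by rwa [Dihedral.smul_half, Dihedral.abs_smul_sub_smul]⟩

theorem window_subset_nearby {c r y x : ℝ} {S : Set ℝ} (hx : x ∈ S) (h : r + |y - x| ≤ c) :
    window (y - r) (y + r) ⊆ nearby c S := by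
  rintro j ⟨h1, h2⟩
  refine ⟨x, hx, ?_⟩
  have h3 := abs_le.1 (show |y - x| ≤ c - r by linarith)
  rw [abs_le]
  constructor <;> linarith [h3.1, h3.2]

theorem exists_nearby_Icc_eq {c s t : ℝ} (hc : 1 ≤ c) (hst : s < t) :
    ∃ (b : ℤ) (n : ℕ), nearby c (Set.Icc s t) = Set.Icc b (b + n) := by
  refine ⟨⌈2 * (s - c)⌉, (⌊2 * (t + c)⌋ - ⌈2 * (s - c)⌉).toNat, ?_⟩
  have hle : ⌈2 * (s - c)⌉ ≤ ⌊2 * (t + c)⌋ := by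
    refine (Int.ceil_le.2 (?_ : 2 * (s - c) ≤ ⌈2 * s⌉)).trans (Int.le_floor.2 ?_)
    · linarith [Int.le_ceil (2 * s)]
    · linarith [Int.ceil_lt_add_one (2 * s)]
  rw [Int.toNat_of_nonneg (by omega), add_sub_cancel]
  ext j
  rw [Set.mem_Icc, Int.ceil_le, Int.le_floor]
  constructor
  · rintro ⟨x, hx, h⟩
    rw [abs_le] at h
    constructor <;> linarith [h.1, h.2, hx.1, hx.2]
  · rintro ⟨h1, h2⟩
    rcases le_total ((j : ℝ) / 2) s with h | h
    · exact ⟨s, ⟨le_rfl, hst.le⟩, by rw [abs_le]; constructor <;> linarith⟩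
    rcases le_total t ((j : ℝ) / 2) with h' | h'
    · exact ⟨t, ⟨hst.le, le_rfl⟩, by rw [abs_le]; constructor <;> linarith⟩
    · exact ⟨_, ⟨h, h'⟩, by simp; linarith⟩

/-- The images of `p` under the symmetries which respect the labels near `p`. -/
def IsMark (ρ : ℤ → Letter) (p c x : ℝ) : Prop :=
  ∃ σ : Dihedral, Matches ρ σ (nearby c {p}) ∧ x = σ • p

/-- The pairs of consecutive marks. -/
structure IsGap (ρ : ℤ → Letter) (p c : ℝ) (I : ℝ × ℝ) : Prop where
  left : IsMark ρ p c I.1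
  right : IsMark ρ p c I.2
  lt : I.1 < I.2
  not_isMark : ∀ x, I.1 < x → x < I.2 → ¬ IsMark ρ p c x

/-- `σ` respects the labels near `I` and maps `I` to `J`. -/
structure Carries (ρ : ℤ → Letter) (c : ℝ) (σ : Dihedral) (I J : ℝ × ℝ) : Prop where
  matches_ : Matches ρ σ (nearby c (Set.Icc I.1 I.2))
  mem_Icc : ∀ x, σ • x ∈ Set.Icc J.1 J.2 ↔ x ∈ Set.Icc I.1 I.2
  mem_Ioo : ∀ x, σ • x ∈ Set.Ioo J.1 J.2 ↔ x ∈ Set.Ioo I.1 I.2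

section

variable {ρ : ℤ → Letter} {p c : ℝ}

theorem IsMark.smul {x : ℝ} (hx : IsMark ρ p c x) {σ : Dihedral} (hσ : Matches ρ σ (nearby c {x})) :
    IsMark ρ p c (σ • x) := by
  obtain ⟨τ, hτ, rfl⟩ := hx
  refine ⟨σ * τ, hσ.mul hτ fun j hj => smul_mem_nearby ?_ hj, (mul_smul _ _ _).symm⟩
  rintro _ rfl
  rfl

theorem IsGap.eq_of_mem {I J : ℝ × ℝ} (hI : IsGap ρ p c I) (hJ : IsGap ρ p c J) {x : ℝ}
    (hx : x ∈ Set.Icc I.1 I.2) (hx' : x ∈ Set.Ioo J.1 J.2) : I = J := by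
  have h1 : I.1 ≤ J.1 := not_lt.1 fun h => hJ.not_isMark _ h (hx.1.trans_lt hx'.2) hI.left
  have h2 : J.1 ≤ I.1 := not_lt.1 fun h => hI.not_isMark _ h (hx'.1.trans_le hx.2) hJ.left
  have h3 : J.2 ≤ I.2 := not_lt.1 fun h => hJ.not_isMark _ (hx'.1.trans_le hx.2) h hI.right
  have h4 : I.2 ≤ J.2 := not_lt.1 fun h => hI.not_isMark _ (hx.1.trans_lt hx'.2) h hJ.right
  exact Prod.ext (le_antisymm h1 h2) (le_antisymm h4 h3)

/-- Being a mark is decided by labels within `c`. As `σ` respects these along the whole closed gap,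
it creates and destroys no marks there. -/
theorem IsGap.exists_carries {I : ℝ × ℝ} (hI : IsGap ρ p c I) {σ : Dihedral}
    (hσ : Matches ρ σ (nearby c (Set.Icc I.1 I.2))) :
    ∃ J, IsGap ρ p c J ∧ Carries ρ c σ I J ∧
      ((σ.e = 1 ∧ J = (σ • I.1, σ • I.2)) ∨ (σ.e = -1 ∧ J = (σ • I.2, σ • I.1))) := by
  have h1 := hI.left.smul (hσ.mono (nearby_mono (by simpa using hI.lt.le)))
  have h2 := hI.right.smul (hσ.mono (nearby_mono (by simpa using hI.lt.le)))
  have h3 : ∀ x, x ∈ Set.Ioo I.1 I.2 → ¬ IsMark ρ p c (σ • x) := by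
    intro x hx hmark
    refine hI.not_isMark x hx.1 hx.2 ?_
    rw [← inv_smul_smul σ x]
    refine hmark.smul (hσ.inv fun j hj => smul_mem_nearby ?_ hj)
    rintro _ rfl
    rw [inv_smul_smul]
    exact Set.Ioo_subset_Icc_self hx
  have hlt := hI.lt
  rcases Int.units_eq_one_or σ.e with hs | hs
  · have e := Dihedral.smul_real_of_one hs
    refine ⟨(σ • I.1, σ • I.2), ⟨h1, h2, ?_, fun x hx hx' => ?_⟩, ⟨hσ, fun x => ?_, fun x => ?_⟩,
      Or.inl ⟨hs, rfl⟩⟩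
    · simp only [e]; linarith
    · simp only [e] at hx hx'
      have := h3 (x - σ.m) ⟨by linarith, by linarith⟩
      rwa [e, sub_add_cancel] at this
    · simp only [e, Set.mem_Icc, add_le_add_iff_right]
    · simp only [e, Set.mem_Ioo, add_lt_add_iff_right]
  · have e := Dihedral.smul_real_of_neg hs
    refine ⟨(σ • I.2, σ • I.1), ⟨h2, h1, ?_, fun x hx hx' => ?_⟩, ⟨hσ, fun x => ?_, fun x => ?_⟩,
      Or.inr ⟨hs, rfl⟩⟩
    · simp only [e]; linarith
    · simp only [e] at hx hx'
      have := h3 (σ.m - x) ⟨by linarith, by linarith⟩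
      rwa [e, neg_sub, sub_add_cancel] at this
    · simp only [e, Set.mem_Icc, add_le_add_iff_right, neg_le_neg_iff, and_comm]
    · simp only [e, Set.mem_Ioo, add_lt_add_iff_right, neg_lt_neg_iff, and_comm]

/-- Overlapping images are the same gap. If the orientations differed, `σ` and `τ` would differ by
the reflection in the centre of the gap, a half integer whose label would equal its own inverse. -/
theorem IsGap.eq_of_smul_eq (hc : 1 ≤ c) {I : ℝ × ℝ} (hI : IsGap ρ p c I) {σ τ : Dihedral}
    (hσ : Matches ρ σ (nearby c (Set.Icc I.1 I.2))) (hτ : Matches ρ τ (nearby c (Set.Icc I.1 I.2)))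
    {y y' : ℝ} (hy : y ∈ Set.Icc I.1 I.2) (hy' : y' ∈ Set.Ioo I.1 I.2) (h : σ • y = τ • y') : σ = τ := by
  obtain ⟨J, hJ, hσJ, eσ⟩ := hI.exists_carries hσ
  obtain ⟨J', hJ', hτJ, eτ⟩ := hI.exists_carries hτ
  have hJJ : J = J' := hJ.eq_of_mem hJ' ((hσJ.mem_Icc y).2 hy) (h ▸ (hτJ.mem_Ioo y').2 hy')
  have hlt := hI.lt
  have center : ∀ k : ℤ, I.1 + I.2 = k → k ∈ nearby c (Set.Icc I.1 I.2) := fun k hk =>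
    ⟨(k : ℝ) / 2, ⟨by linarith, by linarith⟩, by simp; linarith⟩
  rcases eσ with ⟨hs, rfl⟩ | ⟨hs, rfl⟩ <;> rcases eτ with ⟨ht, rfl⟩ | ⟨ht, rfl⟩
  · have h1 := congrArg Prod.fst hJJ
    simp only [Dihedral.smul_real_of_one hs, Dihedral.smul_real_of_one ht] at h1
    ext
    · rw [hs, ht]
    · exact_mod_cast (add_left_cancel h1)
  · have h1 := congrArg Prod.fst hJJ
    simp only [Dihedral.smul_real_of_one hs, Dihedral.smul_real_of_neg ht] at h1
    refine hσ.eq_of_smul_eq hτ (center (τ.m - σ.m) (by push_cast; linarith)) ?_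
    rw [Dihedral.smul_int_of_one hs, Dihedral.smul_int_of_neg ht]
    ring
  · have h1 := congrArg Prod.fst hJJ
    simp only [Dihedral.smul_real_of_neg hs, Dihedral.smul_real_of_one ht] at h1
    refine hσ.eq_of_smul_eq hτ (center (σ.m - τ.m) (by push_cast; linarith)) ?_
    rw [Dihedral.smul_int_of_neg hs, Dihedral.smul_int_of_one ht]
    ring
  · have h1 := congrArg Prod.fst hJJ
    simp only [Dihedral.smul_real_of_neg hs, Dihedral.smul_real_of_neg ht] at h1
    ext
    · rw [hs, ht]
    · exact_mod_cast (add_left_cancel h1)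

theorem Carries.refl (I : ℝ × ℝ) : Carries ρ c 1 I I :=
  ⟨matches_one _ _, fun x => by rw [one_smul], fun x => by rw [one_smul]⟩

theorem Carries.symm {σ : Dihedral} {I J : ℝ × ℝ} (h : Carries ρ c σ I J) : Carries ρ c σ⁻¹ J I := by
  have h1 : ∀ x, σ⁻¹ • x ∈ Set.Icc I.1 I.2 ↔ x ∈ Set.Icc J.1 J.2 := fun x => by
    rw [← h.mem_Icc, smul_inv_smul]
  exact ⟨h.matches_.inv fun j hj => smul_mem_nearby (fun x hx => (h1 x).2 hx) hj, h1,
    fun x => by rw [← h.mem_Ioo, smul_inv_smul]⟩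

theorem Carries.trans {σ τ : Dihedral} {I J K : ℝ × ℝ} (h : Carries ρ c σ I J) (h' : Carries ρ c τ J K) :
    Carries ρ c (τ * σ) I K :=
  ⟨h'.matches_.mul h.matches_ fun _ hj => smul_mem_nearby (fun x hx => (h.mem_Icc x).2 hx) hj,
    fun x => by rw [mul_smul, h'.mem_Icc, h.mem_Icc], fun x => by rw [mul_smul, h'.mem_Ioo, h.mem_Ioo]⟩

/-- Two gaps are equivalent if a symmetry respecting the labels maps one to the other. -/
def gapSetoid (ρ : ℤ → Letter) (p c : ℝ) : Setoid {I : ℝ × ℝ // IsGap ρ p c I} where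
  r I J := ∃ σ, Carries ρ c σ I.1 J.1
  iseqv := ⟨fun _ => ⟨1, Carries.refl _⟩, fun ⟨_, h⟩ => ⟨_, h.symm⟩, fun ⟨_, h⟩ ⟨_, h'⟩ => ⟨_, h.trans h'⟩⟩

theorem exists_isMark (hρ : IsLabelling ρ) (hq : IsQuasiPeriodic ρ) (p c : ℝ) :
    ∃ L, ∀ x, ∃ y, IsMark ρ p c y ∧ x < y ∧ y ≤ x + L := by
  obtain ⟨L, hL⟩ := exists_translation_matches hρ hq (p - c) (p + c)
  refine ⟨L, fun x => ?_⟩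
  obtain ⟨σ, hσ, hm, h1, h2⟩ := hL (x - p)
  refine ⟨σ • p, ⟨σ, hm.mono ?_, rfl⟩, ?_, ?_⟩
  · rintro j ⟨_, rfl, h⟩
    rw [abs_le] at h
    constructor <;> linarith [h.1, h.2]
  · rw [Dihedral.smul_real_of_one hσ]; linarith
  · rw [Dihedral.smul_real_of_one hσ]; linarith

theorem finite_isMark (a b : ℝ) : {x | IsMark ρ p c x ∧ a ≤ x ∧ x ≤ b}.Finite := by
  refine (((Set.finite_Icc ⌈a - p⌉ ⌊b - p⌋).image fun m : ℤ => p + m).union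
    ((Set.finite_Icc ⌈a + p⌉ ⌊b + p⌋).image fun m : ℤ => -p + m)).subset ?_
  rintro _ ⟨⟨σ, -, rfl⟩, h1, h2⟩
  rcases Int.units_eq_one_or σ.e with hs | hs
  · rw [Dihedral.smul_real_of_one hs] at *
    exact Or.inl ⟨σ.m, ⟨Int.ceil_le.2 (by linarith), Int.le_floor.2 (by linarith)⟩, rfl⟩
  · rw [Dihedral.smul_real_of_neg hs] at *
    exact Or.inr ⟨σ.m, ⟨Int.ceil_le.2 (by linarith), Int.le_floor.2 (by linarith)⟩, rfl⟩

/-- Marks are locally finite and unbounded in both directions, so there is a last one up to `x` and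
a first one after it. -/
theorem exists_isGap_mem (hρ : IsLabelling ρ) (hq : IsQuasiPeriodic ρ) (p c x : ℝ) :
    ∃ I, IsGap ρ p c I ∧ x ∈ Set.Icc I.1 I.2 := by
  obtain ⟨L, hL⟩ := exists_isMark hρ hq p c
  obtain ⟨y, hy, hxy, hyL⟩ := hL x
  obtain ⟨z, hz, hzx, hzL⟩ := hL (x - max L 0 - 1)
  have hLm := le_max_left L 0
  obtain ⟨s, ⟨hs, hs1, hs2⟩, hsmax⟩ := Set.exists_max_image _ id
    (finite_isMark (ρ := ρ) (p := p) (c := c) (x - max L 0 - 1) x) ⟨z, hz, hzx.le, by linarith⟩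
  obtain ⟨t, ⟨⟨ht, -, ht3⟩, hxt⟩, htmin⟩ := Set.exists_min_image _ id
    ((finite_isMark (ρ := ρ) (p := p) (c := c) x (x + L)).inter_of_left {t | x < t})
    ⟨y, ⟨hy, hxy.le, hyL⟩, hxy⟩
  replace hxt : x < t := hxt
  refine ⟨(s, t), ⟨hs, ht, by dsimp only; linarith, fun u hu1 hu2 hu => ?_⟩, hs2, hxt.le⟩
  dsimp only at hu1 hu2
  rcases le_or_gt u x with h | h
  · have : u ≤ s := hsmax u ⟨hu, by linarith, h⟩
    linarith
  · have : t ≤ u := htmin u ⟨⟨hu, h.le, by linarith⟩, h⟩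
    linarith

instance : Finite Letter :=
  Finite.of_surjective (fun x : Bool × Bool => match x with
    | (true, true) => Letter.a
    | (true, false) => Letter.b
    | (false, true) => Letter.aInv
    | (false, false) => Letter.bInv) fun l => by
      cases l
      · exact ⟨(true, true), rfl⟩
      · exact ⟨(true, false), rfl⟩
      · exact ⟨(false, true), rfl⟩
      · exact ⟨(false, false), rfl⟩

/-- There are only finitely many classes of gaps. -/
theorem finite_gap_classes (hρ : IsLabelling ρ) (hq : IsQuasiPeriodic ρ) (p c : ℝ) :
    Finite (Quotient (gapSetoid ρ p c)) := by
  obtain ⟨L, hL⟩ := exists_isMark hρ hq p c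
  -- Gaps have length at most `L`, and the left end is within `|p|` of the translation part of its
  -- symmetry. The factor `2` converts half integers to indices.
  obtain ⟨M, hM⟩ := exists_nat_ge (2 * (L + c + |p|))
  have hsym : ∀ I : {I : ℝ × ℝ // IsGap ρ p c I}, ∃ σ : Dihedral, I.1.1 = σ • p := fun I => by
    obtain ⟨σ, -, h⟩ := I.2.left
    exact ⟨σ, h⟩
  choose σ hσ using hsym
  -- Orientation and labels in a fixed window determine the class: equal data give a
  -- label-respecting translation matching the left ends, and the right ends are the next marks. `F`
  -- has finitely many values.
  let F : {I : ℝ × ℝ // IsGap ρ p c I} → ℤˣ × (Set.Icc (-(M : ℤ)) M → Letter) := fun I =>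
    ((σ I).e, fun k => ρ (k + 2 * (σ I).m))
  have hF : ∀ I J, F I = F J → (gapSetoid ρ p c).r I J := by
    intro I J hIJ
    have he : (σ I).e = (σ J).e := congrArg Prod.fst hIJ
    have hw : ∀ k : ℤ, k ∈ Set.Icc (-(M : ℤ)) M → ρ (k + 2 * (σ I).m) = ρ (k + 2 * (σ J).m) :=
      fun k hk => congrFun (congrArg Prod.snd hIJ) ⟨k, hk⟩
    let τ : Dihedral := ⟨1, (σ J).m - (σ I).m⟩
    have hlen : I.1.2 ≤ I.1.1 + L := by
      obtain ⟨y, hy, h1, h2⟩ := hL I.1.1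
      by_contra h
      exact I.2.not_isMark y h1 (by linarith) hy
    have hpm : |I.1.1 - (σ I).m| ≤ |p| := by
      rw [hσ I]
      rcases Int.units_eq_one_or (σ I).e with hs | hs
      · rw [Dihedral.smul_real_of_one hs]; simp
      · rw [Dihedral.smul_real_of_neg hs]; simp
    have hτ : Matches ρ τ (nearby c (Set.Icc I.1.1 I.1.2)) := by
      rintro j ⟨x, hx, hjx⟩
      rw [Dihedral.smul_int_of_one rfl, Dihedral.smul_letter_of_one rfl]
      have hk := hw (j - 2 * (σ I).m) (by
        rw [abs_le] at hjx hpm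
        have h1 : -(M : ℝ) ≤ j - 2 * (σ I).m := by linarith [hx.1, hx.2]
        have h2 : (j : ℝ) - 2 * (σ I).m ≤ M := by linarith [hx.1, hx.2]
        constructor
        · exact_mod_cast h1
        · exact_mod_cast h2)
      rw [sub_add_cancel] at hk
      rw [hk]
      congr 1
      change j + 2 * ((σ J).m - (σ I).m) = _
      ring
    have hτs : τ • I.1.1 = J.1.1 := by
      rw [hσ I, hσ J, Dihedral.smul_real_of_one (σ := τ) rfl, Dihedral.smul_real_def,
        Dihedral.smul_real_def, he]
      change _ + (((σ J).m - (σ I).m : ℤ) : ℝ) = _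
      push_cast
      ring
    obtain ⟨K, hK, hcar, ⟨-, rfl⟩ | ⟨h, -⟩⟩ := I.2.exists_carries hτ
    · refine ⟨τ, ?_⟩
      have hlt1 := hK.lt
      have hlt2 := J.2.lt
      have : (τ • I.1.1, τ • I.1.2) = J.1 := by
        refine Prod.ext hτs (le_antisymm (not_lt.1 fun h => ?_) (not_lt.1 fun h => ?_))
        · exact hK.not_isMark _ (hτs ▸ hlt2) h J.2.right
        · exact J.2.not_isMark _ (hτs ▸ hlt1) h hK.right
      rwa [this] at hcar
    · exact absurd (show (1 : ℤˣ) = -1 from h) (by decide)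
  refine Finite.of_injective (fun q : Quotient (gapSetoid ρ p c) => F q.out) fun q q' h => ?_
  rw [← Quotient.out_eq q, ← Quotient.out_eq q']
  exact Quotient.sound (hF _ _ h)

/-! ### Spreading elements over a class of gaps -/

variable {G : Subgroup (ℝ ≃o ℝ)}

/-- The spread over copies of `unitI i` is cut down to the part of the support common with the gap,
then enlarged to the gap by `IsGap.eq_of_smul_eq`. -/
theorem IsGap.mem_spreadGroup_of_unitI (hc : 1 ≤ c) {I : ℝ × ℝ} (hI : IsGap ρ p c I) {i : ℤ}
    (H : compactPL (openUnitI i) ≤ spreadGroup G ρ (nearby c (Set.Icc I.1 I.2)) (unitI i))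
    {h : ℝ ≃o ℝ} (h1 : h ∈ compactPL (Set.Ioo I.1 I.2)) (h2 : h ∈ compactPL (openUnitI i)) :
    h ∈ spreadGroup G ρ (nearby c (Set.Icc I.1 I.2)) (Set.Icc I.1 I.2) := by
  refine ⟨compactPL_apply_mem_iff Set.Ioo_subset_Icc_self h1, ?_⟩
  obtain ⟨-, f, hf, Hf⟩ := H h2
  obtain ⟨-, K, -, hK, hfix⟩ := h1
  have hout : ∀ y, y ∉ K ∩ unitI i → h y = y := fun y hy => by
    by_cases hyK : y ∈ K
    · exact compactPL_apply_of_notMem h2 fun h => hy ⟨hyK, Set.Ioo_subset_Icc_self h⟩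
    · exact hfix y hyK
  have H1 := Hf.shrink (S' := K ∩ unitI i) Set.inter_subset_right fun y _ hy => hout y hy
  exact ⟨f, hf, H1.enlarge (fun y hy => Set.Ioo_subset_Icc_self (hK hy.1)) (fun y _ hy => hout y hy)
    fun σ τ hσ hτ y hy y' hy' he => hI.eq_of_smul_eq hc hσ hτ hy (hK hy'.1) he⟩

theorem IsGap.compactPL_le_spreadGroup (hρ : IsLabelling ρ) (hG : ∀ i, ∀ u ∈ compactF, gen ρ i u ∈ G)
    (hc : 1 ≤ c) {I : ℝ × ℝ} (hI : IsGap ρ p c I) :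
    compactPL (Set.Ioo I.1 I.2) ≤
      spreadGroup G ρ (nearby c (Set.Icc I.1 I.2)) (Set.Icc I.1 I.2) := by
  obtain ⟨s, t⟩ := I
  have hst : s < t := hI.lt
  dsimp only at *
  have HU : ∀ i ∈ nearby c (Set.Icc s t), compactPL (openUnitI i) ≤
      spreadGroup G ρ (nearby c (Set.Icc s t)) (unitI i) := by
    obtain ⟨b, n, hbn⟩ := exists_nearby_Icc_eq hc hst
    rw [hbn]
    exact SimpleLeftOrderable.compactPL_le_spreadGroup hρ hG b n
  -- The right bound on the support advances by half a unit at each step of the induction.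
  have key : ∀ k : ℕ, compactPL (Set.Ioo s (min t ((⌊2 * s⌋ + k + 1) / 2))) ≤
      spreadGroup G ρ (nearby c (Set.Icc s t)) (Set.Icc s t) := by
    have hs1 := Int.floor_le (2 * s)
    have hs2 := Int.lt_floor_add_one (2 * s)
    intro k
    induction k with
    | zero =>
      intro h hh
      refine hI.mem_spreadGroup_of_unitI hc (i := ⌊2 * s⌋) (HU _ ⟨s, ⟨le_rfl, hst.le⟩, ?_⟩)
        (compactPL_mono (Set.Ioo_subset_Ioo le_rfl (min_le_left _ _)) hh)
        (compactPL_mono (Set.Ioo_subset_Ioo ?_ ((min_le_right _ _).trans ?_)) hh)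
      · rw [abs_le]; constructor <;> linarith
      · linarith
      · push_cast; linarith
    | succ k ih =>
      intro h hh
      set i : ℤ := ⌊2 * s⌋ + k + 1 with hi
      have hiR : (i : ℝ) = ⌊2 * s⌋ + k + 1 := by push_cast [hi]; ring
      have hk0 : (0 : ℝ) ≤ k := k.cast_nonneg
      rw [← hiR] at ih
      have hh' : h ∈ compactPL (Set.Ioo s (min t ((i + 1) / 2))) := by
        rw [hiR]; push_cast at hh ⊢; rwa [← add_assoc] at hh
      have hsi : s < (i : ℝ) / 2 := by linarith
      obtain ⟨a, b, ha, hb, ha1, hab, hb1, hfix⟩ := exists_dyadic_support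
        (lt_min hst (by linarith)) hh'
      rw [lt_min_iff] at hb1
      have hfix' : ∀ x, x ∉ Set.Icc a b → h x = x := fun x hx => hfix x fun h => hx ⟨h.1.le, h.2.le⟩
      rcases lt_or_ge b (min t ((i : ℝ) / 2)) with hbi | hbi
      · exact ih (mem_compactPL_Ioo hh.1 ha1 hbi hfix')
      have hbi' : (i : ℝ) / 2 ≤ b := by
        rcases min_choice t ((i : ℝ) / 2) with h | h <;> rw [h] at hbi
        · linarith [hb1.1]
        · exact hbi
      have hit : (i : ℝ) / 2 < t := by linarith [hb1.1]
      rw [min_eq_right hit.le] at ih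
      obtain ⟨d, hd, hd1, hd2⟩ := exists_dyadic_between
        (max_lt hsi (show ((i : ℝ) - 1) / 2 < i / 2 by linarith))
      rw [max_lt_iff] at hd1
      -- `γ` is supported in both the gap and `unitI i`, so its spread is available. It pulls the
      -- right end `b` of the support back below `i / 2`, where the induction hypothesis applies.
      obtain ⟨γ, hγ, hγb⟩ := exists_compactPL_eqOn (a := max s (((i : ℝ) - 1) / 2))
        (b := min t (((i : ℝ) + 1) / 2)) (affineMap_mem 0 (dyadic_sub hd hb)) hb hb le_rfl
        (max_lt (by linarith) (by linarith)) (lt_min hb1.1 hb1.2)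
        (by simp only [affineMap_apply, zpow_zero, one_mul, add_sub_cancel]; exact max_lt hd1.1 hd1.2)
        (by
          simp only [affineMap_apply, zpow_zero, one_mul, add_sub_cancel]
          exact lt_min (by linarith) (by linarith))
      have hγbd : γ b = d := by
        rw [hγb b ⟨le_rfl, le_rfl⟩, affineMap_apply, zpow_zero]; ring
      have hγ1 : γ ∈ compactPL (Set.Ioo s t) :=
        compactPL_mono (Set.Ioo_subset_Ioo (le_max_left _ _) (min_le_left _ _)) hγ
      have hγ2 : γ ∈ compactPL (openUnitI i) :=
        compactPL_mono (Set.Ioo_subset_Ioo (le_max_right _ _) (min_le_right _ _)) hγ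
      have hγG := hI.mem_spreadGroup_of_unitI hc (i := i) (HU i ⟨(i : ℝ) / 2, ⟨hsi.le, hit.le⟩,
        by simp; linarith⟩) hγ1 hγ2
      have hγa : s < γ a :=
        ((compactPL_apply_mem_iff subset_rfl hγ1 a).2 ⟨ha1, by linarith [hb1.1]⟩).1
      have hconj : γ * h * γ⁻¹ ∈ compactPL (Set.Ioo s (i / 2)) := by
        refine mem_compactPL_Ioo (a' := γ a) (b' := γ b) (mul_mem (mul_mem hγ.1 hh.1) (inv_mem hγ.1))
          hγa (by rw [hγbd]; exact hd2) fun x hx => ?_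
        rw [orderIso_mul_apply, orderIso_mul_apply, hfix', orderIso_apply_inv_self]
        intro hx'
        apply hx
        rw [← OrderIso.image_Icc]
        exact ⟨_, hx', by simp⟩
      have := mul_mem (mul_mem (inv_mem hγG) (ih hconj)) hγG
      simpa [mul_assoc] using this
  obtain ⟨k, hk⟩ := exists_nat_ge (2 * t - ⌊2 * s⌋)
  have := key k
  rwa [min_eq_left (by linarith)] at this

end


/-! ### Families of maps indexed by the classes of gaps -/

section

variable {ρ : ℤ → Letter} {p c : ℝ}

/-- The representative of a class of gaps. -/
noncomputable def repGap (q : Quotient (gapSetoid ρ p c)) : ℝ × ℝ := q.out.1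

theorem isGap_repGap (q : Quotient (gapSetoid ρ p c)) : IsGap ρ p c (repGap q) := q.out.2

theorem IsGap.exists_carries_repGap {I : ℝ × ℝ} (hI : IsGap ρ p c I) :
    ∃ q : Quotient (gapSetoid ρ p c), ∃ σ, Carries ρ c σ (repGap q) I :=
  ⟨Quotient.mk _ ⟨I, hI⟩, Quotient.mk_out (s := gapSetoid ρ p c) ⟨I, hI⟩⟩

/-- Compactly supported elements on the representatives of the classes of gaps. -/
abbrev GapFamily (ρ : ℤ → Letter) (p c : ℝ) : Type :=
  ∀ q : Quotient (gapSetoid ρ p c), compactPL (Set.Ioo (repGap q).1 (repGap q).2)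

/-- `f` acts on every gap as a copy of the member of the family `h` given by its class. -/
def GapSpread (h : GapFamily ρ p c) (f : ℝ ≃o ℝ) : Prop :=
  ∀ q, ∀ σ, Matches ρ σ (nearby c (Set.Icc (repGap q).1 (repGap q).2)) →
    ∀ y ∈ Set.Icc (repGap q).1 (repGap q).2, f (σ • y) = σ • (h q : ℝ ≃o ℝ) y

/-- The gaps cover the line and each is carried from its representative. -/
theorem GapSpread.unique (hρ : IsLabelling ρ) (hq : IsQuasiPeriodic ρ) {h : GapFamily ρ p c}
    {f f' : ℝ ≃o ℝ} (H : GapSpread h f) (H' : GapSpread h f') : f = f' := by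
  ext x
  obtain ⟨I, hI, hx⟩ := exists_isGap_mem hρ hq p c x
  obtain ⟨q, σ, hσ⟩ := hI.exists_carries_repGap
  have hy : σ⁻¹ • x ∈ Set.Icc (repGap q).1 (repGap q).2 := by rwa [← hσ.mem_Icc, smul_inv_smul]
  rw [← smul_inv_smul σ x, H q σ hσ.matches_ _ hy, H' q σ hσ.matches_ _ hy]

theorem GapSpread.injective {h h' : GapFamily ρ p c} {f : ℝ ≃o ℝ} (H : GapSpread h f)
    (H' : GapSpread h' f) : h = h' := by
  funext q
  apply Subtype.ext
  ext x
  by_cases hx : x ∈ Set.Icc (repGap q).1 (repGap q).2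
  · have h1 := H q 1 (matches_one _ _) x hx
    have h2 := H' q 1 (matches_one _ _) x hx
    simp only [one_smul] at h1 h2
    rw [← h1, ← h2]
  · have hx' : x ∉ Set.Ioo (repGap q).1 (repGap q).2 := fun h => hx (Set.Ioo_subset_Icc_self h)
    rw [compactPL_apply_of_notMem (h q).2 hx', compactPL_apply_of_notMem (h' q).2 hx']

theorem GapSpread.mul {h h' : GapFamily ρ p c} {f f' : ℝ ≃o ℝ} (H : GapSpread h f)
    (H' : GapSpread h' f') : GapSpread (h * h') (f * f') := by
  intro q σ hσ y hy
  rw [orderIso_mul_apply, H' q σ hσ y hy,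
    H q σ hσ _ ((compactPL_apply_mem_iff Set.Ioo_subset_Icc_self (h' q).2 y).2 hy)]
  rfl

theorem gapSpread_one : GapSpread (1 : GapFamily ρ p c) 1 := fun _ _ _ _ _ => rfl

variable {G : Subgroup (ℝ ≃o ℝ)}

/-- Gaps of different classes meet at most at endpoints, where `k` is trivial, so the spread over
one class does not disturb the others. -/
theorem exists_gapSpread_mulSingle [DecidableEq (Quotient (gapSetoid ρ p c))] (hρ : IsLabelling ρ)
    (hG : ∀ i, ∀ u ∈ compactF, gen ρ i u ∈ G) (hc : 1 ≤ c) (q : Quotient (gapSetoid ρ p c))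
    (k : compactPL (Set.Ioo (repGap q).1 (repGap q).2)) :
    ∃ f ∈ G, GapSpread (Pi.mulSingle q k : GapFamily ρ p c) f := by
  obtain ⟨-, f, hf, H⟩ := (isGap_repGap q).compactPL_le_spreadGroup hρ hG hc k.2
  refine ⟨f, hf, fun q' σ hσ y hy => ?_⟩
  by_cases hqq : q' = q
  · subst hqq
    rw [Pi.mulSingle_eq_same, H.1 σ hσ y hy]
  rw [Pi.mulSingle_eq_of_ne hqq]
  change f (σ • y) = σ • y
  by_cases hex : ∃ τ, Matches ρ τ (nearby c (Set.Icc (repGap q).1 (repGap q).2)) ∧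
      ∃ z ∈ Set.Icc (repGap q).1 (repGap q).2, σ • y = τ • z
  · obtain ⟨τ, hτ, z, hz, he⟩ := hex
    rw [he, H.1 τ hτ z hz, compactPL_apply_of_notMem k.2]
    intro hz'
    obtain ⟨J, hJ, hσJ, -⟩ := (isGap_repGap q').exists_carries hσ
    obtain ⟨J', hJ', hτJ, -⟩ := (isGap_repGap q).exists_carries hτ
    have : J = J' := hJ.eq_of_mem hJ' ((hσJ.mem_Icc y).2 hy) (he ▸ (hτJ.mem_Ioo z).2 hz')
    subst this
    apply hqq
    rw [← Quotient.out_eq q', ← Quotient.out_eq q]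
    exact Quotient.sound ⟨_, hσJ.trans hτJ.symm⟩
  · exact H.2 _ fun τ hτ z hz he => hex ⟨τ, hτ, z, hz, he⟩

theorem exists_gapSpread (hρ : IsLabelling ρ) (hq : IsQuasiPeriodic ρ)
    (hG : ∀ i, ∀ u ∈ compactF, gen ρ i u ∈ G) (hc : 1 ≤ c) (h : GapFamily ρ p c) :
    ∃ f ∈ G, GapSpread h f := by
  classical
  have := finite_gap_classes hρ hq p c
  have := Fintype.ofFinite (Quotient (gapSetoid ρ p c))
  have key : ∀ A : Finset (Quotient (gapSetoid ρ p c)), ∀ h : GapFamily ρ p c, (∀ q, q ∉ A → h q = 1) →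
      ∃ f ∈ G, GapSpread h f := by
    intro A
    induction A using Finset.induction_on with
    | empty =>
      intro h hA
      have : h = 1 := funext fun q => hA q (by simp)
      exact ⟨1, one_mem _, this ▸ gapSpread_one⟩
    | insert q A hqA ih =>
      intro h hA
      obtain ⟨f, hf, H⟩ := exists_gapSpread_mulSingle hρ hG hc q (h q)
      obtain ⟨f', hf', H'⟩ := ih (Function.update h q 1) fun q' hq' => by
        by_cases he : q' = q
        · subst he; simp
        · rw [Function.update_of_ne he]
          exact hA q' (by simp [he, hq'])
      refine ⟨f * f', mul_mem hf hf', ?_⟩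
      have : h = Pi.mulSingle q (h q) * Function.update h q 1 := by
        funext q'
        by_cases he : q' = q
        · subst he; simp
        · simp [he]
      rw [this]
      exact H.mul H'
  exact key Finset.univ h fun q hq => absurd (Finset.mem_univ q) hq

/-- The homomorphism which spreads a family over all gaps. -/
noncomputable def gapHom (hρ : IsLabelling ρ) (hq : IsQuasiPeriodic ρ)
    (hG : ∀ i, ∀ u ∈ compactF, gen ρ i u ∈ G) (hc : 1 ≤ c) : GapFamily ρ p c →* (ℝ ≃o ℝ) :=
  MonoidHom.mk' (fun h => (exists_gapSpread hρ hq hG hc h).choose) fun h h' =>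
    (exists_gapSpread hρ hq hG hc (h * h')).choose_spec.2.unique hρ hq
      ((exists_gapSpread hρ hq hG hc h).choose_spec.2.mul (exists_gapSpread hρ hq hG hc h').choose_spec.2)

theorem gapHom_spec (hρ : IsLabelling ρ) (hq : IsQuasiPeriodic ρ)
    (hG : ∀ i, ∀ u ∈ compactF, gen ρ i u ∈ G) (hc : 1 ≤ c) (h : GapFamily ρ p c) :
    gapHom hρ hq hG hc h ∈ G ∧ GapSpread h (gapHom hρ hq hG hc h) :=
  (exists_gapSpread hρ hq hG hc h).choose_spec

theorem IsMark.dyadic {x : ℝ} (hp : p ∈ dyadic) (hx : IsMark ρ p c x) : x ∈ dyadic := by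
  obtain ⟨σ, -, rfl⟩ := hx
  rcases Int.units_eq_one_or σ.e with hs | hs
  · rw [Dihedral.smul_real_of_one hs]
    exact dyadic_add hp (dyadic_intCast _)
  · rw [Dihedral.smul_real_of_neg hs]
    exact dyadic_add (dyadic_neg hp) (dyadic_intCast _)

/-- An element of `localGroup ρ` which is the identity near `p` acts on the gaps. -/
theorem exists_gapSpread_of_eqOn {f : ℝ ≃o ℝ} (hf : ∀ a b, ∃ γ ∈ dyadicPL, ∀ x ∈ Set.Icc a b, f x = γ x)
    {r ε : ℝ} (hr : ∀ (σ : Dihedral) (y : ℝ), Matches ρ σ (window (y - r) (y + r)) → f (σ • y) = σ • f y)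
    (hε : 0 < ε) (hp : p ∈ dyadic) (hfix : ∀ x, |x - p| ≤ ε → f x = x) (hc : r + ε ≤ c) :
    ∃ h : GapFamily ρ p c, GapSpread h f := by
  -- Local equivariance carries triviality near `p` to every mark; `r + ε ≤ c` puts the needed
  -- labels among those respected.
  have hmark : ∀ s, IsMark ρ p c s → ∀ x, |x - s| ≤ ε → f x = x := by
    rintro _ ⟨σ, hσ, rfl⟩ x hx
    rw [← smul_inv_smul σ x, Dihedral.abs_smul_sub_smul] at hx
    have h1 := hr σ (σ⁻¹ • x) (hσ.mono (window_subset_nearby (Set.mem_singleton p) (by linarith)))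
    rwa [hfix _ hx, smul_inv_smul] at h1
  have hrestrict : ∀ I, IsGap ρ p c I → ∃ k ∈ compactPL (Set.Ioo I.1 I.2), ∀ x ∈ Set.Icc I.1 I.2, f x = k x := by
    intro I hI
    obtain ⟨γ, hγ, hfγ⟩ := hf I.1 I.2
    have hlt := hI.lt
    have e1 : γ I.2 = (1 : ℝ ≃o ℝ) I.2 := by
      rw [← hfγ _ ⟨hlt.le, le_rfl⟩, hmark _ hI.right _ (by simpa using hε.le)]; rfl
    have e2 : (1 : ℝ ≃o ℝ) I.1 = join I.2 γ 1 e1 I.1 := by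
      rw [join_of_le _ hlt.le, ← hfγ _ ⟨le_rfl, hlt.le⟩, hmark _ hI.left _ (by simpa using hε.le)]; rfl
    have hk : ∀ x ∈ Set.Icc I.1 I.2, f x = join I.1 1 (join I.2 γ 1 e1) e2 x := fun x hx => by
      rw [join_of_ge _ hx.1, join_of_le _ hx.2, hfγ x hx]
    refine ⟨join I.1 1 (join I.2 γ 1 e1) e2, mem_compactPL_Ioo (a' := I.1 + ε) (b' := I.2 - ε)
      (join_mem (hI.left.dyadic hp) _ (one_mem _) (join_mem (hI.right.dyadic hp) _ hγ (one_mem _)))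
      (by linarith) (by linarith) fun x hx => ?_, hk⟩
    rcases le_or_gt x I.1 with h1 | h1
    · rw [join_of_le _ h1]; rfl
    rcases le_or_gt I.2 x with h2 | h2
    · rw [join_of_ge _ h1.le, join_of_ge _ h2]; rfl
    rw [← hk x ⟨h1.le, h2.le⟩]
    rcases lt_or_ge x (I.1 + ε) with h3 | h3
    · exact hmark _ hI.left x (by rw [abs_le]; constructor <;> linarith)
    · have h4 : I.2 - ε < x := not_le.1 fun h4 => hx ⟨h3, h4⟩
      exact hmark _ hI.right x (by rw [abs_le]; constructor <;> linarith)
  choose k hk hfk using fun q : Quotient (gapSetoid ρ p c) => hrestrict _ (isGap_repGap q)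
  refine ⟨fun q => ⟨k q, hk q⟩, fun q σ hσ y hy => ?_⟩
  rw [hr σ y (hσ.mono (window_subset_nearby hy (by simp; linarith))), hfk q y hy]

end

/-- Marks are dyadic because `p` is, so each gap contributes a copy of `F'`. The number of copies is
the number of classes, positive since some gap contains `0`. -/
theorem nonempty_gapFamily_mulEquiv {ρ : ℤ → Letter} {p : ℝ} (hρ : IsLabelling ρ) (hq : IsQuasiPeriodic ρ)
    (hp : p ∈ dyadic) (c : ℝ) :
    ∃ n : ℕ, 1 ≤ n ∧ Nonempty (GapFamily ρ p c ≃* (Fin n → commutator thompsonF)) := by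
  have := finite_gap_classes hρ hq p c
  obtain ⟨n, ⟨e⟩⟩ := Finite.exists_equiv_fin (Quotient (gapSetoid ρ p c))
  obtain ⟨I, hI, -⟩ := exists_isGap_mem hρ hq p c 0
  have hn : 1 ≤ n := Fin.pos (e (Quotient.mk _ ⟨I, hI⟩))
  have he : ∀ q : Quotient (gapSetoid ρ p c),
      Nonempty (compactPL (Set.Ioo (repGap q).1 (repGap q).2) ≃* commutator thompsonF) := fun q =>
    nonempty_mulEquiv_compactPL ((isGap_repGap q).left.dyadic hp) ((isGap_repGap q).right.dyadic hp)
      (isGap_repGap q).lt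
  exact ⟨n, hn, ⟨(MulEquiv.piCongrRight fun q => (he q).some).trans (MulEquiv.arrowCongr e (MulEquiv.refl _))⟩⟩

end SimpleLeftOrderable

/-! ### The decomposition of an element -/

open SimpleLeftOrderable in
/-- All actions are right actions in the mathematical statement, so its product `g₁ g₂`, "first `g₁`,
then `g₂`", is `g₂ * g₁` here. The derived group `F'` is `commutator thompsonF`. -/
theorem mainTheorem3 (ρ : ℤ → Letter) (hρ : IsLabelling ρ) (hquasi : IsQuasiPeriodic ρ)
    (c₀ ν₂ ν₃ : unitInterval ≃o unitInterval) (hc₀ : IsBaseElement c₀) (hν : IsMiddlePair ν₂ ν₃)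
    (f : ℝ ≃o ℝ) (hf : f ∈ simpleGroup ρ c₀ ν₂ ν₃) :
    ∃ g₁ ∈ simpleGroup ρ c₀ ν₂ ν₃, ∃ g₂ ∈ simpleGroup ρ c₀ ν₂ ν₃,
      f = g₂ * g₁ ∧
      (∃ x ∈ simpleGroup ρ c₀ ν₂ ν₃, ∃ y ∈ simpleGroup ρ c₀ ν₂ ν₃,
        g₂ = x * y * x⁻¹ * y⁻¹) ∧
      ∃ K : Subgroup (ℝ ≃o ℝ), K ≤ simpleGroup ρ c₀ ν₂ ν₃ ∧ g₁ ∈ K ∧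
        ∃ n : ℕ, 1 ≤ n ∧ Nonempty (K ≃* (Fin n → commutator thompsonF)) := by
  have hG : ∀ i, ∀ u ∈ compactF, gen ρ i u ∈ simpleGroup ρ c₀ ν₂ ν₃ := fun i u hu =>
    gen_mem_simpleGroup ρ hc₀ hν i hu
  have hle := simpleGroup_le_localGroup ρ hc₀ hν
  set G := simpleGroup ρ c₀ ν₂ ν₃
  obtain ⟨p₀, hp₀⟩ := exists_fixed_point hρ hquasi (hle hf)
  obtain ⟨a, b, ha, hb, hab, x, hx, y, hy, hxy⟩ := exists_commutator_eqOn hG (hle hf) hp₀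
  have hg₂ : x * y * x⁻¹ * y⁻¹ ∈ G := mul_mem (mul_mem (mul_mem hx hy) (inv_mem hx)) (inv_mem hy)
  have hg₁ : (x * y * x⁻¹ * y⁻¹)⁻¹ * f ∈ G := mul_mem (inv_mem hg₂) hf
  refine ⟨_, hg₁, _, hg₂, by group, ⟨x, hx, y, hy, rfl⟩, ?_⟩
  have hfix : ∀ z ∈ Set.Icc a b, ((x * y * x⁻¹ * y⁻¹)⁻¹ * f) z = z := fun z hz => by
    rw [orderIso_mul_apply, orderIso_inv_apply_eq, hxy z hz]
  set g₁ := (x * y * x⁻¹ * y⁻¹)⁻¹ * f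
  obtain ⟨-, ⟨r, hr⟩, hPL⟩ := hle hg₁
  have hp : (a + b) / 2 ∈ dyadic := by
    have := dyadic_zpow_mul (-1) (dyadic_add ha hb)
    rwa [zpow_neg_one, inv_mul_eq_div] at this
  -- This is the constant `c` for the marks: the second term serves the equivariance of `g₁` near
  -- the marks, and the bound `1` makes the half integers near a gap a nonempty block.
  have hc : 1 ≤ max 1 (r + (b - a) / 2) := le_max_left _ _
  obtain ⟨h, hh⟩ := exists_gapSpread_of_eqOn hPL hr (ε := (b - a) / 2) (by linarith) hp
    (fun z hz => hfix z (by
      rw [abs_le] at hz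
      constructor <;> linarith [hz.1, hz.2])) (le_max_right 1 _)
  obtain ⟨n, hn, ⟨φ⟩⟩ := nonempty_gapFamily_mulEquiv hρ hquasi hp (max 1 (r + (b - a) / 2))
  have hinj : Function.Injective (gapHom (p := (a + b) / 2) hρ hquasi hG hc) := fun h₁ h₂ he =>
    (gapHom_spec hρ hquasi hG hc h₁).2.injective (he ▸ (gapHom_spec hρ hquasi hG hc h₂).2)
  refine ⟨(gapHom (p := (a + b) / 2) hρ hquasi hG hc).range, ?_, ⟨h, ?_⟩, n, hn,
    ⟨(MonoidHom.ofInjective hinj).symm.trans φ⟩⟩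
  · rintro _ ⟨h', rfl⟩
    exact (gapHom_spec hρ hquasi hG hc h').1
  -- `g₁` and the image of `h` are spreads of the same family, hence equal.
  · exact (gapHom_spec hρ hquasi hG hc h).2.unique hρ hquasi hh
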